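/- Let $P\subseteq\{3,4,\ldots,\omega\}$ be nonempty. A \emph{dendrite} is a compact, connected, locally connected, metrizable space in which any two distinct points are the endpoints of a unique arc. The order of a point $x$ of a dendrite $X$ is the number of connected components of $X\setminus\{x\}$, and $x$ is a ramification point if its order is at least $3$. A Ważewski dendrite $W_P$ is a dendrite with more than one point in which for every $p\in P$ the ramification points of order $p$ are arcwise dense (they meet every nondegenerate arc), and in which every ramification point has order in $P$ (these two properties are known to determine $W_P$ up to homeomorphism). For a topological group $G$ acting continuously on a compact metric space $X$, let $E(X,G)$ be the closure of $\{x\mapsto gx : g\in G\}$ in $X^X$ with the topology of pointwise convergence. The system $(X,G)$ is \emph{tame} if $E(X,G)$ is a Rosenthal compactum, i.e. homeomorphic to a compact subspace of the space of Baire class 1 functions $Y\to\mathbb R$ (with pointwise convergence) for some Polish space $Y$; \emph{rigid} if some sequence in $E(X,G)\setminus\{\mathrm{Id}_X\}$ converges pointwise to $\mathrm{Id}_X$; \emph{minimal} if every orbit is dense; \emph{equicontinuous} if $\{x\mapsto gx: g\in G\}$ is an equicontinuous family; and \emph{hereditarily nonsensitive} if for every nonempty closed $G$-invariant $Y\subseteq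 X$ and every $\varepsilon>0$ there is a nonempty relatively open $O\subseteq Y$ with $\operatorname{diam}(gO)\le\varepsilon$ for all $g\in G$. Then a Ważewski dendrite $W_P$ exists, and for every such $W_P$ and the natural action of $\mathrm{Homeo}(W_P)$ (a topological group in the compact-open topology, acting continuously) on $W_P$, with any compatible metric: there is a sequence of non-identity homeomorphisms $g_i\in\mathrm{Homeo}(W_P)$ converging pointwise to $\mathrm{Id}_{W_P}$; in particular the system $(W_P,\mathrm{Homeo}(W_P))$ is rigid. Moreover it is tame and minimal, but it is neither hereditarily nonsensitive nor equicontinuous. Hence there is a tame, rigid, minimal metric system which is neither hereditarily nonsensitive nor equicontinuous, which answers Question 5.6 of Glasner–Megrelishvili (asking for a tame, rigid, metric system that is not hereditarily nonsensitive, and for a tame, rigid, minimal, metric system that is not equicontinuous). -/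

import Mathlib

open Set Filter Topology Uniformity

universe u

/-! ### Dendrites -/

/-- `A` is an arc in `X` with endpoints `x` and `y`. -/
def IsArcBetween {X : Type*} [TopologicalSpace X] (x y : X) (A : Set X) : Prop :=
  ∃ γ : unitInterval → X, IsEmbedding γ ∧ γ 0 = x ∧ γ 1 = y ∧ range γ = A

/-- A dendrite: a compact, connected, locally connected, metrizable space in which any two distinct
points are the endpoints of a unique arc. -/
structure IsDendrite (X : Type*) [TopologicalSpace X] : Prop where
  compact : CompactSpace X
  connected : ConnectedSpace X
  locallyConnected : LocallyConnectedSpace X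
  metrizable : TopologicalSpace.MetrizableSpace X
  existsUnique_arc : ∀ x y : X, x ≠ y → ∃! A : Set X, IsArcBetween x y A

/-- The order of a point `x`: the number of connected components of `X ∖ {x}`
(with `⊤` for infinitely many; in a dendrite these are always at most countable, so `⊤` is `ω`). -/
noncomputable def pointOrder {X : Type*} [TopologicalSpace X] (x : X) : ℕ∞ :=
  ENat.card (ConnectedComponents ({x}ᶜ : Set X))

/-- `x` is a ramification point if its complement has at least three connected components. -/
def IsRamificationPoint {X : Type*} [TopologicalSpace X] (x : X) : Prop :=
  3 ≤ pointOrder x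

/-- A set is arcwise dense if it meets every (nondegenerate) arc. -/
def ArcwiseDense {X : Type*} [TopologicalSpace X] (D : Set X) : Prop :=
  ∀ (x y : X) (A : Set X), IsArcBetween x y A → (D ∩ A).Nonempty

/-- `X` is (a copy of) the Ważewski dendrite `W_P`: a nondegenerate dendrite in which, for every
`p ∈ P`, the ramification points of order `p` are arcwise dense, and in which every ramification
point has order in `P`. -/
structure IsWazewskiDendrite (P : Set ℕ∞) (X : Type*) [TopologicalSpace X] : Prop where
  dendrite : IsDendrite X
  nontrivial : Nontrivial X
  arcwiseDense : ∀ p ∈ P, ArcwiseDense {x : X | IsRamificationPoint x ∧ pointOrder x = p}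
  order_mem : ∀ x : X, IsRamificationPoint x → pointOrder x ∈ P

/-! ### Dynamical systems -/

/-- `(X, G)` is a dynamical system: a topological group acting continuously on a compact space. -/
structure IsDynamicalSystem (G X : Type*) [Group G] [TopologicalSpace G] [TopologicalSpace X]
    [MulAction G X] : Prop where
  topologicalGroup : IsTopologicalGroup G
  compact : CompactSpace X
  continuousSMul : ContinuousSMul G X

/-- The Ellis semigroup `E(X, G)`: the closure of (the image of) `G` in `X ^ X` for the topology of
pointwise convergence. -/
def ellisSemigroup (G X : Type*) [Group G] [TopologicalSpace X] [MulAction G X] : Set (X → X) :=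
  closure (range fun (g : G) (x : X) => g • x)

/-- Baire class one functions: preimages of open sets are `F_σ` (complements of `G_δ` sets). -/
def IsBaireClassOne {Y Z : Type*} [TopologicalSpace Y] [TopologicalSpace Z] (f : Y → Z) : Prop :=
  ∀ U : Set Z, IsOpen U → IsGδ (f ⁻¹' U)ᶜ

/-- A Rosenthal compactum: a space homeomorphic to a compact subspace of the space of Baire class
one functions `Y → ℝ`, with the topology of pointwise convergence, for some Polish space `Y`. -/
def IsRosenthalCompactum (K : Type*) [TopologicalSpace K] : Prop :=
  CompactSpace K ∧
    ∃ (Y : Type) (_ : TopologicalSpace Y), PolishSpace Y ∧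
      ∃ F : K → (Y → ℝ), IsEmbedding F ∧ ∀ k, IsBaireClassOne (F k)

/-- A (metric) dynamical system is tame if its Ellis semigroup is a Rosenthal compactum. -/
def IsTameSystem (G X : Type*) [Group G] [TopologicalSpace X] [MulAction G X] : Prop :=
  IsRosenthalCompactum (ellisSemigroup G X)

/-- A dynamical system is rigid if some sequence in `E(X, G) ∖ {Id}` converges pointwise to the
identity. -/
def IsRigidSystem (G X : Type*) [Group G] [TopologicalSpace X] [MulAction G X] : Prop :=
  ∃ p : ℕ → X → X, (∀ i, p i ∈ ellisSemigroup G X ∧ p i ≠ id) ∧ Tendsto p atTop (𝓝 id)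

/-- The invariant subset `Y` of `X` is a nonsensitive system: for every entourage `V` there is a
nonempty relatively open subset of `Y` all of whose translates are `V`-small. -/
def IsNonsensitiveOn (G : Type*) {X : Type*} [Group G] [UniformSpace X] [MulAction G X]
    (Y : Set X) : Prop :=
  ∀ V ∈ 𝓤 X, ∃ O : Set X, IsOpen O ∧ (O ∩ Y).Nonempty ∧
    ∀ g : G, ∀ x ∈ O ∩ Y, ∀ y ∈ O ∩ Y, (g • x, g • y) ∈ V

/-- Hereditarily nonsensitive: every nonempty closed invariant subset is nonsensitive. -/
def IsHereditarilyNonsensitive (G X : Type*) [Group G] [UniformSpace X] [MulAction G X] : Prop :=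
  ∀ Y : Set X, IsClosed Y → Y.Nonempty → (∀ g : G, ∀ y ∈ Y, g • y ∈ Y) → IsNonsensitiveOn G Y

/-- The maps `x ↦ g • x`, `g ∈ G`, form an equicontinuous family. -/
def IsEquicontinuousSystem (G X : Type*) [Group G] [UniformSpace X] [MulAction G X] : Prop :=
  Equicontinuous fun (g : G) (x : X) => g • x

/-! ### The homeomorphism group and its natural action -/

/-- The natural action of `Homeo(X)` on `X`. -/
instance homeoMulAction (X : Type*) [TopologicalSpace X] : MulAction (X ≃ₜ X) X where
  smul f x := f x
  one_smul _ := rfl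
  mul_smul _ _ _ := rfl

/-- The compact-open topology on `Homeo(X)`, imposed on both `f` and `f⁻¹` so that inversion is
continuous (for compact Hausdorff `X` this is the compact-open topology on `f` alone). -/
instance homeoTopologicalSpace (X : Type*) [TopologicalSpace X] : TopologicalSpace (X ≃ₜ X) :=
  TopologicalSpace.induced
    (fun f => ((⟨f, f.continuous⟩ : C(X, X)), (⟨f.symm, f.symm.continuous⟩ : C(X, X))))
    inferInstance

/-! ### Arcs -/

section Arcs

variable {X : Type*} [TopologicalSpace X]

/-! Everything is reduced to rooted trees. After choosing a root `e`, a dendrite is ordered by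
letting `x ≤ y` when `x` lies on the arc from `e` to `y`. This gives a compact meet-semilattice in
which the points below a given point form a chain (`IsDendrite.exists_treeSpace`). Continuity of the
meet rests on arcs between nearby points being small; this follows from local connectedness by
building a path from ever finer chains of connected sets and erasing its loops. In a rooted tree the
connected sets are exactly the convex ones, so betweenness is preserved by homeomorphisms, although
the order is not.

Tameness: betweenness is a closed relation, so every pointwise limit of homeomorphisms preserves it
and pulls half-spaces back to half-spaces. A half-space is open or closed, and finite intersections
of half-spaces form neighbourhood bases, so every element of the Ellis semigroup is of Baire class
one (`isBaireClassOne_of_tbtw`).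

The other dynamical properties come from homogeneity. A back-and-forth argument on the countable set
of ramification points extends every finite partial isomorphism to a homeomorphism
(`IsFinitePartialIso.exists_homeomorph`). Every nonempty open set contains a whole branch
(`IsWazewskiTree.exists_branch_subset`), so a branch given by two points of order `p ∈ P` can be
moved into any nonempty open set. This yields minimality; the inverse maps spread tiny sets over a
fixed pair of points, which excludes nonsensitivity and equicontinuity; and conjugating a
homeomorphism supported in a branch produces nontrivial homeomorphisms with arbitrarily small
support, whence rigidity.

Existence is shown by an explicit model: a point is the record of the distances travelled along
segments, with side segments attached at rational positions according to a labelling with dense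
fibres. -/

theorem isArcBetween_range_of_fibers [T2Space X] {K : Type*} [TopologicalSpace K] [CompactSpace K]
    {h : K → ℝ} {g : K → X} (hc : Continuous h) (gc : Continuous g)
    (hg : ∀ u v, h u = h v ↔ g u = g v) {a b : ℝ} (hab : a < b) (hr : range h = Icc a b)
    {u v : K} (hu : h u = a) (hv : h v = b) : IsArcBetween (g u) (g v) (range g) := by
  have hba : 0 < b - a := sub_pos.2 hab
  have hmem : ∀ k, (h k - a) / (b - a) ∈ unitInterval := fun k => by
    have : h k ∈ Icc a b := hr ▸ mem_range_self k
    exact ⟨div_nonneg (by linarith [this.1]) hba.le, (div_le_one hba).2 (by linarith [this.2])⟩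
  set q : K → unitInterval := fun k => ⟨(h k - a) / (b - a), hmem k⟩ with hq
  have qc : Continuous q := by fun_prop
  have qe : ∀ k l, q k = q l ↔ g k = g l := fun k l => by
    rw [← hg, hq, Subtype.mk.injEq, div_left_inj' hba.ne', sub_left_inj]
  have qs : Function.Surjective q := fun t => by
    have : a + t * (b - a) ∈ range h := by
      rw [hr]; exact ⟨by nlinarith [t.2.1], by nlinarith [t.2.2]⟩
    obtain ⟨k, hk⟩ := this
    refine ⟨k, Subtype.ext ?_⟩
    simp only [hq, hk]
    field_simp
    ring
  choose s hs using qs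
  have hsg : ∀ k, g (s (q k)) = g k := fun k => (qe _ _).1 (hs _)
  -- The map `q` is a continuous closed surjection, hence a quotient map; `g` is constant on its
  -- fibres and therefore descends to a continuous map.
  have hσ : Continuous (fun t => g (s t)) := by
    refine (qc.isClosedMap.isQuotientMap qc fun t => ⟨s t, hs t⟩).continuous_iff.2 ?_
    convert gc using 1
    exact funext hsg
  have hinj : Function.Injective (fun t => g (s t)) := fun t t' e => by
    rw [← hs t, ← hs t']; exact (qe _ _).2 e
  refine ⟨fun t => g (s t), (hσ.isClosedEmbedding hinj).isEmbedding, ?_, ?_, ?_⟩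
  · rw [← hsg u]; congr 2; exact Subtype.ext (by simp [hq, hu])
  · rw [← hsg v]; congr 2; exact Subtype.ext (by simp [hq, hv, hba.ne'])
  · exact Subset.antisymm (range_subset_iff.2 fun t => mem_range_self _)
      (range_subset_iff.2 fun k => ⟨q k, hsg k⟩)

theorem isArcBetween_image_Icc [T2Space X] {γ : ℝ → X} {a b : ℝ} (hab : a < b)
    (hγ : ContinuousOn γ (Icc a b)) (hi : InjOn γ (Icc a b)) :
    IsArcBetween (γ a) (γ b) (γ '' Icc a b) := by
  rw [image_eq_range]
  exact isArcBetween_range_of_fibers (K := Icc a b) (h := Subtype.val) (g := fun t => γ t)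
    continuous_subtype_val (continuousOn_iff_continuous_domRestrict.1 hγ)
    (fun u v => ⟨fun e => by rw [e], fun e => hi u.2 v.2 e⟩) hab Subtype.range_coe
    (u := ⟨a, left_mem_Icc.2 hab.le⟩) (v := ⟨b, right_mem_Icc.2 hab.le⟩) rfl rfl

theorem IsArcBetween.exists_param {x y : X} {A : Set X} (h : IsArcBetween x y A) {a b : ℝ}
    (hab : a < b) : ∃ γ : ℝ → X, ContinuousOn γ (Icc a b) ∧ InjOn γ (Icc a b) ∧
      γ a = x ∧ γ b = y ∧ γ '' Icc a b = A := by
  obtain ⟨σ, hσ, rfl, rfl, rfl⟩ := h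
  have hba : 0 < b - a := sub_pos.2 hab
  set f : ℝ → ℝ := fun t => (t - a) / (b - a) with hf
  have fm : ∀ t ∈ Icc a b, f t ∈ unitInterval := fun t ht =>
    ⟨div_nonneg (by linarith [ht.1]) hba.le, (div_le_one hba).2 (by linarith [ht.2])⟩
  have e : ∀ t (ht : t ∈ Icc a b), projIcc (0 : ℝ) 1 zero_le_one (f t) = ⟨f t, fm t ht⟩ :=
    fun t ht => projIcc_of_mem _ (fm t ht)
  refine ⟨fun t => σ (projIcc 0 1 zero_le_one (f t)), ?_, ?_, ?_, ?_, ?_⟩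
  · exact (hσ.continuous.comp (continuous_projIcc.comp (by fun_prop))).continuousOn
  · intro t ht u hu htu
    have := hσ.injective htu
    rw [e t ht, e u hu, Subtype.mk.injEq, hf] at this
    simpa [div_left_inj' hba.ne'] using this
  · simp [hf]
  · simp [hf, hba.ne']
  · refine Subset.antisymm (image_subset_iff.2 fun t _ => mem_range_self _) ?_
    rintro _ ⟨t, rfl⟩
    have ht : a + t * (b - a) ∈ Icc a b := ⟨by nlinarith [t.2.1], by nlinarith [t.2.2]⟩
    refine ⟨_, ht, ?_⟩
    simp only [e _ ht]
    congr 1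
    exact Subtype.ext (by simp [hf, hba.ne'])

theorem IsArcBetween.symm {x y : X} {A : Set X} (h : IsArcBetween x y A) : IsArcBetween y x A := by
  obtain ⟨σ, hσ, rfl, rfl, rfl⟩ := h
  refine ⟨σ ∘ unitInterval.symmHomeomorph, hσ.comp unitInterval.symmHomeomorph.isEmbedding,
    by simp, by simp, ?_⟩
  exact unitInterval.symmHomeomorph.surjective.range_comp σ

theorem IsArcBetween.isCompact {x y : X} {A : Set X} (h : IsArcBetween x y A) : IsCompact A := by
  obtain ⟨σ, hσ, rfl, rfl, rfl⟩ := h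
  exact isCompact_range hσ.continuous

theorem IsArcBetween.isPreconnected {x y : X} {A : Set X} (h : IsArcBetween x y A) :
    IsPreconnected A := by
  obtain ⟨σ, hσ, rfl, rfl, rfl⟩ := h
  exact isPreconnected_range hσ.continuous

theorem IsArcBetween.left_mem {x y : X} {A : Set X} (h : IsArcBetween x y A) : x ∈ A := by
  obtain ⟨σ, hσ, rfl, rfl, rfl⟩ := h
  exact mem_range_self _

theorem IsArcBetween.right_mem {x y : X} {A : Set X} (h : IsArcBetween x y A) : y ∈ A :=
  h.symm.left_mem

theorem IsArcBetween.ne {x y : X} {A : Set X} (h : IsArcBetween x y A) : x ≠ y := by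
  obtain ⟨σ, hσ, rfl, rfl, rfl⟩ := h
  exact hσ.injective.ne zero_ne_one

/-- An arc contains no proper connected subset through both endpoints. -/
theorem IsArcBetween.eq_of_subset {x y : X} {A C : Set X} (h : IsArcBetween x y A)
    (hC : IsPreconnected C) (hx : x ∈ C) (hy : y ∈ C) (hCA : C ⊆ A) : C = A := by
  obtain ⟨σ, hσ, rfl, rfl, rfl⟩ := h
  have h1 : IsPreconnected (σ ⁻¹' C) := by
    rw [← hσ.isInducing.isPreconnected_image, image_preimage_eq_of_subset hCA]
    exact hC
  refine Subset.antisymm hCA ?_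
  rintro _ ⟨t, rfl⟩
  exact h1.ordConnected.out hx hy ⟨t.2.1, t.2.2⟩

theorem IsArcBetween.split [T2Space X] {x y z : X} {A : Set X} (h : IsArcBetween x y A)
    (hz : z ∈ A) (hx : z ≠ x) (hy : z ≠ y) :
    ∃ B C, IsArcBetween x z B ∧ IsArcBetween z y C ∧ A = B ∪ C ∧ B ∩ C = {z} := by
  obtain ⟨γ, hγ, hi, rfl, rfl, rfl⟩ := h.exists_param zero_lt_one
  obtain ⟨t, ht, rfl⟩ := hz
  have h0 : 0 < t := lt_of_le_of_ne ht.1 fun e => hx (by rw [e])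
  have h1 : t < 1 := lt_of_le_of_ne ht.2 fun e => hy (by rw [e])
  have s0 : Icc 0 t ⊆ Icc (0 : ℝ) 1 := Icc_subset_Icc_right h1.le
  have s1 : Icc t 1 ⊆ Icc (0 : ℝ) 1 := Icc_subset_Icc_left h0.le
  refine ⟨_, _, isArcBetween_image_Icc h0 (hγ.mono s0) (hi.mono s0),
    isArcBetween_image_Icc h1 (hγ.mono s1) (hi.mono s1), ?_, ?_⟩
  · rw [← image_union, Icc_union_Icc_eq_Icc h0.le h1.le]
  · rw [← hi.image_inter s0 s1, Icc_inter_Icc_eq_singleton h0.le h1.le, image_singleton]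

theorem IsArcBetween.concat [T2Space X] {x y z : X} {A B : Set X} (hA : IsArcBetween x y A)
    (hB : IsArcBetween y z B) (h : A ∩ B = {y}) : IsArcBetween x z (A ∪ B) := by
  obtain ⟨γ, hγ, hi, rfl, rfl, rfl⟩ := hA.exists_param zero_lt_one
  obtain ⟨δ, hδ, hj, e, rfl, rfl⟩ := hB.exists_param (a := 1) (b := 2) (by norm_num)
  set f : ℝ → X := fun t => if t ≤ 1 then γ t else δ t with hf
  have f0 : EqOn f γ (Icc 0 1) := fun t ht => if_pos ht.2
  have f1 : EqOn f δ (Icc 1 2) := fun t ht => by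
    rcases ht.1.eq_or_lt with rfl | h
    · simp [hf, e]
    · exact if_neg (not_le.2 h)
  have hu : Icc (0 : ℝ) 1 ∪ Icc 1 2 = Icc 0 2 := Icc_union_Icc_eq_Icc (by norm_num) (by norm_num)
  have c0 : ContinuousOn f (Icc 0 1) := hγ.congr f0
  have c1 : ContinuousOn f (Icc 1 2) := hδ.congr f1
  have hc : ContinuousOn f (Icc 0 2) := by
    rw [← hu]; exact c0.union_of_isClosed c1 isClosed_Icc isClosed_Icc
  have key : ∀ s ∈ Icc (0 : ℝ) 1, ∀ t ∈ Icc (1 : ℝ) 2, f s = f t → s = t := by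
    intro s hs t ht est
    rw [f0 hs, f1 ht] at est
    have hm : γ s ∈ γ '' Icc 0 1 ∩ δ '' Icc 1 2 := ⟨⟨s, hs, rfl⟩, ⟨t, ht, est.symm⟩⟩
    rw [h, mem_singleton_iff] at hm
    have h1 : s = 1 := hi hs ⟨zero_le_one, le_rfl⟩ hm
    have h2 : t = 1 := hj ht ⟨le_rfl, by norm_num⟩ (by rw [← est, hm, e])
    rw [h1, h2]
  have hinj : InjOn f (Icc 0 2) := by
    rw [← hu]
    rintro s (hs | hs) t (ht | ht) est
    · exact hi hs ht (by rwa [f0 hs, f0 ht] at est)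
    · exact key s hs t ht est
    · exact (key t ht s hs est.symm).symm
    · exact hj hs ht (by rwa [f1 hs, f1 ht] at est)
  have := isArcBetween_image_Icc two_pos hc hinj
  rw [← hu, image_union, f0.image_eq, f1.image_eq] at this
  convert this using 1
  · exact (f0 ⟨le_rfl, zero_le_one⟩).symm
  · exact (f1 ⟨by norm_num, le_rfl⟩).symm

end Arcs

/-! ### Arcwise connectedness of locally connected compact metric spaces -/

section Paths

variable {X : Type*} [MetricSpace X]

/-- `p` and `q` lie in a connected open subset of `V` of diameter at most `ε`. -/
def Linked (ε : ℝ) (V : Set X) (p q : X) : Prop :=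
  ∃ W, IsOpen W ∧ IsPreconnected W ∧ W ⊆ V ∧ p ∈ W ∧ q ∈ W ∧ ∀ a ∈ W, ∀ b ∈ W, dist a b ≤ ε

theorem linked_self [LocallyConnectedSpace X] {ε : ℝ} (hε : 0 < ε) {V : Set X} (hV : IsOpen V)
    {p : X} (hp : p ∈ V) : Linked ε V p p := by
  obtain ⟨W, hW, h1, h2, h3⟩ := locallyConnectedSpace_iff_subsets_isOpen_isConnected.1 ‹_› p
    (V ∩ Metric.ball p (ε / 2)) (inter_mem (hV.mem_nhds hp) (Metric.ball_mem_nhds _ (by positivity)))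
  refine ⟨W, h1, h3.isPreconnected, fun a ha => (hW ha).1, h2, h2, fun a ha b hb => ?_⟩
  have := Metric.mem_ball.1 (hW ha).2
  have := Metric.mem_ball.1 (hW hb).2
  linarith [dist_triangle_right a b p]

/-- Being joined by a finite chain of links is an equivalence relation on `V` with open classes, so
connectedness leaves a single class. The last clause keeps the stationary end of a chain stationary
when its links are refined. -/
theorem exists_chain [LocallyConnectedSpace X] {ε : ℝ} (hε : 0 < ε) {V : Set X} (hV : IsOpen V)
    (hc : IsPreconnected V) {p q : X} (hp : p ∈ V) (hq : q ∈ V) :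
    ∃ K, ∃ f : ℕ → X, f 0 = p ∧ (∀ k ≥ K, f k = q) ∧ (∀ k, Linked ε V (f k) (f (k + 1))) ∧
      (p = q → ∀ k, f k = p) := by
  by_cases hpq : p = q
  · subst hpq
    exact ⟨0, fun _ => p, rfl, fun _ _ => rfl, fun _ => linked_self hε hV hp, fun _ _ => rfl⟩
  have h1 : Relation.ReflTransGen (Linked ε V) p q := by
    refine hc.induction₂ (Relation.ReflTransGen (Linked ε V)) ?_ ?_ ?_ hp hq
    · intro x hx
      obtain ⟨W, hW, hcW, hWV, hxW, -, hd⟩ := linked_self hε hV hx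
      exact mem_nhdsWithin_of_mem_nhds (mem_of_superset (hW.mem_nhds hxW) fun y hy =>
        Relation.ReflTransGen.single ⟨W, hW, hcW, hWV, hxW, hy, hd⟩)
    · intro x y z _ _ _ h h'
      exact h.trans h'
    · intro x y _ _ h
      have : Std.Symm (Linked ε V) :=
        ⟨fun a b ⟨W, h1, h2, h3, h4, h5, h6⟩ => ⟨W, h1, h2, h3, h5, h4, h6⟩⟩
      exact Std.Symm.symm _ _ h
  suffices ∃ K, ∃ f : ℕ → X, f 0 = p ∧ (∀ k ≥ K, f k = q) ∧ ∀ k, Linked ε V (f k) (f (k + 1)) by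
    obtain ⟨K, f, h0, hK, hl⟩ := this
    exact ⟨K, f, h0, hK, hl, fun h => (hpq h).elim⟩
  clear hpq hp
  induction h1 using Relation.ReflTransGen.head_induction_on with
  | refl => exact ⟨0, fun _ => q, rfl, fun _ _ => rfl, fun _ => linked_self hε hV hq⟩
  | @head a b hab _ ih =>
    obtain ⟨K, f, h0, hK, hl⟩ := ih
    let f' : ℕ → X
      | 0 => a
      | k + 1 => f k
    refine ⟨K + 1, f', rfl, ?_, ?_⟩
    · rintro (_ | k) hk
      · omega
      · exact hK k (by omega)
    · rintro (_ | k)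
      · change Linked ε V a (f 0)
        rwa [h0]
      · exact hl k

/-- Each link is replaced by a finer chain inside its own connected set. All these chains are padded
to one common length, so the new chain at time `k` stays in the old link number `k / K`. -/
theorem exists_refinement [LocallyConnectedSpace X] {ε ε' : ℝ} (hε' : 0 < ε') {C : Set X}
    {x y : X} {L : ℕ} {f : ℕ → X} (h0 : f 0 = x) (hL : ∀ k ≥ L, f k = y)
    (hf : ∀ k, Linked ε C (f k) (f (k + 1))) :
    ∃ K > 0, ∃ f' : ℕ → X, f' 0 = x ∧ (∀ k ≥ L * K, f' k = y) ∧
      (∀ k, Linked ε' C (f' k) (f' (k + 1))) ∧ ∀ k, dist (f' k) (f (k / K)) ≤ ε := by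
  choose W hW hcW hWC hl hr hd using hf
  choose K g g0 gK gl gc using fun k => exists_chain hε' (hW k) (hcW k) (hl k) (hr k)
  -- This bounds the lengths of the chains replacing the first `L` links; the later ones are
  -- constant. The summand `1` makes `M` positive even when `L = 0`.
  set M := 1 + ∑ k ∈ Finset.range L, K k with hM
  have hM0 : 0 < M := by omega
  have gM : ∀ k, ∀ i ≥ M, g k i = f (k + 1) := by
    intro k i hi
    by_cases hk : k < L
    · refine gK k i ?_
      have := Finset.single_le_sum (f := K) (fun _ _ => Nat.zero_le _) (Finset.mem_range.2 hk)
      omega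
    · have e : f k = f (k + 1) := by rw [hL k (by omega), hL (k + 1) (by omega)]
      rw [gc k e i, e]
  have gW : ∀ k i, g k i ∈ W k := fun k i => by
    obtain ⟨W', -, -, h, h', -⟩ := gl k i
    exact h h'
  have hdiv : ∀ k i, i < M → (k * M + i) / M = k ∧ (k * M + i) % M = i := fun k i hi =>
    ⟨by rw [mul_comm, Nat.mul_add_div hM0, Nat.div_eq_of_lt hi, add_zero],
      Nat.mul_add_mod_of_lt hi⟩
  have key : ∀ k i, i ≤ M → g ((k * M + i) / M) ((k * M + i) % M) = g k i := by
    intro k i hi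
    rcases hi.lt_or_eq with hi | rfl
    · rw [(hdiv k i hi).1, (hdiv k i hi).2]
    · have := hdiv (k + 1) 0 hM0
      rw [show k * M + M = (k + 1) * M + 0 by ring, this.1, this.2, g0, gM k M le_rfl]
  refine ⟨M, hM0, fun n => g (n / M) (n % M), by simp [g0, h0], fun n hn => ?_, fun n => ?_,
    fun n => hd _ _ (gW _ _) _ (hl _)⟩
  · have hk : L ≤ n / M := (Nat.le_div_iff_mul_le hM0).2 hn
    have e : f (n / M) = f (n / M + 1) := by rw [hL _ hk, hL _ (by omega)]
    change g (n / M) (n % M) = y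
    rw [gc _ e, hL _ hk]
  · have hlt := Nat.mod_lt n hM0
    have e1 := key (n / M) (n % M) hlt.le
    have e2 := key (n / M) (n % M + 1) hlt
    rw [← add_assoc] at e2
    rw [Nat.div_add_mod'] at e1 e2
    change Linked ε' C (g _ _) (g _ _)
    rw [e2]
    obtain ⟨W', h1, h2, h3, h4⟩ := gl (n / M) (n % M)
    exact ⟨W', h1, h2, h3.trans (hWC _), h4⟩

/-- Two points of a connected open set are joined by a path in its closure. -/
theorem exists_path_closure [CompleteSpace X] [LocallyConnectedSpace X] {C : Set X}
    (hC : IsOpen C) (hc : IsPreconnected C) {x y : X} (hx : x ∈ C) (hy : y ∈ C) :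
    ∃ γ : ℝ → X, Continuous γ ∧ γ 0 = x ∧ γ 1 = y ∧ ∀ t, γ t ∈ closure C := by
  let T : ℕ → ℕ × (ℕ → X) → Prop := fun n s => 0 < s.1 ∧ s.2 0 = x ∧ (∀ k ≥ s.1, s.2 k = y) ∧
    ∀ k, Linked ((1 / 2 : ℝ) ^ n) C (s.2 k) (s.2 (k + 1))
  have step : ∀ n, ∀ s : {s // T n s}, ∃ s' : {s' // T (n + 1) s'}, ∃ K > 0,
      s'.1.1 = s.1.1 * K ∧ ∀ k, dist (s'.1.2 k) (s.1.2 (k / K)) ≤ (1 / 2 : ℝ) ^ n := by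
    rintro n ⟨s, hs, h0, hL, hl⟩
    obtain ⟨K, hK, f', h0', hL', hl', hd⟩ :=
      exists_refinement (ε' := (1 / 2 : ℝ) ^ (n + 1)) (by positivity) h0 hL hl
    exact ⟨⟨(s.1 * K, f'), Nat.mul_pos hs hK, h0', hL', hl'⟩, K, hK, rfl, hd⟩
  have start : ∃ s, T 0 s := by
    obtain ⟨K, f, h0, hK, hl, -⟩ := exists_chain (ε := (1 / 2 : ℝ) ^ 0) (by positivity) hC hc hx hy
    exact ⟨(K + 1, f), Nat.succ_pos K, h0, fun k hk => hK k (by simp at hk; omega), hl⟩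
  obtain ⟨s0, hs0⟩ := start
  choose nx K hK hL hd using step
  let s : (n : ℕ) → {s // T n s} := fun n => Nat.rec ⟨s0, hs0⟩ (fun n s => nx n s) n
  let L : ℕ → ℕ := fun n => (s n).1.1
  let f : ℕ → ℕ → X := fun n => (s n).1.2
  have Lpos : ∀ n, (0 : ℝ) < L n := fun n => Nat.cast_pos.2 (s n).2.1
  have fC : ∀ n k, f n k ∈ C := fun n k => by
    obtain ⟨W, -, -, h, h', -⟩ := (s n).2.2.2.2 k
    exact h h'
  have fd : ∀ n k, dist (f n k) (f n (k + 1)) ≤ (1 / 2 : ℝ) ^ n := fun n k => by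
    obtain ⟨W, -, -, -, h, h', hd⟩ := (s n).2.2.2.2 k
    exact hd _ h _ h'
  -- The `n`-th chain is read as a step function with steps of length `1 / L n`. Since `L n` divides
  -- `L (n + 1)`, consecutive step functions are uniformly close, and the path is their limit.
  let γ' : ℕ → ℝ → X := fun n t => f n ⌊t * L n⌋₊
  have gd : ∀ t n, dist (γ' n t) (γ' (n + 1) t) ≤ 1 * (1 / 2 : ℝ) ^ n := by
    intro t n
    have e : ⌊t * L n⌋₊ = ⌊t * L (n + 1)⌋₊ / K n (s n) := by
      rw [← Nat.floor_div_natCast]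
      congr 1
      have h1 : (L (n + 1) : ℝ) = L n * K n (s n) := by
        rw [← Nat.cast_mul]; exact congrArg Nat.cast (hL n (s n))
      have h2 : (K n (s n) : ℝ) ≠ 0 := Nat.cast_ne_zero.2 (hK n (s n)).ne'
      rw [h1]
      field_simp
    rw [one_mul, dist_comm]
    change dist (f (n + 1) _) (f n ⌊t * L n⌋₊) ≤ _
    rw [e]
    exact hd n (s n) _
  have lim : ∀ t, ∃ a, Tendsto (fun n => γ' n t) atTop (𝓝 a) := fun t =>
    cauchySeq_tendsto_of_complete (cauchySeq_of_le_geometric _ 1 (by norm_num) (gd t))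
  choose γ hγ using lim
  have close : ∀ n t, dist (γ' n t) (γ t) ≤ 2 * (1 / 2 : ℝ) ^ n := fun n t => by
    have := dist_le_of_le_geometric_of_tendsto _ 1 (by norm_num) (gd t) (hγ t) n
    refine this.trans (le_of_eq ?_)
    ring
  have adj : ∀ n, ∀ t u : ℝ, t ≤ u → u - t < 1 / L n →
      dist (γ' n t) (γ' n u) ≤ (1 / 2 : ℝ) ^ n := by
    intro n t u htu h
    have h1 : u * L n < t * L n + 1 := by
      rw [lt_div_iff₀ (Lpos n)] at h; linarith
    have h2 : ⌊t * L n⌋₊ ≤ ⌊u * L n⌋₊ :=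
      Nat.floor_le_floor (mul_le_mul_of_nonneg_right htu (Lpos n).le)
    have h3 : ⌊u * L n⌋₊ ≤ ⌊t * L n⌋₊ + 1 := by
      rcases le_or_gt 0 (t * L n) with h0 | h0
      · rw [← Nat.floor_add_one h0]; exact Nat.floor_le_floor h1.le
      · rw [Nat.floor_of_nonpos h0.le]
        exact Nat.lt_succ_iff.1 ((Nat.floor_lt' (by norm_num)).2 (by push_cast; linarith))
    change dist (f n ⌊t * L n⌋₊) (f n ⌊u * L n⌋₊) ≤ _
    rcases h2.eq_or_lt with e | e
    · rw [e, dist_self]; positivity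
    · rw [show ⌊u * L n⌋₊ = ⌊t * L n⌋₊ + 1 by omega]; exact fd n _
  refine ⟨γ, ?_, ?_, ?_, fun t => mem_closure_of_tendsto (hγ t) (Eventually.of_forall fun n =>
    fC n _)⟩
  · rw [Metric.continuous_iff]
    intro t ε hε
    -- The factor 5 covers two tail errors of `2 * (1 / 2) ^ n` and one jump of at most `(1 / 2) ^
    -- n`.
    obtain ⟨n, hn⟩ := exists_pow_lt_of_lt_one (show 0 < ε / 5 by positivity)
      (show (1 / 2 : ℝ) < 1 by norm_num)
    refine ⟨1 / L n, by have := Lpos n; positivity, fun u hu => ?_⟩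
    rw [Real.dist_eq, abs_lt] at hu
    have h1 : dist (γ' n u) (γ' n t) ≤ (1 / 2 : ℝ) ^ n := by
      rcases le_total u t with h | h
      · exact adj n u t h (by linarith)
      · rw [dist_comm]; exact adj n t u h (by linarith)
    have h2 := close n u
    have h3 := close n t
    have h4 := dist_triangle4 (γ u) (γ' n u) (γ' n t) (γ t)
    rw [dist_comm (γ u) (γ' n u)] at h4
    linarith
  · refine tendsto_nhds_unique (hγ 0) ?_
    have : ∀ n, γ' n 0 = x := fun n => by
      change f n ⌊(0 : ℝ) * L n⌋₊ = x
      rw [zero_mul, Nat.floor_zero]; exact (s n).2.2.1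
    simp [this]
  · refine tendsto_nhds_unique (hγ 1) ?_
    have : ∀ n, γ' n 1 = y := fun n => by
      change f n ⌊(1 : ℝ) * L n⌋₊ = y
      rw [one_mul, Nat.floor_natCast]; exact (s n).2.2.2.1 _ le_rfl
    simp [this]

end Paths

/-! ### Extracting an arc from a path by erasing loops -/

section LoopErasure

variable {X : Type*}

/-- Closed subsets of `[0, 1]` containing both endpoints, such that the path `γ` takes the same
value at the two ends of each gap. -/
def LoopErasing (γ : ℝ → X) (K : Set ℝ) : Prop :=
  K ⊆ Icc 0 1 ∧ IsClosed K ∧ 0 ∈ K ∧ 1 ∈ K ∧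
    ∀ s ∈ K, ∀ t ∈ K, s < t → (∀ u ∈ K, u ≤ s ∨ t ≤ u) → γ s = γ t

/-- By compactness, a gap of the intersection is approximated by gaps of members of the chain with
ends close to its own; continuity of `γ` passes the equality of end values to the limit. This is the
chain condition for Zorn's lemma. -/
theorem LoopErasing.sInter [MetricSpace X] {γ : ℝ → X} (hγ : Continuous γ) {c : Set (Set ℝ)}
    (hc : c ⊆ {K | LoopErasing γ K}) (hch : IsChain (· ⊆ ·) c) (hne : c.Nonempty) :
    LoopErasing γ (⋂₀ c) := by
  obtain ⟨K₀, hK₀⟩ := hne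
  refine ⟨(sInter_subset_of_mem hK₀).trans (hc hK₀).1, isClosed_sInter fun K hK => (hc hK).2.1,
    fun K hK => (hc hK).2.2.1, fun K hK => (hc hK).2.2.2.1, fun s hs t ht hst hgap => ?_⟩
  refine eq_of_forall_dist_le fun ε hε => ?_
  obtain ⟨δ₁, h1, hδ₁⟩ := Metric.continuous_iff.1 hγ s (ε / 2) (half_pos hε)
  obtain ⟨δ₂, h2, hδ₂⟩ := Metric.continuous_iff.1 hγ t (ε / 2) (half_pos hε)
  obtain ⟨η, hη, hηs⟩ : ∃ η > 0, η < δ₁ ∧ η < δ₂ ∧ η + η < t - s := by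
    refine ⟨min (min δ₁ δ₂) (t - s) / 3, by
      have := sub_pos.2 hst
      positivity, ?_⟩
    have a := min_le_left (min δ₁ δ₂) (t - s)
    have b := min_le_right (min δ₁ δ₂) (t - s)
    have c := min_le_left δ₁ δ₂
    have d := min_le_right δ₁ δ₂
    exact ⟨by linarith, by linarith, by linarith⟩
  obtain ⟨g1, g2, g3⟩ := hηs
  have : Nonempty c := ⟨⟨K₀, hK₀⟩⟩
  -- Some single member of the chain already misses the slightly shrunken gap.
  obtain ⟨⟨K, hK⟩, hKd⟩ := (isCompact_Icc (a := s + η) (b := t - η)).elim_directed_family_closed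
    (ι := c) (fun K => (K : Set ℝ)) (fun K => (hc K.2).2.1) (by
      rw [← sInter_eq_iInter, ← disjoint_iff_inter_eq_empty, disjoint_left]
      intro u hu hu'
      rcases hgap u hu' with h | h
      · linarith [hu.1]
      · linarith [hu.2]) (by
      rintro ⟨A, hA⟩ ⟨B, hB⟩
      rcases hch.total hA hB with h | h
      · exact ⟨⟨A, hA⟩, Subset.rfl, h⟩
      · exact ⟨⟨B, hB⟩, h, Subset.rfl⟩)
  obtain ⟨hKI, hKc, -, -, hKg⟩ := hc hK
  have hKcomp : IsCompact K := isCompact_Icc.of_isClosed_subset hKc hKI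
  obtain ⟨s', ⟨hs'K, hs'⟩, hs'm⟩ := (hKcomp.inter_right (isClosed_Iic (a := s + η))).exists_isGreatest
    ⟨s, hs K hK, by simp [hη.le]⟩
  obtain ⟨t', ⟨ht'K, ht'⟩, ht'm⟩ := (hKcomp.inter_right (isClosed_Ici (a := t - η))).exists_isLeast
    ⟨t, ht K hK, by simp [hη.le]⟩
  have ss : s ≤ s' := hs'm ⟨hs K hK, by simp [hη.le]⟩
  have tt : t' ≤ t := ht'm ⟨ht K hK, by simp [hη.le]⟩
  simp only [mem_Iic, mem_Ici] at hs' ht'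
  have e := hKg s' hs'K t' ht'K (by linarith) fun u hu => by
    by_contra! h
    have h3 : s + η < u := by
      by_contra! h'; exact absurd (hs'm ⟨hu, h'⟩) (not_le.2 h.1)
    have h4 : u < t - η := by
      by_contra! h'; exact absurd (ht'm ⟨hu, h'⟩) (not_le.2 h.2)
    exact (hKd ▸ show u ∈ Icc (s + η) (t - η) ∩ K from ⟨⟨h3.le, h4.le⟩, hu⟩ : u ∈ (∅ : Set ℝ))
  have d1 := hδ₁ s' (by rw [Real.dist_eq, abs_lt]; constructor <;> linarith)
  have d2 := hδ₂ t' (by rw [Real.dist_eq, abs_lt]; constructor <;> linarith)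
  rw [← e] at d2
  have := dist_triangle_left (γ s) (γ t) (γ s')
  linarith

/-- Removing a loop creates no gap other than the one from `u` to `v`, whose end values agree by
assumption. -/
theorem LoopErasing.diff_Ioo {γ : ℝ → X} {K : Set ℝ} (hK : LoopErasing γ K) {u v : ℝ} (hu : u ∈ K)
    (hv : v ∈ K) (huv : γ u = γ v) : LoopErasing γ (K \ Ioo u v) := by
  obtain ⟨h1, h2, h3, h4, h5⟩ := hK
  refine ⟨sdiff_subset.trans h1, h2.sdiff isOpen_Ioo, ⟨h3, fun h => ?_⟩, ⟨h4, fun h => ?_⟩, ?_⟩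
  · exact absurd (h1 hu).1 (not_le.2 h.1)
  · exact absurd (h1 hv).2 (not_le.2 h.2)
  rintro s ⟨hs, hs'⟩ t ⟨ht, ht'⟩ hst hgap
  by_cases hd : ∀ w ∈ K, w ≤ s ∨ t ≤ w
  · exact h5 s hs t ht hst hd
  push Not at hd
  obtain ⟨w, hw, hsw, hwt⟩ := hd
  have hwI : w ∈ Ioo u v := by
    by_contra h
    rcases hgap w ⟨hw, h⟩ with h | h <;> linarith
  have e1 : s ≤ u := not_lt.1 fun h => hs' ⟨h, hsw.trans hwI.2⟩
  have e2 : v ≤ t := not_lt.1 fun h => ht' ⟨hwI.1.trans hwt, h⟩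
  have e3 : s = u := le_antisymm e1 <| by
    rcases hgap u ⟨hu, fun h => lt_irrefl _ h.1⟩ with h | h
    · exact h
    · linarith [hwI.1, hwI.2]
  have e4 : t = v := le_antisymm (by
    rcases hgap v ⟨hv, fun h => lt_irrefl _ h.2⟩ with h | h
    · linarith [hwI.1, hwI.2]
    · exact h) e2
  rw [e3, e4, huv]

theorem exists_loopErasing_minimal [MetricSpace X] {γ : ℝ → X} (hγ : Continuous γ) :
    ∃ K, LoopErasing γ K ∧ ∀ u ∈ K, ∀ v ∈ K, γ u = γ v → ∀ w ∈ K, u < w → ¬ w < v := by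
  have h0 : LoopErasing γ (Icc 0 1) := by
    refine ⟨Subset.rfl, isClosed_Icc, by simp, by simp, fun s hs t ht hst h => ?_⟩
    rcases h ((s + t) / 2) ⟨by linarith [hs.1, ht.1], by linarith [hs.2, ht.2]⟩ with h | h <;>
      linarith
  obtain ⟨K, -, hK, hmin⟩ := zorn_superset_nonempty {K | LoopErasing γ K}
    (fun c hc hch hne => ⟨_, LoopErasing.sInter hγ hc hch hne, fun s hs => sInter_subset_of_mem hs⟩)
    _ h0
  refine ⟨K, hK, fun u hu v hv huv w hw h1 h2 => ?_⟩
  exact (hmin (LoopErasing.diff_Ioo hK hu hv huv) sdiff_subset hw).2 ⟨h1, h2⟩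

/-- A path joining two distinct points contains an arc joining them. -/
theorem exists_arc_subset_path [MetricSpace X] [CompactSpace X] {γ : ℝ → X} (hγ : Continuous γ)
    (hne : γ 0 ≠ γ 1) : ∃ A, IsArcBetween (γ 0) (γ 1) A ∧ A ⊆ range γ := by
  obtain ⟨K, ⟨hKI, hKc, h0, h1, hgap⟩, hmin⟩ := exists_loopErasing_minimal hγ
  have : Nonempty X := ⟨γ 0⟩
  have hKcomp : IsCompact K := isCompact_Icc.of_isClosed_subset hKc hKI
  let x : ℕ → X := TopologicalSpace.denseSeq X
  -- `S t` is the part of the loop-erased path traversed by time `t`. By minimality of `K`, it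
  -- determines `γ t` for `t ∈ K`, and conversely.
  let S : ℝ → Set X := fun t => γ '' (K ∩ Iic t)
  have hS0 : ∀ t ∈ K, γ 0 ∈ S t := fun t ht => ⟨0, ⟨h0, (hKI ht).1⟩, rfl⟩
  have hSt : ∀ t ∈ K, γ t ∈ S t := fun t ht => ⟨t, ⟨ht, self_mem_Iic⟩, rfl⟩
  have hSm : ∀ s t, s ≤ t → S s ⊆ S t := fun s t h =>
    image_mono (inter_subset_inter_right _ (Iic_subset_Iic.2 h))
  let m : ℕ → ℝ → ℝ := fun n t => Metric.infDist (x n) (S t)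
  have manti : ∀ n, ∀ s ∈ K, ∀ t, s ≤ t → m n t ≤ m n s := fun n s hs t h =>
    Metric.infDist_le_infDist_of_subset (hSm s t h) ⟨_, hSt s hs⟩
  have mcont : ∀ n, ContinuousOn (m n) K := by
    intro n t₀ ht₀
    rw [Metric.continuousWithinAt_iff]
    intro ε hε
    obtain ⟨δ, hδ, hd⟩ := Metric.continuous_iff.1 hγ t₀ (ε / 4) (by positivity)
    have key : ∀ a ∈ K, ∀ b ∈ K, a ≤ b → dist a t₀ < δ → dist b t₀ < δ → m n a ≤ m n b + ε / 2 := by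
      intro a ha b hb hab hda hdb
      suffices m n a - ε / 2 ≤ m n b by linarith
      refine (Metric.le_infDist ⟨_, hSt b hb⟩).2 ?_
      rintro _ ⟨r, ⟨hr, hrb⟩, rfl⟩
      rcases le_total r a with h | h
      · have := Metric.infDist_le_dist_of_mem (x := x n) (show γ r ∈ S a from ⟨r, ⟨hr, h⟩, rfl⟩)
        change m n a ≤ _ at this
        linarith
      · have h2 := Metric.infDist_le_dist_of_mem (x := x n) (hSt a ha)
        change m n a ≤ _ at h2
        have h3 : dist (γ r) (γ t₀) < ε / 4 := by
          refine hd r ?_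
          rw [Real.dist_eq, abs_lt] at hda hdb ⊢
          simp only [mem_Iic] at hrb
          constructor <;> linarith
        have h4 := hd a hda
        have h5 := dist_triangle4_right (x n) (γ a) (γ r) (γ t₀)
        have h6 := dist_triangle (x n) (γ r) (γ a)
        have h7 := dist_triangle_right (γ r) (γ a) (γ t₀)
        linarith
    refine ⟨δ, hδ, fun t ht hdt => ?_⟩
    have h00 : dist t₀ t₀ < δ := by simpa using hδ
    rw [Real.dist_eq, abs_lt]
    rcases le_total t t₀ with h | h
    · have := key t ht t₀ ht₀ h hdt h00
      have := manti n t ht t₀ h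
      constructor <;> linarith
    · have := key t₀ ht₀ t ht h h00 hdt
      have := manti n t₀ ht₀ t h
      constructor <;> linarith
  obtain ⟨D, hD⟩ : ∃ D, ∀ n, ∀ t ∈ K, |m n t| ≤ D := by
    refine ⟨Metric.diam (univ : Set X), fun n t ht => ?_⟩
    rw [abs_of_nonneg Metric.infDist_nonneg]
    exact (Metric.infDist_le_dist_of_mem (hSt t ht)).trans
      (Metric.dist_le_diam_of_mem isCompact_univ.isBounded trivial trivial)
  have hsum : Summable fun n : ℕ => (1 / 2 : ℝ) ^ n * D := summable_geometric_two.mul_right D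
  have hle : ∀ n, ∀ t ∈ K, ‖(1 / 2 : ℝ) ^ n * m n t‖ ≤ (1 / 2 : ℝ) ^ n * D := fun n t ht => by
    rw [norm_mul, Real.norm_eq_abs, Real.norm_eq_abs, abs_of_pos (by positivity)]
    exact mul_le_mul_of_nonneg_left (hD n t ht) (by positivity)
  -- A weighted sum of the distances from a dense sequence to `S t`. It decreases in `t` and, on
  -- `K`, has the same fibres as `γ`, so it parametrizes the arc.
  let h : ℝ → ℝ := fun t => ∑' n : ℕ, (1 / 2 : ℝ) ^ n * m n t
  have hc : ContinuousOn h K :=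
    continuousOn_tsum (fun n => continuousOn_const.mul (mcont n)) hsum hle
  have hs : ∀ t ∈ K, Summable fun n : ℕ => (1 / 2 : ℝ) ^ n * m n t := fun t ht =>
    Summable.of_norm_bounded hsum fun n => hle n t ht
  have hanti : ∀ s ∈ K, ∀ t ∈ K, s ≤ t → h t ≤ h s := fun s hs' t ht hst =>
    (hs t ht).tsum_le_tsum (fun n => mul_le_mul_of_nonneg_left (manti n s hs' t hst)
      (by positivity)) (hs s hs')
  have hfib : ∀ u ∈ K, ∀ v ∈ K, u ≤ v → (h u = h v ↔ γ u = γ v) := by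
    intro u hu v hv huv
    rcases huv.eq_or_lt with rfl | huv
    · simp
    constructor
    · intro e
      by_contra hne
      have hnot : γ v ∉ S u := by
        rintro ⟨w, ⟨hw, hwu⟩, hwv⟩
        have := hmin w hw v hv hwv u hu
        have e : w = u := le_antisymm hwu (not_lt.1 fun h => this h huv)
        exact hne (e ▸ hwv)
      have hcl : IsClosed (S u) := ((hKcomp.inter_right isClosed_Iic).image hγ).isClosed
      have hpos := (hcl.notMem_iff_infDist_pos ⟨_, hSt u hu⟩).1 hnot
      obtain ⟨_, hn, ⟨n, rfl⟩⟩ := Metric.dense_iff.1 (TopologicalSpace.denseRange_denseSeq X) (γ v)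
        _ (half_pos hpos)
      rw [Metric.mem_ball] at hn
      have l1 : m n v < m n u := by
        have a1 : m n v ≤ _ := Metric.infDist_le_dist_of_mem (hSt v hv)
        have a2 := Metric.infDist_le_infDist_add_dist (s := S u) (x := γ v) (y := x n)
        change _ ≤ m n u + _ at a2
        rw [dist_comm] at a2
        change dist (x n) (γ v) < _ at hn
        linarith
      have := Summable.tsum_lt_tsum (i := n) (fun k => mul_le_mul_of_nonneg_left
        (manti k u hu v huv.le) (by positivity : (0 : ℝ) ≤ (1 / 2) ^ k))
        (mul_lt_mul_of_pos_left l1 (by positivity)) (hs v hv) (hs u hu)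
      exact absurd e this.ne'
    · intro e
      have : S u = S v := by
        refine Subset.antisymm (hSm u v huv.le) ?_
        rintro _ ⟨w, ⟨hw, hwv⟩, rfl⟩
        rcases le_or_gt w u with h | h
        · exact ⟨w, ⟨hw, h⟩, rfl⟩
        · have := hmin u hu v hv e w hw h
          have : w = v := le_antisymm hwv (not_lt.1 this)
          exact ⟨u, ⟨hu, self_mem_Iic⟩, by rw [this, e]⟩
      change (∑' n : ℕ, (1 / 2 : ℝ) ^ n * Metric.infDist (x n) (S u)) = _
      rw [this]
  have hfib' : ∀ u ∈ K, ∀ v ∈ K, (h u = h v ↔ γ u = γ v) := fun u hu v hv => by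
    rcases le_total u v with huv | huv
    · exact hfib u hu v hv huv
    · rw [eq_comm, hfib v hv u hu huv, eq_comm]
  -- A missing value would be jumped over at a gap of `K`; but `γ`, and hence `h`, agrees at the two
  -- ends of a gap.
  have himg : h '' K = Icc (h 1) (h 0) := by
    refine Subset.antisymm ?_ ?_
    · rintro _ ⟨t, ht, rfl⟩
      exact ⟨hanti t ht 1 h1 (hKI ht).2, hanti 0 h0 t ht (hKI ht).1⟩
    · intro τ hτ
      by_contra hτK
      have hτ' : ∀ k ∈ K, h k ≠ τ := fun k hk e => hτK ⟨k, hk, e⟩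
      obtain ⟨u, ⟨hu, hu'⟩, hum⟩ := (hKcomp.of_isClosed_subset
        (hc.preimage_isClosed_of_isClosed hKc (isClosed_Ici (a := τ))) inter_subset_left).exists_isGreatest
        ⟨0, h0, hτ.2⟩
      obtain ⟨v, ⟨hv, hv'⟩, hvm⟩ := (hKcomp.of_isClosed_subset
        (hc.preimage_isClosed_of_isClosed hKc (isClosed_Iic (a := τ))) inter_subset_left).exists_isLeast
        ⟨1, h1, hτ.1⟩
      have hvu : h v < h u := lt_of_lt_of_le (lt_of_le_of_ne hv' (hτ' v hv)) hu'
      have huv : u < v := not_le.1 fun hle => absurd (hanti v hv u hu hle) (not_le.2 hvu)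
      have := hgap u hu v hv huv fun w hw => (le_total τ (h w)).imp (fun e => hum ⟨hw, e⟩)
        fun e => hvm ⟨hw, e⟩
      exact absurd ((hfib' u hu v hv).2 this) hvu.ne'
  have hlt : h 1 < h 0 := lt_of_le_of_ne (hanti 0 h0 1 h1 zero_le_one) fun e =>
    hne ((hfib' 0 h0 1 h1).1 e.symm)
  have : CompactSpace K := isCompact_iff_compactSpace.1 hKcomp
  have harc := isArcBetween_range_of_fibers (K := K) (h := fun t => h t) (g := fun t => γ t)
    (continuousOn_iff_continuous_domRestrict.1 hc) (hγ.comp continuous_subtype_val)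
    (fun u v => hfib' u u.2 v v.2) hlt (by rw [← himg, image_eq_range])
    (u := ⟨1, h1⟩) (v := ⟨0, h0⟩) rfl rfl
  exact ⟨_, harc.symm, range_subset_iff.2 fun t => mem_range_self _⟩

end LoopErasure

/-! ### Small arcs in dendrites -/

section Dendrites

variable {X : Type*} [TopologicalSpace X]

/-- In a dendrite, arcs between nearby points are small. -/
theorem IsDendrite.eventually_arc_subset (hX : IsDendrite X) {z : X} {V : Set X} (hV : V ∈ 𝓝 z) :
    ∀ᶠ w in 𝓝 z, ∀ A, IsArcBetween z w A → A ⊆ V := by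
  have := hX.compact
  have := hX.metrizable
  have := hX.locallyConnected
  let _ := TopologicalSpace.metrizableSpaceMetric X
  obtain ⟨V', hV', hVc, hVV⟩ := exists_mem_nhds_isClosed_subset hV
  obtain ⟨C, hCV, hCo, hz, hC⟩ := locallyConnectedSpace_iff_subsets_isOpen_isConnected.1 ‹_› z V' hV'
  filter_upwards [hCo.mem_nhds hz] with w hw A hA
  obtain ⟨γ, hγ, rfl, rfl, hγC⟩ := exists_path_closure hCo hC.isPreconnected hz hw
  -- The path stays near `z`, and the arc it contains must be `A` by uniqueness of arcs.
  obtain ⟨B, hB, hBγ⟩ := exists_arc_subset_path hγ hA.ne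
  rw [(hX.existsUnique_arc _ _ hA.ne).unique hA hB]
  exact (hBγ.trans (range_subset_iff.2 hγC)).trans ((closure_minimal hCV hVc).trans hVV)

end Dendrites

/-! ### Rooted topological trees -/

/-- A compact metrizable topological meet-semilattice with least element, in which the elements
below a given one form a chain and order intervals are connected. -/
class TreeSpace (X : Type*) [TopologicalSpace X] [SemilatticeInf X] [OrderBot X] : Prop
    extends CompactSpace X, TopologicalSpace.MetrizableSpace X, ContinuousInf X where
  le_total_of_le : ∀ a b c : X, a ≤ c → b ≤ c → a ≤ b ∨ b ≤ a
  isPreconnected_Icc : ∀ a b : X, a ≤ b → IsPreconnected (Icc a b)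

/-- `z` lies on the arc between `x` and `y`. -/
def TBtw {X : Type*} [SemilatticeInf X] (x z y : X) : Prop :=
  x ⊓ y ≤ z ∧ (z ≤ x ∨ z ≤ y)

/-- `H` contains the arc between any two of its points. -/
def TConvex {X : Type*} [SemilatticeInf X] (H : Set X) : Prop :=
  ∀ x ∈ H, ∀ y ∈ H, ∀ z, TBtw x z y → z ∈ H

/-! ### Betweenness and half-spaces in semilattices -/

section Betweenness

variable {X : Type*} [SemilatticeInf X]

theorem TBtw.symm {x y z : X} (h : TBtw x z y) : TBtw y z x :=
  ⟨inf_comm y x ▸ h.1, h.2.symm⟩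

theorem tbtw_comm {x y z : X} : TBtw x z y ↔ TBtw y z x := ⟨TBtw.symm, TBtw.symm⟩

theorem tbtw_self_iff {x z : X} : TBtw x z x ↔ z = x :=
  ⟨fun h => le_antisymm (h.2.elim id id) (by simpa using h.1), fun h => by simp [TBtw, h]⟩

theorem tbtw_left (x y : X) : TBtw x x y := ⟨inf_le_left, Or.inl le_rfl⟩

theorem tbtw_right (x y : X) : TBtw x y y := ⟨inf_le_right, Or.inr le_rfl⟩

theorem tbtw_inf (x y : X) : TBtw x (x ⊓ y) y := ⟨le_rfl, Or.inl inf_le_left⟩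

theorem tbtw_of_le {x y z : X} (h : x ≤ z) (h' : z ≤ y) : TBtw x z y :=
  ⟨inf_le_left.trans h, Or.inr h'⟩

/-- A half-space: a convex set with convex complement. -/
def IsHalfSpace (H : Set X) : Prop := TConvex H ∧ TConvex Hᶜ

theorem IsHalfSpace.compl {H : Set X} (h : IsHalfSpace H) : IsHalfSpace Hᶜ :=
  ⟨h.2, (compl_compl H).symm ▸ h.1⟩

theorem isHalfSpace_of_isUpperSet {H : Set X} (hu : IsUpperSet H) (hi : InfClosed H) :
    IsHalfSpace H := by
  refine ⟨fun x hx y hy z hz => hu hz.1 (hi hx hy), fun x hx y hy z hz hzH => ?_⟩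
  exact hz.2.elim (fun h => hx (hu h hzH)) fun h => hy (hu h hzH)

theorem tbtw_bot_iff [OrderBot X] {x y : X} : TBtw x ⊥ y ↔ x ⊓ y = ⊥ := by simp [TBtw]

theorem bot_tbtw_iff [OrderBot X] {x z : X} : TBtw ⊥ z x ↔ z ≤ x :=
  ⟨fun h => h.2.elim (fun h => h.trans bot_le) id, fun h => ⟨by simp, Or.inr h⟩⟩

theorem setOf_tbtw_of_le {a b : X} (h : a ≤ b) : {z | TBtw a z b} = Icc a b := by
  ext z
  simp only [TBtw, inf_eq_left.2 h, mem_ofPred_eq, mem_Icc]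
  exact and_congr_right fun h' => ⟨fun h'' => h''.elim (fun h' => h'.trans h) id, Or.inr⟩

end Betweenness

/-! ### Convexity, components and half-spaces in rooted trees -/

section TreeOrder

variable {X : Type*} [TopologicalSpace X] [SemilatticeInf X] [OrderBot X] [TreeSpace X]

theorem TreeSpace.total {a b c : X} (h : a ≤ c) (h' : b ≤ c) : a ≤ b ∨ b ≤ a :=
  TreeSpace.le_total_of_le a b c h h'

/-- The arc from `x` to `w` is covered by the arcs from `x` to `y` and from `y` to `w`.
Equivalently, not being separated by `z` is transitive; this makes the sides of a point well
defined. -/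
theorem TBtw.or {x y z w : X} (h : TBtw x z w) : TBtw x z y ∨ TBtw y z w := by
  have key : ∀ {x y z w : X}, x ⊓ w ≤ z → z ≤ x → TBtw x z y ∨ TBtw y z w := by
    intro x y z w h1 h2
    by_cases hzy : z ≤ y
    · rcases TreeSpace.total (inf_le_right : x ⊓ y ≤ y) (inf_le_left : y ⊓ w ≤ y) with h | h
      · exact Or.inl ⟨(le_inf inf_le_left (h.trans inf_le_right)).trans h1, Or.inl h2⟩
      · exact Or.inr ⟨(le_inf (h.trans inf_le_left) inf_le_right).trans h1, Or.inl hzy⟩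
    · rcases TreeSpace.total (inf_le_left : x ⊓ y ≤ x) h2 with h | h
      · exact Or.inl ⟨h, Or.inl h2⟩
      · exact absurd (h.trans inf_le_right) hzy
  rcases h with ⟨h1, h2 | h2⟩
  · exact key h1 h2
  · exact (key (inf_comm x w ▸ h1) h2).symm.imp TBtw.symm TBtw.symm

/-- Below a point that is not below `y`, the meet with `y` does not grow. -/
theorem le_inf_of_not_inf_le {a b c : X} (hc : c ≤ b) (h : ¬ a ⊓ b ≤ c) : c ≤ a ⊓ b :=
  (TreeSpace.total inf_le_right hc).resolve_left h

instance TreeSpace.orderClosedTopology : OrderClosedTopology X where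
  isClosed_le' := by
    have : {p : X × X | p.1 ≤ p.2} = {p | p.1 ⊓ p.2 = p.1} := by ext; simp
    rw [this]
    exact isClosed_eq continuous_inf continuous_fst

theorem isClosed_tbtw : IsClosed {p : X × X × X | TBtw p.1 p.2.1 p.2.2} := by
  refine IsClosed.inter ?_ (IsClosed.union ?_ ?_)
  · exact isClosed_le (by fun_prop) (by fun_prop)
  · exact isClosed_le (by fun_prop) (by fun_prop)
  · exact isClosed_le (by fun_prop) (by fun_prop)

theorem isClosed_setOf_tbtw_right (x z : X) : IsClosed {y | TBtw x z y} :=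
  isClosed_tbtw.preimage (f := fun y => (x, z, y)) (by fun_prop)

theorem isOpen_setOf_not_tbtw (x z : X) : IsOpen {y | ¬ TBtw x z y} :=
  (isClosed_setOf_tbtw_right x z).isOpen_compl

theorem isPreconnected_setOf_tbtw (x y : X) : IsPreconnected {z | TBtw x z y} := by
  have : {z | TBtw x z y} = Icc (x ⊓ y) x ∪ Icc (x ⊓ y) y := by
    ext z; simp [TBtw, and_or_left]
  rw [this]
  exact IsPreconnected.union (x ⊓ y) (left_mem_Icc.2 inf_le_left) (left_mem_Icc.2 inf_le_right)
    (TreeSpace.isPreconnected_Icc _ _ inf_le_left) (TreeSpace.isPreconnected_Icc _ _ inf_le_right)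

theorem exists_between_of_lt {a b : X} (h : a < b) : ∃ c, a < c ∧ c < b := by
  by_contra! hn
  have := isPreconnected_closed_iff.1 (TreeSpace.isPreconnected_Icc a b h.le) (Iic a) (Ici b)
    isClosed_Iic isClosed_Ici (fun z hz => by
      rcases hz.1.eq_or_lt with rfl | h1
      · exact Or.inl le_rfl
      · rcases hz.2.eq_or_lt with rfl | h2
        · exact Or.inr le_rfl
        · exact absurd h2 (hn z h1)) ⟨a, left_mem_Icc.2 h.le, self_mem_Iic⟩
    ⟨b, right_mem_Icc.2 h.le, self_mem_Ici⟩
  obtain ⟨z, -, hz1, hz2⟩ := this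
  exact absurd ((hz2.trans hz1 : b ≤ a)) h.not_ge

theorem TConvex.isPreconnected {H : Set X} (hH : TConvex H) : IsPreconnected H :=
  isPreconnected_of_forall_pair fun x hx y hy =>
    ⟨{z | TBtw x z y}, fun z hz => hH x hx y hy z hz, tbtw_left x y, tbtw_right x y,
      isPreconnected_setOf_tbtw x y⟩

/-- If a point `z` between `x` and `y` were missing from `C`, then `C` would be split into the
points that `z` does not separate from `x` and the others; both parts are relatively open, the
second by `TBtw.or`. -/
theorem IsPreconnected.tConvex {C : Set X} (hC : IsPreconnected C) : TConvex C := by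
  intro x hx y hy z hz
  by_contra hzC
  have hne : ∀ w ∈ C, w ≠ z := fun w hw h => hzC (h ▸ hw)
  have hzz : ∀ {w}, w ≠ z → ¬ TBtw w z w := fun h h' => h (tbtw_self_iff.1 h').symm
  have hopen : IsOpen {w | w ≠ z ∧ TBtw x z w} := by
    refine isOpen_iff_mem_nhds.2 fun w hw => ?_
    refine mem_of_superset ((isOpen_ne.inter (isOpen_setOf_not_tbtw w z)).mem_nhds
      ⟨hw.1, hzz hw.1⟩) fun v hv => ⟨hv.1, ?_⟩
    exact (hw.2.or (y := v)).resolve_right fun h => hv.2 h.symm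
  obtain ⟨w, -, h1, h2⟩ := hC _ _ (isOpen_setOf_not_tbtw x z) hopen (fun w hw => by
    by_cases h : TBtw x z w
    · exact Or.inr ⟨hne w hw, h⟩
    · exact Or.inl h) ⟨x, hx, hzz (hne x hx)⟩ ⟨y, hy, hne y hy, hz⟩
  exact h1 h2.2

/-- Betweenness is a topological notion. -/
theorem tbtw_iff_forall_isPreconnected {x y z : X} :
    TBtw x z y ↔ ∀ C : Set X, IsPreconnected C → x ∈ C → y ∈ C → z ∈ C :=
  ⟨fun h _ hC hx hy => hC.tConvex _ hx _ hy _ h, fun h =>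
    h {z | TBtw x z y} (isPreconnected_setOf_tbtw x y) (tbtw_left x y) (tbtw_right x y)⟩

theorem tbtw_map_homeomorph {Y : Type*} [TopologicalSpace Y] [SemilatticeInf Y] [OrderBot Y]
    [TreeSpace Y] (g : X ≃ₜ Y) {x y z : X} : TBtw (g x) (g z) (g y) ↔ TBtw x z y := by
  simp only [tbtw_iff_forall_isPreconnected]
  constructor
  · intro h C hC hx hy
    have := h (g '' C) (hC.image g g.continuous.continuousOn) ⟨x, hx, rfl⟩ ⟨y, hy, rfl⟩
    exact (g.injective.mem_set_image).1 this
  · intro h C hC hx hy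
    exact h (g ⁻¹' C) (g.isPreconnected_preimage.2 hC) hx hy

/-! ### Components of the complement of a point -/

theorem connectedComponents_mk_eq_iff {c : X} {x y : ({c}ᶜ : Set X)} :
    (x : ConnectedComponents ({c}ᶜ : Set X)) = y ↔ ¬ TBtw (x : X) c y := by
  rw [ConnectedComponents.coe_eq_coe']
  constructor
  · intro h hb
    have := (isPreconnected_connectedComponent (x := y)).image _ continuous_subtype_val.continuousOn
    have hc := this.tConvex _ ⟨x, h, rfl⟩ _ ⟨y, mem_connectedComponent, rfl⟩ c hb
    obtain ⟨w, -, hw⟩ := hc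
    exact w.2 hw
  · intro h
    refine IsPreconnected.subset_connectedComponent (s := Subtype.val ⁻¹' {z | TBtw (x : X) z y})
      ?_ (tbtw_right (x : X) (y : X)) (tbtw_left (x : X) (y : X))
    rw [← IsInducing.subtypeVal.isPreconnected_image,
      image_preimage_eq_of_subset]
    · exact isPreconnected_setOf_tbtw _ _
    · intro z hz
      rw [Subtype.range_coe]
      rintro rfl
      exact h hz

/-- The component of `x` in the complement of `c`. -/
def pointComp (c : X) (x : X) (h : x ≠ c) : ConnectedComponents ({c}ᶜ : Set X) :=
  ConnectedComponents.mk (⟨x, h⟩ : ({c}ᶜ : Set X))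

theorem pointComp_eq_iff {c x y : X} (hx : x ≠ c) (hy : y ≠ c) :
    pointComp c x hx = pointComp c y hy ↔ ¬ TBtw x c y := connectedComponents_mk_eq_iff

theorem exists_pointComp_eq {Y : Type*} [TopologicalSpace Y] {c : Y} (K : ConnectedComponents ({c}ᶜ : Set Y)) :
    ∃ x, ∃ h : x ≠ c, pointComp c x h = K := by
  obtain ⟨⟨x, h⟩, rfl⟩ := ConnectedComponents.surjective_coe K
  exact ⟨x, h, rfl⟩

theorem pointOrder_eq_card {D : Type*} {c : X} (f : ({c}ᶜ : Set X) → D)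
    (hs : Function.Surjective f) (hf : ∀ x y, f x = f y ↔ ¬ TBtw (x : X) c y) :
    pointOrder c = ENat.card D := by
  let g : ConnectedComponents ({c}ᶜ : Set X) → D := Quotient.lift f fun x y h =>
    (hf x y).2 (connectedComponents_mk_eq_iff.1 (Quotient.sound h))
  refine ENat.card_congr (Equiv.ofBijective g ⟨?_, fun d => ?_⟩)
  · intro a b h
    obtain ⟨x, rfl⟩ := ConnectedComponents.surjective_coe a
    obtain ⟨y, rfl⟩ := ConnectedComponents.surjective_coe b
    exact connectedComponents_mk_eq_iff.2 ((hf x y).1 h)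
  · obtain ⟨x, rfl⟩ := hs d
    exact ⟨(x : ConnectedComponents _), rfl⟩

/-- A third component is left over besides those of `x` and `y`, which may coincide. -/
theorem IsRamificationPoint.exists_tbtw {c : X} (hc : IsRamificationPoint c) {x y : X} (hx : x ≠ c)
    (hy : y ≠ c) : ∃ w, w ≠ c ∧ TBtw x c w ∧ TBtw y c w := by
  obtain ⟨K, h1, h2⟩ := ENat.exists_ne_ne_of_three_le hc (pointComp c x hx) (pointComp c y hy)
  obtain ⟨w, hw, rfl⟩ := exists_pointComp_eq K
  refine ⟨w, hw, ?_, ?_⟩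
  · by_contra h; exact h1 ((pointComp_eq_iff hx hw).2 h).symm
  · by_contra h; exact h2 ((pointComp_eq_iff hy hw).2 h).symm

theorem IsRamificationPoint.exists_ne {Y : Type*} [TopologicalSpace Y] {c : Y}
    (hc : IsRamificationPoint c) : ∃ x, x ≠ c := by
  have : 0 < ENat.card (ConnectedComponents ({c}ᶜ : Set Y)) :=
    lt_of_lt_of_le (by norm_num) (show (3 : ℕ∞) ≤ _ from hc)
  obtain ⟨K⟩ := (ENat.card_pos_iff_nonempty _).1 this
  obtain ⟨w, hw, rfl⟩ := exists_pointComp_eq K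
  exact ⟨w, hw⟩

theorem isRamificationPoint_of_tbtw {c x y z : X} (hx : x ≠ c) (hy : y ≠ c) (hz : z ≠ c)
    (hxy : TBtw x c y) (hyz : TBtw y c z) (hxz : TBtw x c z) : IsRamificationPoint c := by
  have hinj : Function.Injective ![pointComp c x hx, pointComp c y hy, pointComp c z hz] := by
    have h1 := (pointComp_eq_iff hx hy).not.2 (not_not.2 hxy)
    have h2 := (pointComp_eq_iff hy hz).not.2 (not_not.2 hyz)
    have h3 := (pointComp_eq_iff hx hz).not.2 (not_not.2 hxz)
    intro i j h
    fin_cases i <;> fin_cases j <;> simp_all [eq_comm]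
  have := ENat.card_le_card_of_injective hinj
  simpa [IsRamificationPoint, pointOrder] using this

theorem isRamificationPoint_inf {x y : X} (hx : ¬ x ≤ y) (hy : ¬ y ≤ x) (h : x ⊓ y ≠ ⊥) :
    IsRamificationPoint (x ⊓ y) := by
  refine isRamificationPoint_of_tbtw (x := x) (y := y) (z := ⊥) ?_ ?_ h.symm (tbtw_inf x y) ?_ ?_
  · exact fun e => hx (inf_eq_left.1 e.symm)
  · exact fun e => hy (inf_eq_right.1 e.symm)
  · exact (bot_tbtw_iff.2 inf_le_right).symm
  · exact (bot_tbtw_iff.2 inf_le_left).symm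

/-- A ramification point other than the root has two distinct components away from the root. Both
are open, so each contains a point of a countable dense set, and the meet of these two points is the
ramification point. -/
theorem countable_isRamificationPoint : {c : X | IsRamificationPoint c}.Countable := by
  have : Nonempty X := ⟨⊥⟩
  let _ := TopologicalSpace.metrizableSpaceMetric X
  let q := TopologicalSpace.denseSeq X
  have hq : DenseRange q := TopologicalSpace.denseRange_denseSeq X
  refine ((countable_range fun p : ℕ × ℕ => q p.1 ⊓ q p.2).union (countable_singleton ⊥)).mono ?_
  intro c hc
  by_cases hb : c = ⊥
  · exact Or.inr hb
  left
  obtain ⟨x, hx, hbx, -⟩ := hc.exists_tbtw (Ne.symm hb) (Ne.symm hb)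
  obtain ⟨y, hy, hby, hxy⟩ := hc.exists_tbtw (Ne.symm hb) hx
  have hzz : ∀ {w}, w ≠ c → ¬ TBtw w c w := fun h h' => h (tbtw_self_iff.1 h').symm
  obtain ⟨_, hi, ⟨i, rfl⟩⟩ := hq.inter_open_nonempty _ (isOpen_setOf_not_tbtw x c) ⟨x, hzz hx⟩
  obtain ⟨_, hj, ⟨j, rfl⟩⟩ := hq.inter_open_nonempty _ (isOpen_setOf_not_tbtw y c) ⟨y, hzz hy⟩
  have h1 : TBtw ⊥ c (q i) := (hbx.or (y := q i)).resolve_right fun h => hi h.symm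
  have h2 : TBtw ⊥ c (q j) := (hby.or (y := q j)).resolve_right fun h => hj h.symm
  have h3 : TBtw x c (q j) := (hxy.or (y := q j)).resolve_right fun h => hj h.symm
  have h4 : TBtw (q i) c (q j) := (h3.or (y := q i)).resolve_left hi
  exact ⟨(i, j), le_antisymm h4.1 (le_inf (bot_tbtw_iff.1 h1) (bot_tbtw_iff.1 h2))⟩

/-! ### Half-spaces -/

/-- Half-spaces are open or closed. -/
theorem IsHalfSpace.isOpen_or_isClosed {H : Set X} (hH : IsHalfSpace H) :
    IsOpen H ∨ IsClosed H := by
  suffices ∀ H : Set X, IsHalfSpace H → ⊥ ∉ H → IsOpen H ∨ IsClosed H by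
    by_cases h : ⊥ ∈ H
    · exact (this _ hH.compl (not_not.2 h)).symm.imp isClosed_compl_iff.1 isOpen_compl_iff.1
    · exact this H hH h
  intro H hH hb
  -- A half-space without the root is an upper set closed under meets. If it has a least element it
  -- is a closed cone `Ici c`; otherwise each point lies strictly above another one and the set is
  -- open.
  have hu : IsUpperSet H := by
    intro x y hxy hx
    by_contra hy
    exact hH.2 _ hb _ hy x (bot_tbtw_iff.2 hxy) hx
  have hi : InfClosed H := fun x hx y hy => hH.1 x hx y hy _ (tbtw_inf x y)
  by_cases hm : ∃ c ∈ H, ∀ h ∈ H, c ≤ h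
  · obtain ⟨c, hc, hm⟩ := hm
    right
    rw [show H = Ici c from Subset.antisymm hm fun x hx => hu hx hc]
    exact isClosed_Ici
  · left
    push Not at hm
    refine isOpen_iff_mem_nhds.2 fun x hx => ?_
    obtain ⟨h, hh, hxh⟩ := hm x hx
    have hlt : ¬ x ⊓ x ≤ x ⊓ h := by simpa using hxh
    have : IsOpen {z : X | ¬ z ⊓ x ≤ x ⊓ h} :=
      (isClosed_le (by fun_prop) continuous_const).isOpen_compl
    refine mem_of_superset (this.mem_nhds hlt) fun z hz => ?_
    exact hu ((le_inf_of_not_inf_le inf_le_left hz).trans inf_le_left) (hi hx hh)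

/-- When `y` is not below `x`, cut at a point `c` strictly between `x ⊓ y` and `y`: the side of `c`
that contains `y` is the required half-space. The other case is symmetric. -/
theorem exists_isHalfSpace_separating {x y : X} (h : x ≠ y) :
    ∃ H : Set X, IsHalfSpace H ∧ H ∈ 𝓝 x ∧ Hᶜ ∈ 𝓝 y := by
  have key : ∀ x y : X, ¬ y ≤ x → ∃ F : Set X, IsHalfSpace F ∧ F ∈ 𝓝 y ∧ Fᶜ ∈ 𝓝 x := by
    intro x y hyx
    obtain ⟨c, hc, hcy⟩ := exists_between_of_lt (show x ⊓ y < y from inf_lt_right.2 hyx)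
    have ho : IsOpen {z : X | ¬ z ⊓ y ≤ c} :=
      (isClosed_le (by fun_prop) continuous_const).isOpen_compl
    refine ⟨{z | ¬ z ⊓ y ≤ c}, isHalfSpace_of_isUpperSet ?_ ?_, ho.mem_nhds ?_, ?_⟩
    · exact fun a b hab ha hb => ha ((inf_le_inf_right y hab).trans hb)
    · intro a ha b hb hab
      have h1 := le_inf_of_not_inf_le hcy.le ha
      have h2 := le_inf_of_not_inf_le hcy.le hb
      have h3 : a ⊓ y ≤ b ⊓ y ∨ b ⊓ y ≤ a ⊓ y := TreeSpace.total inf_le_right inf_le_right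
      rcases h3 with h | h
      · exact ha ((le_inf (le_inf inf_le_left (h.trans inf_le_left)) inf_le_right).trans hab)
      · exact hb ((le_inf (le_inf (h.trans inf_le_left) inf_le_left) inf_le_right).trans hab)
    · simpa using hcy.not_ge
    · have : IsOpen {z : X | ¬ c ≤ z} := (isClosed_le continuous_const continuous_id).isOpen_compl
      refine mem_of_superset (this.mem_nhds fun h => ?_) fun z hz => ?_
      · exact absurd (le_inf h hcy.le) hc.not_ge
      · intro h
        exact hz ((le_inf_of_not_inf_le hcy.le h).trans inf_le_left)
  by_cases hyx : y ≤ x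
  · obtain ⟨F, h1, h2, h3⟩ := key y x fun h' => h (le_antisymm h' hyx)
    exact ⟨F, h1, h2, h3⟩
  · obtain ⟨F, h1, h2, h3⟩ := key x y hyx
    exact ⟨Fᶜ, h1.compl, h3, (compl_compl F).symm ▸ h2⟩

theorem exists_halfSpaces_nhds {x : X} {U : Set X} (hU : U ∈ 𝓝 x) :
    ∃ F : Set (Set X), F.Finite ∧ (∀ H ∈ F, IsHalfSpace H) ∧ ⋂₀ F ∈ 𝓝 x ∧ ⋂₀ F ⊆ U := by
  have hex : ∀ y ∈ (interior U)ᶜ, ∃ H : Set X, IsHalfSpace H ∧ H ∈ 𝓝 x ∧ Hᶜ ∈ 𝓝 y := by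
    intro y hy
    refine exists_isHalfSpace_separating ?_
    rintro rfl
    exact hy (mem_interior_iff_mem_nhds.2 hU)
  choose! H hH hx hy using hex
  obtain ⟨t, ht, hcov⟩ := isOpen_interior.isClosed_compl.isCompact.elim_nhds_subcover
    (fun y => (H y)ᶜ) hy
  refine ⟨H '' t, t.finite_toSet.image H, ?_, ?_, ?_⟩
  · rintro _ ⟨y, hyt, rfl⟩
    exact hH y (ht y hyt)
  · rw [sInter_image, biInter_mem t.finite_toSet]
    exact fun y hyt => hx y (ht y hyt)
  · intro z hz
    by_contra hzU
    have := hcov (show z ∈ (interior U)ᶜ from fun h => hzU (interior_subset h))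
    simp only [mem_iUnion] at this
    obtain ⟨y, hyt, hzy⟩ := this
    exact hzy (hz _ ⟨y, hyt, rfl⟩)

theorem exists_tConvex_nhds {x : X} {U : Set X} (hU : U ∈ 𝓝 x) :
    ∃ C ∈ 𝓝 x, TConvex C ∧ C ⊆ U := by
  obtain ⟨F, -, hF, hx, hFU⟩ := exists_halfSpaces_nhds hU
  exact ⟨_, hx, fun a ha b hb z hz H hH => (hF H hH).1 a (ha H hH) b (hb H hH) z hz, hFU⟩

end TreeOrder

/-! ### Dendrites are rooted topological trees -/

namespace IsDendrite

variable {X : Type*} [TopologicalSpace X]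

open Classical in
/-- The arc between two points of a dendrite (a singleton if the points coincide). -/
noncomputable def arc (hX : IsDendrite X) (x y : X) : Set X :=
  if h : x = y then {x} else (hX.existsUnique_arc x y h).choose

theorem t2Space (hX : IsDendrite X) : T2Space X :=
  have := hX.metrizable
  inferInstance

variable (hX : IsDendrite X)

theorem isArcBetween_arc {x y : X} (h : x ≠ y) : IsArcBetween x y (hX.arc x y) := by
  rw [arc, dif_neg h]
  exact (hX.existsUnique_arc x y h).choose_spec.1

theorem arc_self (x : X) : hX.arc x x = {x} := by simp [arc]

theorem eq_arc {x y : X} {A : Set X} (hA : IsArcBetween x y A) : A = hX.arc x y :=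
  (hX.existsUnique_arc x y hA.ne).unique hA (hX.isArcBetween_arc hA.ne)

theorem arc_comm (x y : X) : hX.arc x y = hX.arc y x := by
  by_cases h : x = y
  · rw [h]
  · exact hX.eq_arc (hX.isArcBetween_arc h).symm

theorem left_mem_arc (x y : X) : x ∈ hX.arc x y := by
  by_cases h : x = y
  · rw [h, arc_self]; rfl
  · exact (hX.isArcBetween_arc h).left_mem

theorem right_mem_arc (x y : X) : y ∈ hX.arc x y := hX.arc_comm y x ▸ hX.left_mem_arc y x

theorem isPreconnected_arc (x y : X) : IsPreconnected (hX.arc x y) := by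
  by_cases h : x = y
  · rw [h, arc_self]; exact isPreconnected_singleton
  · exact (hX.isArcBetween_arc h).isPreconnected

theorem isClosed_arc (x y : X) : IsClosed (hX.arc x y) := by
  have := hX.t2Space
  by_cases h : x = y
  · rw [h, arc_self]; exact isClosed_singleton
  · exact (hX.isArcBetween_arc h).isCompact.isClosed

theorem arc_split {x y z : X} (hz : z ∈ hX.arc x y) :
    hX.arc x y = hX.arc x z ∪ hX.arc z y ∧ hX.arc x z ∩ hX.arc z y = {z} := by
  have := hX.t2Space
  by_cases hx : z = x
  · subst hx
    rw [arc_self, singleton_union, insert_eq_self.2 hz, inter_eq_left.2 (singleton_subset_iff.2 hz)]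
    exact ⟨rfl, rfl⟩
  by_cases hy : z = y
  · subst hy
    rw [arc_self, union_singleton, insert_eq_self.2 hz, inter_eq_right.2 (singleton_subset_iff.2 hz)]
    exact ⟨rfl, rfl⟩
  have hxy : x ≠ y := by
    rintro rfl
    rw [arc_self] at hz
    exact hx hz
  obtain ⟨B, C, hB, hC, h1, h2⟩ := (hX.isArcBetween_arc hxy).split hz hx hy
  rw [hX.eq_arc hB, hX.eq_arc hC] at h1 h2
  exact ⟨h1, h2⟩

theorem arc_concat {x y z : X} (h : hX.arc x z ∩ hX.arc z y ⊆ {z}) :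
    hX.arc x y = hX.arc x z ∪ hX.arc z y := by
  have := hX.t2Space
  by_cases hx : x = z
  · rw [hx, arc_self, singleton_union, insert_eq_self.2 (hX.left_mem_arc _ _)]
  by_cases hy : z = y
  · rw [← hy, arc_self, union_singleton, insert_eq_self.2 (hX.right_mem_arc _ _)]
  refine (hX.eq_arc ((hX.isArcBetween_arc hx).concat (hX.isArcBetween_arc hy) ?_)).symm
  exact Subset.antisymm h (singleton_subset_iff.2 ⟨hX.right_mem_arc _ _, hX.left_mem_arc _ _⟩)

/-- Follow the arc from `z` to `x` and stop at its first entry into `A`. -/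
theorem exists_arc_inter_eq {A : Set X} (hA : IsClosed A) {x : X} (hx : x ∈ A) (z : X) :
    ∃ w ∈ A, hX.arc z w ∩ A ⊆ {w} := by
  have := hX.t2Space
  by_cases hz : z ∈ A
  · exact ⟨z, hz, by rw [arc_self]; exact inter_subset_left⟩
  have hne : z ≠ x := fun h => hz (h ▸ hx)
  obtain ⟨γ, hγ, hi, h0, h1, -⟩ := (hX.isArcBetween_arc hne).exists_param zero_lt_one
  obtain ⟨t, ⟨ht, htA⟩, hmin⟩ := (isCompact_Icc.of_isClosed_subset
    (hγ.preimage_isClosed_of_isClosed isClosed_Icc hA) inter_subset_left).exists_isLeast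
    ⟨1, ⟨zero_le_one, le_rfl⟩, show γ 1 ∈ A from h1 ▸ hx⟩
  have ht0 : 0 < t := lt_of_le_of_ne ht.1 fun e => hz (h0 ▸ e ▸ htA)
  have hs : Icc 0 t ⊆ Icc (0 : ℝ) 1 := Icc_subset_Icc_right ht.2
  have harc := isArcBetween_image_Icc ht0 (hγ.mono hs) (hi.mono hs)
  rw [h0] at harc
  refine ⟨γ t, htA, ?_⟩
  rw [← hX.eq_arc harc]
  rintro _ ⟨⟨s, hs', rfl⟩, hsA⟩
  rw [le_antisymm hs'.2 (hmin ⟨hs hs', hsA⟩)]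
  rfl

/-- The first point of the arc from `x` to `y` met when coming from `z` is the median. With `z` the
root, it becomes the meet of `x` and `y`. -/
theorem exists_median (x y z : X) :
    ∃ w, w ∈ hX.arc x y ∧ w ∈ hX.arc z x ∧ w ∈ hX.arc z y := by
  obtain ⟨w, hw, hd⟩ := hX.exists_arc_inter_eq (hX.isClosed_arc x y) (hX.left_mem_arc x y) z
  have hs := (hX.arc_split hw).1
  refine ⟨w, hw, ?_, ?_⟩
  · rw [hX.arc_concat (z := w)]
    · exact Or.inl (hX.right_mem_arc _ _)
    · refine (inter_subset_inter_right _ ?_).trans hd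
      rw [hX.arc_comm w x, hs]
      exact subset_union_left
  · rw [hX.arc_concat (z := w)]
    · exact Or.inl (hX.right_mem_arc _ _)
    · refine (inter_subset_inter_right _ ?_).trans hd
      rw [hs]
      exact subset_union_right

theorem arc_antisymm {a x y : X} (h : x ∈ hX.arc a y) (h' : y ∈ hX.arc a x) : x = y := by
  have : y ∈ hX.arc a x ∩ hX.arc x y := ⟨h', hX.right_mem_arc x y⟩
  rw [(hX.arc_split h).2] at this
  exact this.symm

theorem arc_trans {a x y z : X} (h : x ∈ hX.arc a y) (h' : y ∈ hX.arc a z) : x ∈ hX.arc a z := by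
  rw [(hX.arc_split h').1]
  exact Or.inl h

theorem arc_total {e a b c : X} (ha : a ∈ hX.arc e c) (hb : b ∈ hX.arc e c) :
    a ∈ hX.arc e b ∨ b ∈ hX.arc e a := by
  have h1 := ha
  rw [(hX.arc_split hb).1] at h1
  refine h1.imp_right fun h1 => ?_
  have h2 := hb
  rw [(hX.arc_split ha).1] at h2
  rcases h2 with h2 | h2
  · exact h2
  · rw [hX.arc_comm] at h1 h2
    rw [hX.arc_antisymm h1 h2]
    exact hX.right_mem_arc _ _

theorem mem_arc_of_mem {e a b z : X} (ha : a ∈ hX.arc e z) (hz : z ∈ hX.arc e b) :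
    z ∈ hX.arc a b := by
  have h := hz
  rw [(hX.arc_split (hX.arc_trans ha hz)).1] at h
  rcases h with h | h
  · rw [hX.arc_antisymm h ha]; exact hX.left_mem_arc _ _
  · exact h

theorem mem_of_mem_arc {e a b z : X} (ha : a ∈ hX.arc e b) (hz : z ∈ hX.arc a b) :
    a ∈ hX.arc e z ∧ z ∈ hX.arc e b := by
  have hzb : z ∈ hX.arc e b := by rw [(hX.arc_split ha).1]; exact Or.inr hz
  refine ⟨(hX.arc_total ha hzb).elim id fun h => ?_, hzb⟩
  have : z ∈ hX.arc e a ∩ hX.arc a b := ⟨h, hz⟩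
  rw [(hX.arc_split ha).2] at this
  rw [mem_singleton_iff.1 this]
  exact hX.right_mem_arc _ _

/-- A dendrite is a rooted topological tree, for any choice of the root. -/
theorem exists_treeSpace (hX : IsDendrite X) (e : X) : ∃ (_ : SemilatticeInf X) (_ : OrderBot X),
    TreeSpace X ∧ (⊥ : X) = e := by
  choose med h1 h2 h3 using fun x y => hX.exists_median x y e
  let i : SemilatticeInf X :=
    { le := fun x y => x ∈ hX.arc e y
      le_refl := fun x => hX.right_mem_arc e x
      le_trans := fun x y z h h' => hX.arc_trans h h'
      le_antisymm := fun x y h h' => hX.arc_antisymm h h'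
      inf := med
      inf_le_left := h2
      inf_le_right := h3
      le_inf := fun u x y hx hy => by
        rcases hX.arc_total hx (h2 x y) with h | h
        · exact h
        · have a1 := hX.mem_arc_of_mem h hx
          have a2 := hX.mem_arc_of_mem h hy
          have : u ∈ hX.arc x (med x y) ∩ hX.arc (med x y) y := ⟨hX.arc_comm _ _ ▸ a1, a2⟩
          rw [(hX.arc_split (h1 x y)).2] at this
          rw [mem_singleton_iff.1 this]
          exact hX.right_mem_arc _ _ }
  let j : OrderBot X := { bot := e, bot_le := fun x => hX.left_mem_arc e x }
  refine ⟨i, j, ?_, rfl⟩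
  have hIcc : ∀ a b : X, a ≤ b → Icc a b = hX.arc a b := fun a b hab => by
    ext z
    exact ⟨fun h => hX.mem_arc_of_mem h.1 h.2, fun h => hX.mem_of_mem_arc hab h⟩
  have hmet := hX.metrizable
  have hcont : ContinuousInf X := by
    let _ := TopologicalSpace.metrizableSpaceMetric X
    -- Either the two meets coincide or both lie on the arc from `x` to `x'`, which is small. The
    -- estimate is uniform in `y`, so joint continuity follows by moving one argument at a time.
    have key : ∀ x : X, ∀ ε > 0, ∀ᶠ x' in 𝓝 x, ∀ y, dist (x ⊓ y) (x' ⊓ y) < ε := by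
      intro x ε hε
      filter_upwards [hX.eventually_arc_subset (Metric.ball_mem_nhds x (half_pos hε))] with x' hx' y
      have harc : ∀ a b : X, a ≤ x → x ⊓ x' ≤ a → b ≤ x' → x ⊓ x' ≤ b → dist a b < ε := by
        intro a b ha ha' hb hb'
        by_cases hne : x = x'
        · subst hne
          rw [inf_idem] at ha' hb'
          rw [le_antisymm ha ha', le_antisymm hb hb', dist_self]
          exact hε
        have hsub := hx' _ (hX.isArcBetween_arc hne)
        rw [(hX.arc_split (h1 x x')).1] at hsub
        have m1 := Metric.mem_ball.1 (hsub (Or.inl (hX.arc_comm _ _ ▸ hX.mem_arc_of_mem ha' ha)))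
        have m2 := Metric.mem_ball.1 (hsub (Or.inr (hX.mem_arc_of_mem hb' hb)))
        linarith [dist_triangle_right a b x]
      have a1 : x ⊓ y ≤ y := inf_le_right
      have a2 : x' ⊓ y ≤ y := inf_le_right
      have b1 : x ⊓ y ≤ x := inf_le_left
      have b2 : x' ⊓ y ≤ x' := inf_le_left
      by_cases c1 : x ⊓ x' ≤ x ⊓ y
      · exact harc _ _ b1 c1 b2 (le_inf inf_le_right (c1.trans a1))
      by_cases c2 : x ⊓ x' ≤ x' ⊓ y
      · exact harc _ _ b1 (le_inf inf_le_left (c2.trans a2)) b2 c2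
      have d1 := (hX.arc_total (show x ⊓ x' ≤ x from inf_le_left) b1).resolve_left c1
      have d2 := (hX.arc_total (show x ⊓ x' ≤ x' from inf_le_right) b2).resolve_left c2
      have : x ⊓ y = x' ⊓ y := le_antisymm
        (le_inf (le_trans (show x ⊓ y ≤ x ⊓ x' from d1) inf_le_right) a1)
        (le_inf (le_trans (show x' ⊓ y ≤ x ⊓ x' from d2) inf_le_left) a2)
      rw [this, dist_self]
      exact hε
    refine ⟨continuous_iff_continuousAt.2 fun ⟨x, y⟩ => ?_⟩
    refine Metric.tendsto_nhds.2 fun ε hε => ?_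
    rw [nhds_prod_eq]
    filter_upwards [(key x _ (half_pos hε)).prod_mk (key y _ (half_pos hε))] with p hp
    have e1 := hp.1 y
    have e2 := hp.2 p.1
    rw [inf_comm y, inf_comm p.2] at e2
    linarith [dist_triangle_right (p.1 ⊓ p.2) (x ⊓ y) (p.1 ⊓ y), dist_comm (p.1 ⊓ p.2) (p.1 ⊓ y)]
  exact
    { toCompactSpace := hX.compact
      toMetrizableSpace := hmet
      toContinuousInf := hcont
      le_total_of_le := fun a b c ha hb => hX.arc_total ha hb
      isPreconnected_Icc := fun a b hab => by
        rw [hIcc a b hab]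
        exact hX.isPreconnected_arc a b }

end IsDendrite

theorem IsArcBetween.eq_setOf_tbtw {X : Type*} [TopologicalSpace X] [SemilatticeInf X] [OrderBot X]
    [TreeSpace X] {x y : X} {A : Set X} (h : IsArcBetween x y A) : A = {z | TBtw x z y} :=
  (h.eq_of_subset (isPreconnected_setOf_tbtw x y) (tbtw_left x y) (tbtw_right x y) fun z hz =>
    h.isPreconnected.tConvex _ h.left_mem _ h.right_mem z hz).symm

/-! ### Extending an order isomorphism between dense subsets to a homeomorphism -/

section MeetRel

variable {X Y : Type*} [SemilatticeInf X] [OrderBot X] [SemilatticeInf Y] [OrderBot Y]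

/-- A relation between `X` and `Y` that preserves order and meets. -/
structure IsMeetRel (S : Set (X × Y)) : Prop where
  bot_mem : (⊥, ⊥) ∈ S
  le_iff : ∀ p ∈ S, ∀ q ∈ S, (p.1 ≤ q.1 ↔ p.2 ≤ q.2)
  inf_mem : ∀ p ∈ S, ∀ q ∈ S, (p.1 ⊓ q.1, p.2 ⊓ q.2) ∈ S

theorem IsMeetRel.swap {S : Set (X × Y)} (h : IsMeetRel S) : IsMeetRel (Prod.swap ⁻¹' S) where
  bot_mem := h.bot_mem
  le_iff _ hp _ hq := (h.le_iff _ hp _ hq).symm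
  inf_mem _ hp _ hq := h.inf_mem _ hp _ hq

theorem IsMeetRel.lt_iff {S : Set (X × Y)} (h : IsMeetRel S) {p q : X × Y} (hp : p ∈ S)
    (hq : q ∈ S) : p.1 < q.1 ↔ p.2 < q.2 := by
  rw [lt_iff_le_not_ge, lt_iff_le_not_ge, h.le_iff p hp q hq, h.le_iff q hq p hp]

theorem IsMeetRel.tbtw_iff {S : Set (X × Y)} (h : IsMeetRel S) {p q r : X × Y} (hp : p ∈ S)
    (hq : q ∈ S) (hr : r ∈ S) : TBtw p.1 q.1 r.1 ↔ TBtw p.2 q.2 r.2 := by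
  rw [TBtw, TBtw, h.le_iff q hq p hp, h.le_iff q hq r hr,
    ← h.le_iff _ (h.inf_mem p hp r hr) q hq]

end MeetRel

theorem mem_closure_preimage_swap {X Y : Type*} [TopologicalSpace X] [TopologicalSpace Y]
    {S : Set (X × Y)} {x : X} {y : Y} :
    (y, x) ∈ closure (Prod.swap ⁻¹' S) ↔ (x, y) ∈ closure S := by
  have := (Homeomorph.prodComm Y X).preimage_closure S
  exact (Set.ext_iff.1 this (y, x)).symm

section Extension

variable {X Y : Type*} [TopologicalSpace X] [SemilatticeInf X] [OrderBot X] [TreeSpace X]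
  [TopologicalSpace Y] [SemilatticeInf Y] [OrderBot Y] [TreeSpace Y]

theorem exists_mem_lt_of_mem_nhds {x : X} (hx : x ≠ ⊥) {U : Set X} (hU : U ∈ 𝓝 x) :
    ∃ z ∈ U, z < x := by
  obtain ⟨z, hz, hzU, hzx⟩ := TreeSpace.isPreconnected_Icc ⊥ x bot_le _ _ isOpen_interior
    (isOpen_compl_singleton (x := x)) (fun z _ => by
      by_cases h : z = x
      · exact Or.inl (h ▸ mem_interior_iff_mem_nhds.2 hU)
      · exact Or.inr h) ⟨x, right_mem_Icc.2 bot_le, mem_interior_iff_mem_nhds.2 hU⟩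
    ⟨⊥, left_mem_Icc.2 bot_le, hx.symm⟩
  exact ⟨z, interior_subset hzU, lt_of_le_of_ne hz.2 hzx⟩

/-- If `y` is not below `y'`, choose three pairs of `S` whose second coordinates increase strictly
between `y ⊓ y'` and `y`. Approximating `(x, y)` puts `x` above the middle pair; then pairs
approximating `(x, y')` lie above the lowest one, although `y'` does not. Hence the closure of `S`
is the graph of a partial function. -/
theorem IsMeetRel.closure_unique {S : Set (X × Y)} (h : IsMeetRel S)
    (hd : ∀ a b : Y, a < b → ∃ p ∈ S, a < p.2 ∧ p.2 < b) {x : X} {y y' : Y}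
    (hy : (x, y) ∈ closure S) (hy' : (x, y') ∈ closure S) : y ≤ y' := by
  by_contra hn
  obtain ⟨p₃, hp₃, h3, h3'⟩ := hd _ _ (inf_lt_left.2 hn : y ⊓ y' < y)
  obtain ⟨p₂, hp₂, h2, h2'⟩ := hd _ _ h3
  obtain ⟨p₁, hp₁, h1, h1'⟩ := hd _ _ h2
  have hx : p₂.1 ≤ x := by
    by_contra hx
    obtain ⟨p, ⟨q1, q2⟩, hp⟩ := mem_closure_iff.1 hy ({w : X | ¬ p₂.1 ≤ w} ×ˢ
      {z : Y | ¬ z ⊓ p₃.2 ≤ p₂.2})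
      ((isClosed_le (by fun_prop) (by fun_prop)).isOpen_compl.prod
        (isClosed_le (by fun_prop) (by fun_prop)).isOpen_compl)
      ⟨hx, by simpa [inf_eq_right.2 h3'.le] using h2'.not_ge⟩
    exact q1 ((h.le_iff _ hp₂ _ hp).2 ((le_inf_of_not_inf_le h2'.le q2).trans inf_le_left))
  obtain ⟨p, ⟨q1, q2⟩, hp⟩ := mem_closure_iff.1 hy' ({w : X | ¬ w ⊓ p₂.1 ≤ p₁.1} ×ˢ
      {z : Y | ¬ p₁.2 ≤ z})
      ((isClosed_le (by fun_prop) (by fun_prop)).isOpen_compl.prod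
        (isClosed_le (by fun_prop) (by fun_prop)).isOpen_compl)
      ⟨by simpa [inf_eq_right.2 hx] using ((h.lt_iff hp₁ hp₂).2 h1').not_ge,
        fun h' => h1.not_ge (le_inf (h1'.le.trans (h2'.le.trans h3'.le)) h')⟩
  exact q2 ((h.le_iff _ hp₁ _ hp).1
    ((le_inf_of_not_inf_le ((h.lt_iff hp₁ hp₂).2 h1').le q1).trans inf_le_left))

/-- The first projection of the compact closure is closed, and it is dense because every point other
than the root is approached from below by first coordinates of `S`. -/
theorem IsMeetRel.exists_mem_closure {S : Set (X × Y)} (h : IsMeetRel S)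
    (hd : ∀ a b : X, a < b → ∃ p ∈ S, a < p.1 ∧ p.1 < b) (x : X) : ∃ y, (x, y) ∈ closure S := by
  have hcl : IsClosed (Prod.fst '' closure S) :=
    (isClosed_closure.isCompact.image continuous_fst).isClosed
  suffices x ∈ closure (Prod.fst '' closure S) by
    rw [hcl.closure_eq] at this
    obtain ⟨⟨_, y⟩, hy, rfl⟩ := this
    exact ⟨y, hy⟩
  by_cases hx : x = ⊥
  · exact subset_closure ⟨_, subset_closure h.bot_mem, hx.symm⟩
  refine mem_closure_iff_nhds.2 fun U hU => ?_
  obtain ⟨C, hC, hconv, hCU⟩ := exists_tConvex_nhds hU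
  obtain ⟨z, hz, hzx⟩ := exists_mem_lt_of_mem_nhds hx hC
  obtain ⟨p, hp, h1, h2⟩ := hd z x hzx
  exact ⟨p.1, hCU (hconv z hz x (mem_of_mem_nhds hC) _ (tbtw_of_le h1.le h2.le)), p,
    subset_closure hp, rfl⟩

theorem IsMeetRel.exists_homeomorph {S : Set (X × Y)} (h : IsMeetRel S)
    (hX : ∀ a b : X, a < b → ∃ p ∈ S, a < p.1 ∧ p.1 < b)
    (hY : ∀ a b : Y, a < b → ∃ p ∈ S, a < p.2 ∧ p.2 < b) :
    ∃ g : X ≃ₜ Y, ∀ p ∈ S, g p.1 = p.2 := by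
  have hX' : ∀ a b : X, a < b → ∃ p ∈ Prod.swap ⁻¹' S, a < p.2 ∧ p.2 < b := fun a b hab => by
    obtain ⟨p, hp, h1⟩ := hX a b hab
    exact ⟨p.swap, by simpa using hp, h1⟩
  have hY' : ∀ a b : Y, a < b → ∃ p ∈ Prod.swap ⁻¹' S, a < p.1 ∧ p.1 < b := fun a b hab => by
    obtain ⟨p, hp, h1⟩ := hY a b hab
    exact ⟨p.swap, by simpa using hp, h1⟩
  have : CompactSpace (closure S) := isCompact_iff_compactSpace.1 isClosed_closure.isCompact
  have b1 : Function.Bijective fun p : closure S => p.1.1 := by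
    refine ⟨?_, fun x => ?_⟩
    · rintro ⟨⟨x, y⟩, hp⟩ ⟨⟨x', y'⟩, hq⟩ (rfl : x = x')
      have := le_antisymm (h.closure_unique hY hp hq) (h.closure_unique hY hq hp)
      simp [this]
    · obtain ⟨y, hy⟩ := h.exists_mem_closure hX x
      exact ⟨⟨_, hy⟩, rfl⟩
  have b2 : Function.Bijective fun p : closure S => p.1.2 := by
    refine ⟨?_, fun y => ?_⟩
    · rintro ⟨⟨x, y⟩, hp⟩ ⟨⟨x', y'⟩, hq⟩ (rfl : y = y')
      have hp' := mem_closure_preimage_swap.2 hp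
      have hq' := mem_closure_preimage_swap.2 hq
      have := le_antisymm (h.swap.closure_unique hX' hp' hq') (h.swap.closure_unique hX' hq' hp')
      simp [this]
    · obtain ⟨x, hx⟩ := h.swap.exists_mem_closure hY' y
      exact ⟨⟨_, mem_closure_preimage_swap.1 hx⟩, rfl⟩
  let e1 : closure S ≃ₜ X := Continuous.homeoOfEquivCompactToT2 (f := Equiv.ofBijective _ b1)
    (continuous_fst.comp continuous_subtype_val)
  let e2 : closure S ≃ₜ Y := Continuous.homeoOfEquivCompactToT2 (f := Equiv.ofBijective _ b2)
    (continuous_snd.comp continuous_subtype_val)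
  refine ⟨e1.symm.trans e2, fun p hp => ?_⟩
  have : e1.symm p.1 = ⟨p, subset_closure hp⟩ := by
    rw [Homeomorph.symm_apply_eq]; rfl
  rw [Homeomorph.trans_apply, this]
  rfl

end Extension

/-! ### Back and forth between ramification points -/

section FinitePartialIso

variable {X Y : Type*} [TopologicalSpace X] [SemilatticeInf X] [OrderBot X]
  [TopologicalSpace Y] [SemilatticeInf Y] [OrderBot Y]

/-- A finite partial isomorphism between the ramification points of two rooted trees. -/
structure IsFinitePartialIso (S : Set (X × Y)) : Prop extends IsMeetRel S where
  finite : S.Finite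
  isRamificationPoint : ∀ p ∈ S, IsRamificationPoint p.1
  pointOrder_eq : ∀ p ∈ S, pointOrder p.1 = pointOrder p.2

theorem IsFinitePartialIso.swap {S : Set (X × Y)} (h : IsFinitePartialIso S) :
    IsFinitePartialIso (Prod.swap ⁻¹' S) where
  toIsMeetRel := h.toIsMeetRel.swap
  finite := h.finite.preimage Prod.swap_injective.injOn
  isRamificationPoint p hp := by
    have := h.pointOrder_eq _ hp
    have h' := h.isRamificationPoint _ hp
    rw [IsRamificationPoint, this] at h'
    exact h'
  pointOrder_eq p hp := (h.pointOrder_eq _ hp).symm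

theorem IsFinitePartialIso.insert_pair {S : Set (X × Y)} (h : IsFinitePartialIso S) {c : X} {d : Y}
    (hc : IsRamificationPoint c) (hcd : pointOrder c = pointOrder d)
    (h1 : ∀ p ∈ S, (p.1 ≤ c ↔ p.2 ≤ d)) (h2 : ∀ p ∈ S, (c ≤ p.1 ↔ d ≤ p.2))
    (h3 : ∀ p ∈ S, (c ⊓ p.1, d ⊓ p.2) ∈ insert (c, d) S) :
    IsFinitePartialIso (insert (c, d) S) where
  bot_mem := Or.inr h.bot_mem
  le_iff := by
    rintro p (rfl | hp) q (rfl | hq)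
    · simp
    · exact h2 q hq
    · exact h1 p hp
    · exact h.le_iff p hp q hq
  inf_mem := by
    rintro p (rfl | hp) q (rfl | hq)
    · simp
    · exact h3 q hq
    · rw [inf_comm p.1, inf_comm p.2]; exact h3 p hp
    · exact Or.inr (h.inf_mem p hp q hq)
  finite := h.finite.insert _
  isRamificationPoint := by
    rintro p (rfl | hp)
    · exact hc
    · exact h.isRamificationPoint p hp
  pointOrder_eq := by
    rintro p (rfl | hp)
    · exact hcd
    · exact h.pointOrder_eq p hp

end FinitePartialIso

section BackAndForth

variable {X Y : Type*} [TopologicalSpace X] [SemilatticeInf X] [OrderBot X] [TreeSpace X]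
  [TopologicalSpace Y] [SemilatticeInf Y] [OrderBot Y] [TreeSpace Y]

/-- The ramification points of each order in `P` are dense in all order intervals, and there are
no ramification points of other orders. -/
structure IsWazewskiTree (P : Set ℕ∞) (X : Type*) [TopologicalSpace X] [SemilatticeInf X] :
    Prop where
  three_le : ∀ p ∈ P, 3 ≤ p
  exists_between : ∀ p ∈ P, ∀ a b : X, a < b → ∃ c, a < c ∧ c < b ∧ pointOrder c = p
  order_mem : ∀ c : X, IsRamificationPoint c → pointOrder c ∈ P

/-- Extending a partial isomorphism to a point below a point of its domain. -/
theorem IsFinitePartialIso.extend_below {P : Set ℕ∞} (hX : IsWazewskiTree P X)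
    (hY : IsWazewskiTree P Y) {S : Set (X × Y)} (h : IsFinitePartialIso S) {c : X}
    (hc : IsRamificationPoint c) {p₀ : X × Y} (hp₀ : p₀ ∈ S) (hcp : c ≤ p₀.1) :
    ∃ d, IsFinitePartialIso (insert (c, d) S) := by
  -- `p` and `q` become the closest pairs of `S` above and below `c`. The first is a least one since
  -- `S` is closed under meets, the second a greatest one since the points below `c` form a chain.
  obtain ⟨p, ⟨hp, hcp⟩, hmin⟩ := (h.finite.subset (sep_subset S fun p => c ≤ p.1)).exists_minimalFor
    Prod.fst _ ⟨p₀, hp₀, hcp⟩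
  replace hmin : ∀ r ∈ S, c ≤ r.1 → p.1 ≤ r.1 := fun r hr hcr => by
    have := hmin (j := (p.1 ⊓ r.1, p.2 ⊓ r.2)) ⟨h.inf_mem p hp r hr, le_inf hcp hcr⟩ inf_le_left
    exact le_trans this inf_le_right
  obtain ⟨q, ⟨hq, hqc⟩, hmax⟩ := (h.finite.subset (sep_subset S fun p => p.1 ≤ c)).exists_maximalFor
    Prod.fst _ ⟨_, h.bot_mem, bot_le⟩
  replace hmax : ∀ r ∈ S, r.1 ≤ c → r.1 ≤ q.1 := fun r hr hrc => by
    rcases TreeSpace.total hrc hqc with h' | h'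
    · exact h'
    · exact hmax ⟨hr, hrc⟩ h'
  by_cases hcq : c = q.1
  · exact ⟨q.2, by rwa [hcq, Prod.mk.eta, insert_eq_of_mem hq]⟩
  by_cases hcp' : c = p.1
  · exact ⟨p.2, by rwa [hcp', Prod.mk.eta, insert_eq_of_mem hp]⟩
  have hqc' : q.1 < c := lt_of_le_of_ne hqc (Ne.symm hcq)
  have hcp'' : c < p.1 := lt_of_le_of_ne hcp hcp'
  have hqp : q.2 < p.2 := (h.lt_iff hq hp).1 (hqc'.trans hcp'')
  -- Any point of the right order strictly between `q.2` and `p.2` will do, since no pair of `S`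
  -- distinguishes it from the position of `c`.
  obtain ⟨d, hqd, hdp, hd⟩ := hY.exists_between _ (hX.order_mem c hc) _ _ hqp
  have k1 : ∀ r ∈ S, r.2 ≤ d → r.2 ≤ q.2 := by
    intro r hr hrd
    have h1 : r.1 ≤ p.1 := (h.le_iff r hr p hp).2 (hrd.trans hdp.le)
    refine (h.le_iff r hr q hq).1 ?_
    rcases TreeSpace.total h1 hcp with h' | h'
    · exact hmax r hr h'
    · exact absurd ((h.le_iff p hp r hr).1 (hmin r hr h')) (hrd.trans_lt hdp).not_ge
  have k2 : ∀ r ∈ S, d ≤ r.2 → p.2 ≤ r.2 := by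
    intro r hr hdr
    have hm := h.inf_mem p hp r hr
    rcases TreeSpace.total (inf_le_left : p.1 ⊓ r.1 ≤ p.1) hcp with h' | h'
    · have h1 := (h.le_iff _ hm q hq).1 (hmax _ hm h')
      exact absurd ((le_inf hdp.le hdr).trans h1) hqd.not_ge
    · exact (h.le_iff p hp r hr).1 (hmin r hr (h'.trans inf_le_right))
  have e1 : ∀ r ∈ S, (r.1 ≤ c ↔ r.2 ≤ d) := fun r hr =>
    ⟨fun h' => ((h.le_iff r hr q hq).1 (hmax r hr h')).trans hqd.le,
      fun h' => ((h.le_iff r hr q hq).2 (k1 r hr h')).trans hqc⟩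
  have e2 : ∀ r ∈ S, (c ≤ r.1 ↔ d ≤ r.2) := fun r hr =>
    ⟨fun h' => hdp.le.trans ((h.le_iff p hp r hr).1 (hmin r hr h')),
      fun h' => hcp.trans ((h.le_iff p hp r hr).2 (k2 r hr h'))⟩
  refine ⟨d, h.insert_pair hc hd.symm e1 e2 fun r hr => ?_⟩
  by_cases hcr : c ≤ r.1
  · left
    rw [inf_eq_left.2 hcr, inf_eq_left.2 ((e2 r hr).1 hcr)]
  · right
    have hdr : ¬ d ≤ r.2 := fun h' => hcr ((e2 r hr).2 h')
    have a1 : c ⊓ r.1 = p.1 ⊓ r.1 := by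
      refine le_antisymm (inf_le_inf_right _ hcp) (le_inf ?_ inf_le_right)
      exact (TreeSpace.total (inf_le_left : p.1 ⊓ r.1 ≤ p.1) hcp).resolve_right
        fun h' => hcr (h'.trans inf_le_right)
    have a2 : d ⊓ r.2 = p.2 ⊓ r.2 := by
      refine le_antisymm (inf_le_inf_right _ hdp.le) (le_inf ?_ inf_le_right)
      exact (TreeSpace.total (inf_le_left : p.2 ⊓ r.2 ≤ p.2) hdp.le).resolve_right
        fun h' => hdr (h'.trans inf_le_right)
    rw [a1, a2]
    exact h.inf_mem p hp r hr

/-- If a direction at a point of the domain is not used by a partial isomorphism, then some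
direction at its image is not used either. -/
theorem IsFinitePartialIso.exists_free_direction {S : Set (X × Y)} (h : IsFinitePartialIso S)
    {q : X × Y} (hq : q ∈ S) {m : X} (hm : m ≠ q.1) (hfree : ∀ r ∈ S, TBtw m q.1 r.1) :
    ∃ y, y ≠ q.2 ∧ ∀ r ∈ S, TBtw y q.2 r.2 := by
  by_contra! hn
  have hne : ∀ r ∈ S, (r.2 ≠ q.2 ↔ r.1 ≠ q.1) := fun r hr => by
    rw [Ne, Ne, le_antisymm_iff, le_antisymm_iff, h.le_iff r hr q hq, h.le_iff q hq r hr]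
  have hex : ∀ L : ConnectedComponents ({q.2}ᶜ : Set Y), ∃ r ∈ S, ∃ hr : r.2 ≠ q.2,
      L = pointComp q.2 r.2 hr := by
    intro L
    obtain ⟨y, hy, rfl⟩ := exists_pointComp_eq L
    obtain ⟨r, hr, hb⟩ := hn y hy
    have hrq : r.2 ≠ q.2 := fun e => hb (e ▸ tbtw_right y r.2)
    exact ⟨r, hr, hrq, (pointComp_eq_iff hy hrq).2 hb⟩
  choose r hr hrq hL using hex
  -- If all directions at `q.2` were used, there would be finitely many of them, and they would
  -- inject into the used directions at `q.1`. As the orders agree, all directions at `q.1` would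
  -- then be used, including that of `m`.
  let j : ConnectedComponents ({q.2}ᶜ : Set Y) → ConnectedComponents ({q.1}ᶜ : Set X) := fun L =>
    pointComp q.1 (r L).1 ((hne _ (hr L)).1 (hrq L))
  have hj : Function.Injective j := fun L L' e => by
    have := (pointComp_eq_iff _ _).1 e
    rw [h.tbtw_iff (hr L) hq (hr L')] at this
    rw [hL L, hL L']
    exact (pointComp_eq_iff _ _).2 this
  have hrinj : Function.Injective fun L => (⟨r L, hr L⟩ : S) := fun L L' e => by
    have : r L = r L' := congrArg Subtype.val e
    have hL' := hL L'
    simp only [← this] at hL'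
    exact (hL L).trans hL'.symm
  have : Finite S := h.finite
  have hfin : Finite (ConnectedComponents ({q.2}ᶜ : Set Y)) := Finite.of_injective _ hrinj
  have hcard := h.pointOrder_eq q hq
  rw [pointOrder, pointOrder] at hcard
  have hfin' : Finite (ConnectedComponents ({q.1}ᶜ : Set X)) := by
    rw [← ENat.card_lt_top, hcard, ENat.card_lt_top]; exact hfin
  have hcard' : Nat.card (ConnectedComponents ({q.1}ᶜ : Set X)) =
      Nat.card (ConnectedComponents ({q.2}ᶜ : Set Y)) := by
    rwa [ENat.card_eq_coe_natCard, ENat.card_eq_coe_natCard, Nat.cast_inj] at hcard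
  obtain ⟨L, hL'⟩ := (hj.bijective_of_nat_card_le hcard'.le).2 (pointComp q.1 m hm)
  exact (pointComp_eq_iff _ hm).1 hL' (hfree _ (hr L)).symm

/-- Extending a partial isomorphism to a point branching off its domain at a point of the domain. -/
theorem IsFinitePartialIso.extend_above {P : Set ℕ∞} (hX : IsWazewskiTree P X)
    (hY : IsWazewskiTree P Y) {S : Set (X × Y)} (h : IsFinitePartialIso S) {m : X}
    (hm : IsRamificationPoint m) {q : X × Y} (hq : q ∈ S) (hqm : q.1 < m)
    (hmax : ∀ r ∈ S, m ⊓ r.1 ≤ q.1) : ∃ d, IsFinitePartialIso (insert (m, d) S) := by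
  obtain ⟨y, hy, hfree⟩ := h.exists_free_direction hq hqm.ne' fun r hr => ⟨hmax r hr, Or.inl hqm.le⟩
  have hqy : q.2 < y := lt_of_le_of_ne (bot_tbtw_iff.1 (hfree _ h.bot_mem).symm) hy.symm
  obtain ⟨d, hqd, hdy, hd⟩ := hY.exists_between _ (hX.order_mem m hm) _ _ hqy
  have hmax' : ∀ r ∈ S, d ⊓ r.2 ≤ q.2 := fun r hr =>
    (inf_le_inf_right _ hdy.le).trans (hfree r hr).1
  refine ⟨d, h.insert_pair hm hd.symm (fun r hr => ?_) (fun r hr => ?_) fun r hr => Or.inr ?_⟩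
  · refine ⟨fun h' => ?_, fun h' => ?_⟩
    · exact ((h.le_iff r hr q hq).1 ((le_inf h' le_rfl).trans (hmax r hr))).trans hqd.le
    · exact ((h.le_iff r hr q hq).2 ((le_inf h' le_rfl).trans (hmax' r hr))).trans hqm.le
  · refine ⟨fun h' => ?_, fun h' => ?_⟩
    · exact absurd ((le_inf le_rfl h').trans (hmax r hr)) hqm.not_ge
    · exact absurd ((le_inf le_rfl h').trans (hmax' r hr)) hqd.not_ge
  · have e1 : m ⊓ r.1 = q.1 ⊓ r.1 :=
      le_antisymm (le_inf (hmax r hr) inf_le_right) (inf_le_inf_right _ hqm.le)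
    have e2 : d ⊓ r.2 = q.2 ⊓ r.2 :=
      le_antisymm (le_inf (hmax' r hr) inf_le_right) (inf_le_inf_right _ hqd.le)
    rw [e1, e2]
    exact h.inf_mem q hq r hr

/-- The point at which `m` leaves the subtree spanned by `S` is the largest meet of `m` with a point
of the domain. It is added first, so that the domain stays closed under meets, and then `m` is added
above it. -/
theorem IsFinitePartialIso.extend {P : Set ℕ∞} (hX : IsWazewskiTree P X)
    (hY : IsWazewskiTree P Y) {S : Set (X × Y)} (h : IsFinitePartialIso S) {m : X}
    (hm : IsRamificationPoint m) :
    ∃ S', S ⊆ S' ∧ IsFinitePartialIso S' ∧ ∃ d, (m, d) ∈ S' := by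
  obtain ⟨p, hp, hmax⟩ := h.finite.exists_maximalFor (fun r => m ⊓ r.1) _ ⟨_, h.bot_mem⟩
  replace hmax : ∀ r ∈ S, m ⊓ r.1 ≤ m ⊓ p.1 := fun r hr => by
    rcases TreeSpace.total (inf_le_left : m ⊓ r.1 ≤ m) (inf_le_left : m ⊓ p.1 ≤ m) with h' | h'
    · exact h'
    · exact hmax hr h'
  by_cases hmp : m ≤ p.1
  · obtain ⟨d, hd⟩ := h.extend_below hX hY hm hp hmp
    exact ⟨_, subset_insert _ _, hd, d, mem_insert _ _⟩
  have hlt : m ⊓ p.1 < m := inf_lt_left.2 hmp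
  have hc : IsRamificationPoint (m ⊓ p.1) := by
    by_cases hpm : p.1 ≤ m
    · rw [inf_eq_right.2 hpm]; exact h.isRamificationPoint p hp
    by_cases hb : m ⊓ p.1 = ⊥
    · rw [hb]; exact h.isRamificationPoint _ h.bot_mem
    · exact isRamificationPoint_inf hmp hpm hb
  obtain ⟨c, hS⟩ := h.extend_below hX hY hc hp inf_le_right
  obtain ⟨d, hd⟩ := hS.extend_above hX hY hm (mem_insert _ _) hlt (by
    rintro r (rfl | hr)
    · exact inf_le_right
    · exact hmax r hr)
  exact ⟨_, (subset_insert _ _).trans (subset_insert _ _), hd, d, mem_insert _ _⟩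

/-- Finite partial isomorphisms of Ważewski trees extend to homeomorphisms. -/
theorem IsFinitePartialIso.exists_homeomorph {P : Set ℕ∞} (hne : P.Nonempty)
    (hX : IsWazewskiTree P X) (hY : IsWazewskiTree P Y) {S : Set (X × Y)}
    (h : IsFinitePartialIso S) : ∃ g : X ≃ₜ Y, ∀ p ∈ S, g p.1 = p.2 := by
  obtain ⟨u, hu⟩ := countable_isRamificationPoint.exists_eq_range
    (⟨_, h.isRamificationPoint _ h.bot_mem⟩ : {c : X | IsRamificationPoint c}.Nonempty)
  obtain ⟨v, hv⟩ := countable_isRamificationPoint.exists_eq_range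
    (⟨_, h.swap.isRamificationPoint _ h.swap.bot_mem⟩ : {c : Y | IsRamificationPoint c}.Nonempty)
  have step : ∀ n : ℕ, ∀ S : {S : Set (X × Y) // IsFinitePartialIso S},
      ∃ S' : {S : Set (X × Y) // IsFinitePartialIso S}, S.1 ⊆ S'.1 ∧ (∃ d, (u n, d) ∈ S'.1) ∧
        ∃ c, (c, v n) ∈ S'.1 := by
    rintro n ⟨S, hS⟩
    obtain ⟨S₁, h1, hS₁, d, hd⟩ := hS.extend hX hY (m := u n) (hu.symm ▸ mem_range_self n :)
    obtain ⟨S₂, h2, hS₂, c, hc⟩ := hS₁.swap.extend hY hX (m := v n) (hv.symm ▸ mem_range_self n :)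
    have h12 : S₁ ⊆ Prod.swap ⁻¹' S₂ := fun p hp => h2 (by simpa using hp)
    exact ⟨⟨_, hS₂.swap⟩, h1.trans h12, ⟨d, h12 hd⟩, c, hc⟩
  choose nx h1 h2 h3 using step
  let T : ℕ → {S : Set (X × Y) // IsFinitePartialIso S} := fun n =>
    Nat.rec ⟨S, h⟩ (fun n S => nx n S) n
  have hmono : Monotone fun n => (T n).1 := monotone_nat_of_le_succ fun n => h1 n (T n)
  let U : Set (X × Y) := ⋃ n, (T n).1
  have hpair : ∀ p ∈ U, ∀ q ∈ U, ∃ n, p ∈ (T n).1 ∧ q ∈ (T n).1 := by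
    intro p hp q hq
    obtain ⟨i, hi⟩ := mem_iUnion.1 hp
    obtain ⟨j, hj⟩ := mem_iUnion.1 hq
    exact ⟨max i j, hmono (le_max_left i j) hi, hmono (le_max_right i j) hj⟩
  have hU : IsMeetRel U :=
    { bot_mem := mem_iUnion.2 ⟨0, h.bot_mem⟩
      le_iff := fun p hp q hq => by
        obtain ⟨n, hn, hn'⟩ := hpair p hp q hq
        exact (T n).2.le_iff p hn q hn'
      inf_mem := fun p hp q hq => by
        obtain ⟨n, hn, hn'⟩ := hpair p hp q hq
        exact mem_iUnion.2 ⟨n, (T n).2.inf_mem p hn q hn'⟩ }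
  obtain ⟨p, hp⟩ := hne
  -- Every ramification point occurs in the union on its own side, and those of order `p` already
  -- meet every interval.
  obtain ⟨g, hg⟩ := hU.exists_homeomorph (fun a b hab => by
    obtain ⟨c, hac, hcb, hcp⟩ := hX.exists_between p hp a b hab
    have hc : c ∈ range u := hu ▸ show IsRamificationPoint c from
      (hX.three_le p hp).trans hcp.ge
    obtain ⟨n, rfl⟩ := hc
    obtain ⟨d, hd⟩ := h2 n (T n)
    exact ⟨_, mem_iUnion.2 ⟨n + 1, hd⟩, hac, hcb⟩) (fun a b hab => by
    obtain ⟨c, hac, hcb, hcp⟩ := hY.exists_between p hp a b hab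
    have hc : c ∈ range v := hv ▸ show IsRamificationPoint c from
      (hX.three_le p hp).trans hcp.ge
    obtain ⟨n, rfl⟩ := hc
    obtain ⟨d, hd⟩ := h3 n (T n)
    exact ⟨_, mem_iUnion.2 ⟨n + 1, hd⟩, hac, hcb⟩)
  exact ⟨g, fun q hq => hg q (mem_iUnion.2 ⟨0, hq⟩)⟩

end BackAndForth

/-! ### Trees with a strictly monotone function are dendrites -/

section StrictMonoTree

variable {X : Type*} [TopologicalSpace X] [SemilatticeInf X]

/-- On the chain `Icc a b` the function `h` is injective, and it omits no value: an omitted one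
would leave two points of the chain with nothing strictly between them. -/
theorem isArcBetween_Icc [CompactSpace X] [T2Space X] [OrderClosedTopology X]
    (htot : ∀ a b c : X, a ≤ c → b ≤ c → a ≤ b ∨ b ≤ a)
    (hd : ∀ a b : X, a < b → ∃ c, a < c ∧ c < b) {h : X → ℝ} (hc : Continuous h)
    (hm : StrictMono h) {a b : X} (hab : a < b) : IsArcBetween a b (Icc a b) := by
  have hcomp : IsCompact (Icc a b) := isClosed_Icc.isCompact
  have hr : h '' Icc a b = Icc (h a) (h b) := by
    refine Subset.antisymm ?_ fun τ hτ => ?_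
    · rintro _ ⟨z, hz, rfl⟩
      exact ⟨hm.monotone hz.1, hm.monotone hz.2⟩
    by_contra hτn
    obtain ⟨u, ⟨hu, huτ⟩, hum⟩ := (hcomp.inter_right (isClosed_Iic.preimage hc (t := Iic τ))
      ).exists_isMaxOn ⟨a, left_mem_Icc.2 hab.le, hτ.1⟩ hc.continuousOn
    obtain ⟨v, ⟨hv, hvτ⟩, hvm⟩ := (hcomp.inter_right (isClosed_Ici.preimage hc (t := Ici τ))
      ).exists_isMinOn ⟨b, right_mem_Icc.2 hab.le, hτ.2⟩ hc.continuousOn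
    have huv : u < v := by
      have hlt : h u < h v := lt_of_le_of_ne (le_trans huτ hvτ) fun e =>
        hτn ⟨u, hu, le_antisymm huτ (e ▸ hvτ)⟩
      refine lt_of_le_of_ne ((htot u v b hu.2 hv.2).resolve_right fun hvu => ?_) ?_
      · exact hlt.not_ge (hm.monotone hvu)
      · rintro rfl; exact lt_irrefl _ hlt
    obtain ⟨w, huw, hwv⟩ := hd u v huv
    have hw : w ∈ Icc a b := ⟨hu.1.trans huw.le, hwv.le.trans hv.2⟩
    rcases le_total (h w) τ with h' | h'
    · exact (hm huw).not_ge (hum ⟨hw, h'⟩)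
    · exact (hm hwv).not_ge (hvm ⟨hw, h'⟩)
  have : CompactSpace (Icc a b) := isCompact_iff_compactSpace.1 hcomp
  have := isArcBetween_range_of_fibers (K := Icc a b) (h := fun z => h z) (g := Subtype.val)
    (hc.comp continuous_subtype_val) continuous_subtype_val (fun u v => ⟨fun e => ?_, fun e => by
      rw [e]⟩) (hm hab) (by rw [← hr, image_eq_range]) (u := ⟨a, left_mem_Icc.2 hab.le⟩)
    (v := ⟨b, right_mem_Icc.2 hab.le⟩) rfl rfl
  · rwa [Subtype.range_coe] at this
  · rcases htot u v b u.2.2 v.2.2 with h' | h'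
    · exact h'.eq_of_not_lt fun hlt => (hm hlt).ne e
    · exact (h'.eq_of_not_lt fun hlt => (hm hlt).ne e.symm).symm

variable [OrderBot X]

theorem isArcBetween_setOf_tbtw [TreeSpace X] {h : X → ℝ} (hc : Continuous h) (hm : StrictMono h)
    {x y : X} (hxy : x ≠ y) : IsArcBetween x y {z | TBtw x z y} := by
  have key : ∀ {a b : X}, a < b → IsArcBetween a b (Icc a b) := fun hab =>
    isArcBetween_Icc TreeSpace.le_total_of_le (fun _ _ => exists_between_of_lt) hc hm hab
  have swap : ∀ x y : X, {z | TBtw x z y} = {z | TBtw y z x} := fun x y => by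
    ext z; exact tbtw_comm
  by_cases h1 : x ≤ y
  · rw [setOf_tbtw_of_le h1]
    exact key (lt_of_le_of_ne h1 hxy)
  by_cases h2 : y ≤ x
  · rw [swap, setOf_tbtw_of_le h2]
    exact (key (lt_of_le_of_ne h2 hxy.symm)).symm
  have e : {z | TBtw x z y} = Icc (x ⊓ y) x ∪ Icc (x ⊓ y) y := by
    ext z; simp [TBtw, and_or_left]
  rw [e]
  refine (key (inf_lt_left.2 h1)).symm.concat (key (inf_lt_right.2 h2)) ?_
  refine Subset.antisymm (fun z hz => le_antisymm (le_inf hz.1.2 hz.2.2) hz.1.1) ?_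
  rintro _ rfl
  exact ⟨left_mem_Icc.2 inf_le_left, left_mem_Icc.2 inf_le_right⟩

theorem TreeSpace.isDendrite [TreeSpace X] {h : X → ℝ} (hc : Continuous h) (hm : StrictMono h) :
    IsDendrite X where
  compact := inferInstance
  metrizable := inferInstance
  connected :=
    { isPreconnected_univ := TConvex.isPreconnected fun _ _ _ _ _ _ => trivial
      toNonempty := ⟨⊥⟩ }
  locallyConnected := locallyConnectedSpace_iff_connected_subsets.2 fun x U hU => by
    obtain ⟨C, hC, hconv, hCU⟩ := exists_tConvex_nhds hU
    exact ⟨C, hC, hconv.isPreconnected, hCU⟩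
  existsUnique_arc := fun x y hxy =>
    ⟨_, isArcBetween_setOf_tbtw hc hm hxy, fun A hA => hA.eq_setOf_tbtw⟩

end StrictMonoTree

/-! ### Labellings of the rationals with dense fibres -/

/-- Odd multiples of `2 ^ n / 3 ^ k` have 2-adic valuation `n`, and consecutive ones differ by `2 ^
(n + 1) / 3 ^ k`, which is less than `b - a` for large `k`. -/
theorem exists_rat_padicValRat_eq (n : ℕ) {a b : ℝ} (hab : a < b) :
    ∃ q : ℚ, a < q ∧ q < b ∧ padicValRat 2 q = n := by
  obtain ⟨k, hk⟩ := exists_pow_lt_of_lt_one (show 0 < (b - a) / 2 ^ (n + 1) by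
    have := sub_pos.2 hab
    positivity) (show (1 / 3 : ℝ) < 1 by norm_num)
  have h3 : (0 : ℝ) < 3 ^ k := by positivity
  have h2 : (0 : ℝ) < 2 ^ n := by positivity
  have hstep : (2 : ℝ) ^ (n + 1) < (b - a) * 3 ^ k := by
    rw [lt_div_iff₀ (by positivity), one_div, inv_pow, inv_mul_lt_iff₀ h3] at hk
    linarith
  set m : ℤ := ⌊(a * 3 ^ k / 2 ^ n - 1) / 2⌋ + 1 with hm
  have m1 : (a * 3 ^ k / 2 ^ n - 1) / 2 < m := by
    rw [hm]; push_cast; exact Int.lt_floor_add_one _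
  have m2 : (m : ℝ) ≤ (a * 3 ^ k / 2 ^ n - 1) / 2 + 1 := by
    rw [hm]; push_cast; linarith [Int.floor_le ((a * 3 ^ k / 2 ^ n - 1) / 2)]
  have hodd : (2 * m + 1 : ℤ) ≠ 0 := by omega
  have e1 : a * 3 ^ k < (2 * m + 1) * 2 ^ n := by
    have : a * 3 ^ k / 2 ^ n < 2 * m + 1 := by linarith
    rwa [div_lt_iff₀ h2] at this
  have e2 : (2 * m + 1) * 2 ^ n ≤ a * 3 ^ k + 2 ^ (n + 1) := by
    have : (2 * m + 1 : ℝ) ≤ (a * 3 ^ k + 2 ^ (n + 1)) / 2 ^ n := by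
      rw [add_div, pow_succ, mul_div_cancel_left₀ _ h2.ne']; linarith
    rwa [le_div_iff₀ h2] at this
  refine ⟨((2 * m + 1 : ℤ) : ℚ) * 2 ^ n / 3 ^ k, ?_, ?_, ?_⟩
  · push_cast
    rw [lt_div_iff₀ h3]
    exact e1
  · push_cast
    rw [div_lt_iff₀ h3]
    linarith
  · have hq : ((2 * m + 1 : ℤ) : ℚ) ≠ 0 := Int.cast_ne_zero.2 hodd
    rw [padicValRat.div (by positivity) (by positivity), padicValRat.mul hq (by positivity),
      padicValRat.pow, padicValRat.pow, padicValRat.of_int,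
      padicValInt.eq_zero_of_not_dvd (by omega)]
    have : padicValRat 2 (3 : ℚ) = 0 := by
      have := padicValRat.of_nat (p := 2) (n := 3)
      rw [Nat.cast_ofNat] at this
      rw [this, padicValNat.eq_zero_of_not_dvd (by norm_num)]
      rfl
    have h22 : padicValRat 2 (2 : ℚ) = 1 := by
      have := padicValRat.self (p := 2) (by norm_num)
      rwa [Nat.cast_ofNat] at this
    rw [this, h22]
    simp

theorem exists_labelling {α : Type*} {P : Set α} (hP : P.Countable) (hne : P.Nonempty) :
    ∃ l : ℚ → α, (∀ q, l q ∈ P) ∧ ∀ p ∈ P, ∀ a b : ℝ, a < b → ∃ q : ℚ, a < q ∧ q < b ∧ l q = p := by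
  obtain ⟨f, rfl⟩ := hP.exists_eq_range hne
  refine ⟨fun q => f (padicValRat 2 q).toNat, fun q => mem_range_self _, ?_⟩
  rintro _ ⟨n, rfl⟩ a b hab
  obtain ⟨q, h1, h2, h3⟩ := exists_rat_padicValRat_eq n hab
  exact ⟨q, h1, h2, by simp [h3]⟩

/-! ### The model space -/

namespace WazewskiModel

/-- A node is a finite sequence of steps, the last step first; a step `(q, k)` leaves the current
segment at position `q` along its `k`-th side branch. -/
abbrev Node := List (ℚ × ℕ)

/-- The steps that lead to a segment of the model: `ℓ q - 2` side branches are attached at each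
position `q`. -/
def Valid (ℓ : ℚ → ℕ∞) (s : ℚ × ℕ) : Prop := 0 < s.1 ∧ s.1 < 1 ∧ (s.2 : ℕ∞) + 3 ≤ ℓ s.1

/-- The points of the model: `v i` is the distance travelled along the segment of the node `i`. -/
def carrier (ℓ : ℚ → ℕ∞) : Set (Node → ℝ) :=
  {v | (∀ i, v i ∈ Icc (0 : ℝ) 1) ∧ (∀ j s, v (s :: j) ≠ 0 → v j = s.1 ∧ Valid ℓ s) ∧
    ∀ j s s', v (s :: j) ≠ 0 → v (s' :: j) ≠ 0 → s = s'}

theorem exists_cons_suffix {α : Type*} {i j : List α} (h : i <:+ j) (hne : i ≠ j) :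
    ∃ a, a :: i <:+ j := by
  obtain ⟨t, rfl⟩ := h
  rcases List.eq_nil_or_concat t with rfl | ⟨t, a, rfl⟩
  · simp at hne
  · exact ⟨a, t, by simp⟩

theorem not_cons_suffix {α : Type*} {i : List α} {a : α} : ¬ a :: i <:+ i := fun h => by
  simpa using h.length_le

variable {ℓ : ℚ → ℕ∞} {v w : Node → ℝ} {i j l : Node} {s s' : ℚ × ℕ}

theorem nonneg (hv : v ∈ carrier ℓ) (i : Node) : 0 ≤ v i := (hv.1 i).1

/-- A point that has reached the segment of `i` has passed through all earlier segments, leaving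
each at the prescribed position. Thus a nonzero coordinate determines those of all proper suffixes.
-/
theorem eq_of_suffix (hv : v ∈ carrier ℓ) (hi : v i ≠ 0) (h : s :: l <:+ i) :
    v l = s.1 ∧ Valid ℓ s := by
  induction i with
  | nil => simp at h
  | cons a i ih =>
    have h2 := hv.2.1 i a hi
    rcases List.suffix_cons_iff.1 h with h | h
    · obtain ⟨rfl, rfl⟩ := List.cons.inj h
      exact h2
    · refine ih ?_ h
      rw [h2.1]
      exact_mod_cast h2.2.1.ne'

theorem ne_zero_of_suffix (hv : v ∈ carrier ℓ) (hi : v i ≠ 0) (h : l <:+ i) : v l ≠ 0 := by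
  by_cases hli : l = i
  · rwa [hli]
  · obtain ⟨a, ha⟩ := exists_cons_suffix h hli
    have := eq_of_suffix hv hi ha
    rw [this.1]
    exact_mod_cast this.2.1.ne'

theorem suffix_total (hv : v ∈ carrier ℓ) (hi : v i ≠ 0) (hj : v j ≠ 0) : i <:+ j ∨ j <:+ i := by
  induction i with
  | nil => exact Or.inl List.nil_suffix
  | cons a i ih =>
    rcases ih (ne_zero_of_suffix hv hi (List.suffix_cons a i)) with h | h
    · by_cases hij : i = j
      · exact Or.inr (hij ▸ List.suffix_cons a i)
      · obtain ⟨b, hb⟩ := exists_cons_suffix h hij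
        have := hv.2.2 i a b hi (ne_zero_of_suffix hv hj hb)
        exact Or.inl (this ▸ hb)
    · exact Or.inr (h.trans (List.suffix_cons a i))

theorem inf_mem (hv : v ∈ carrier ℓ) (hw : w ∈ carrier ℓ) : v ⊓ w ∈ carrier ℓ := by
  have key : ∀ i, (v ⊓ w) i ≠ 0 → v i ≠ 0 ∧ w i ≠ 0 := fun i hi => by
    refine ⟨fun h => hi ?_, fun h => hi ?_⟩
    · simp [h, nonneg hw i]
    · simp [h, nonneg hv i]
  refine ⟨fun i => ⟨le_min (nonneg hv i) (nonneg hw i), (min_le_left _ _).trans (hv.1 i).2⟩,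
    fun j s h => ?_, fun j s s' h h' => hv.2.2 j s s' (key _ h).1 (key _ h').1⟩
  obtain ⟨h1, h2⟩ := key _ h
  refine ⟨?_, (hv.2.1 j s h1).2⟩
  simp [(hv.2.1 j s h1).1, (hw.2.1 j s h2).1]

theorem zero_mem : (0 : Node → ℝ) ∈ carrier ℓ := ⟨fun _ => by simp, by simp, by simp⟩

theorem ne_zero_of_le (hv : v ∈ carrier ℓ) (h : v ≤ w) (hi : v i ≠ 0) : w i ≠ 0 :=
  (((nonneg hv i).lt_of_ne' hi).trans_le (h i)).ne'

theorem isClosed_carrier : IsClosed (carrier ℓ) := by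
  -- The implications with hypothesis `≠ 0` become vanishing products, which are closed conditions
  -- on finitely many coordinates.
  have e : carrier ℓ = {v | (∀ i, v i ∈ Icc (0 : ℝ) 1) ∧
      (∀ j s, v (s :: j) * (v j - (s.1 : ℝ)) = 0) ∧ (∀ j s, ¬ Valid ℓ s → v (s :: j) = 0) ∧
      ∀ j s s', s ≠ s' → v (s :: j) * v (s' :: j) = 0} := by
    ext v
    refine and_congr_right fun _ => ⟨fun ⟨h1, h2⟩ => ⟨fun j s => ?_, fun j s hs => ?_,
      fun j s s' hs => ?_⟩, fun ⟨h1, h2, h3⟩ => ⟨fun j s hs => ⟨?_, ?_⟩, fun j s s' h h' => ?_⟩⟩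
    · by_cases h : v (s :: j) = 0
      · rw [h, zero_mul]
      · rw [(h1 j s h).1, sub_self, mul_zero]
    · by_contra h
      exact hs (h1 j s h).2
    · by_contra h
      exact hs (h2 j s s' (left_ne_zero_of_mul h) (right_ne_zero_of_mul h))
    · exact sub_eq_zero.1 ((mul_eq_zero.1 (h1 j s)).resolve_left hs)
    · by_contra h
      exact hs (h2 j s h)
    · by_contra hs
      exact mul_ne_zero h h' (h3 j s s' hs)
  rw [e]
  have h1 : IsClosed {v : Node → ℝ | ∀ i, v i ∈ Icc (0 : ℝ) 1} := by
    simp only [ofPred_forall]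
    exact isClosed_iInter fun i => isClosed_Icc.preimage (continuous_apply i)
  have h2 : IsClosed {v : Node → ℝ | ∀ (j : Node) (s : ℚ × ℕ),
      v (s :: j) * (v j - (s.1 : ℝ)) = 0} := by
    simp only [ofPred_forall]
    exact isClosed_iInter fun j => isClosed_iInter fun s => isClosed_eq (by fun_prop) (by fun_prop)
  have h3 : IsClosed {v : Node → ℝ | ∀ (j : Node) (s : ℚ × ℕ), ¬ Valid ℓ s → v (s :: j) = 0} := by
    simp only [ofPred_forall]
    exact isClosed_iInter fun j => isClosed_iInter fun s => isClosed_iInter fun _ =>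
      isClosed_eq (by fun_prop) (by fun_prop)
  have h4 : IsClosed {v : Node → ℝ | ∀ (j : Node) (s s' : ℚ × ℕ), s ≠ s' →
      v (s :: j) * v (s' :: j) = 0} := by
    simp only [ofPred_forall]
    exact isClosed_iInter fun j => isClosed_iInter fun s => isClosed_iInter fun s' =>
      isClosed_iInter fun _ => isClosed_eq (by fun_prop) (by fun_prop)
  exact h1.inter (h2.inter (h3.inter h4))

theorem isCompact_carrier : IsCompact (carrier ℓ) :=
  (isCompact_univ_pi fun _ : Node => isCompact_Icc (a := (0 : ℝ)) (b := 1)).of_isClosed_subset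
    isClosed_carrier fun _ hv i _ => hv.1 i

/-- If `a` is ahead at `i` and `b` at `j`, both nodes are visited by `c`, so one is a suffix of the
other, say `i` of `j`. Then `b` leaves the segment of `i` where `c` does, and `a`, being below `c`,
cannot be ahead there. -/
theorem le_or_le {a b c : Node → ℝ} (ha : a ∈ carrier ℓ) (hb : b ∈ carrier ℓ) (hc : c ∈ carrier ℓ)
    (hac : a ≤ c) (hbc : b ≤ c) : a ≤ b ∨ b ≤ a := by
  have key : ∀ {a b : Node → ℝ}, a ∈ carrier ℓ → b ∈ carrier ℓ → a ≤ c → b ≤ c → ∀ {i j : Node},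
      i <:+ j → b i < a i → a j < b j → False := by
    intro a b ha hb hac hbc i j hij hi hj
    have hbj : b j ≠ 0 := ((nonneg ha j).trans_lt hj).ne'
    have hne : i ≠ j := by rintro rfl; exact lt_asymm hi hj
    obtain ⟨s, hs⟩ := exists_cons_suffix hij hne
    have e1 := (eq_of_suffix hb hbj hs).1
    have e2 := (eq_of_suffix hc (ne_zero_of_le hb hbc hbj) hs).1
    have := hac i
    rw [e2, ← e1] at this
    exact hi.not_ge this
  by_contra! h
  obtain ⟨h1, h2⟩ := h
  simp only [Pi.le_def, not_forall, not_le] at h1 h2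
  obtain ⟨i, hi⟩ := h1
  obtain ⟨j, hj⟩ := h2
  have hai : a i ≠ 0 := ((nonneg hb i).trans_lt hi).ne'
  have hbj : b j ≠ 0 := ((nonneg ha j).trans_lt hj).ne'
  rcases suffix_total hc (ne_zero_of_le ha hac hai) (ne_zero_of_le hb hbc hbj) with h | h
  · exact key ha hb hac hbc h hi hj
  · exact key hb ha hbc hac h hj hi

open Classical in
/-- The point at position `t` of the segment of the node `i`, whose earlier coordinates are those
of `v`. -/
noncomputable def graft (v : Node → ℝ) (i : Node) (t : ℝ) : Node → ℝ := fun l =>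
  if l = i then t else if l <:+ i then v l else 0

theorem graft_self (v : Node → ℝ) (i : Node) (t : ℝ) : graft v i t i = t := if_pos rfl

theorem graft_of_suffix {t : ℝ} (h : l <:+ i) (hne : l ≠ i) : graft v i t l = v l := by
  simp [graft, h, hne]

theorem graft_of_not_suffix {t : ℝ} (h : ¬ l <:+ i) : graft v i t l = 0 := by
  have : l ≠ i := by rintro rfl; exact h List.suffix_rfl
  simp [graft, h, this]

theorem graft_mem (hv : v ∈ carrier ℓ) {t : ℝ} (ht : t ∈ Icc (0 : ℝ) 1)
    (hi : ∀ j s, i = s :: j → v j = s.1 ∧ Valid ℓ s) : graft v i t ∈ carrier ℓ := by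
  refine ⟨fun l => ?_, fun j s h => ?_, fun j s s' h h' => ?_⟩
  · by_cases hli : l = i
    · rw [hli, graft_self]; exact ht
    by_cases hs : l <:+ i
    · rw [graft_of_suffix hs hli]; exact hv.1 l
    · rw [graft_of_not_suffix hs]; simp
  · by_cases hji : s :: j = i
    · have hj : j <:+ i := hji ▸ List.suffix_cons s j
      have hne : j ≠ i := by rintro rfl; simp at hji
      rw [graft_of_suffix hj hne]
      exact hi j s hji.symm
    · have hs : s :: j <:+ i := by
        by_contra hs; exact h (graft_of_not_suffix hs)
      have hj : j <:+ i := (List.suffix_cons s j).trans hs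
      have hne : j ≠ i := by rintro rfl; exact not_cons_suffix hs
      rw [graft_of_suffix hs hji] at h
      rw [graft_of_suffix hj hne]
      exact hv.2.1 j s h
  · have hs : s :: j <:+ i := by
      by_contra hs; exact h (graft_of_not_suffix hs)
    have hs' : s' :: j <:+ i := by
      by_contra hs; exact h' (graft_of_not_suffix hs)
    have := List.suffix_of_suffix_length_le hs hs' (by simp)
    exact (List.cons.inj (this.eq_of_length (by simp))).1

theorem parent_eq (hv : v ∈ carrier ℓ) (hi : v i ≠ 0) : ∀ j s, i = s :: j → v j = s.1 ∧ Valid ℓ s :=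
  fun j s e => hv.2.1 j s (e ▸ hi)

/-- Since `v` and `w` differ at `i`, the point `v` cannot continue past the segment of `i`, so
cutting `w` off there loses nothing of `v`. -/
theorem le_graft (hv : v ∈ carrier ℓ) (hw : w ∈ carrier ℓ) (hvw : v ≤ w) {t : ℝ}
    (hi : w i ≠ 0) (hlt : v i ≠ w i) (ht : v i ≤ t) : v ≤ graft w i t := by
  intro l
  by_cases hli : l = i
  · rw [hli, graft_self]; exact ht
  by_cases hs : l <:+ i
  · rw [graft_of_suffix hs hli]; exact hvw l
  rw [graft_of_not_suffix hs]
  by_contra! hl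
  have hil := (suffix_total hw (ne_zero_of_le hv hvw hl.ne') hi).resolve_left hs
  obtain ⟨s, hs'⟩ := exists_cons_suffix hil (Ne.symm hli)
  exact hlt ((eq_of_suffix hv hl.ne' hs').1.trans
    (eq_of_suffix hw (ne_zero_of_le hv hvw hl.ne') hs').1.symm)

theorem graft_le (hv : v ∈ carrier ℓ) {t : ℝ} (ht : t ≤ v i) : graft v i t ≤ v := by
  intro l
  by_cases hli : l = i
  · rw [hli, graft_self]; exact ht
  by_cases hs : l <:+ i
  · rw [graft_of_suffix hs hli]
  · rw [graft_of_not_suffix hs]; exact nonneg hv l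

theorem eq_graft (hv : v ∈ carrier ℓ) (hi : v i ≠ 0) (hc : ∀ s, v (s :: i) = 0) :
    v = graft v i (v i) := by
  funext l
  by_cases hli : l = i
  · rw [hli, graft_self]
  by_cases hs : l <:+ i
  · rw [graft_of_suffix hs hli]
  rw [graft_of_not_suffix hs]
  by_contra hl
  obtain ⟨s, hs'⟩ := exists_cons_suffix ((suffix_total hv hl hi).resolve_left hs) (Ne.symm hli)
  exact ne_zero_of_suffix hv hl hs' (hc s)

end WazewskiModel

/-- The model of the Ważewski dendrite for the labelling `ℓ`. -/
def WazewskiModel (ℓ : ℚ → ℕ∞) : Type := WazewskiModel.carrier ℓ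

/-! ### The model as a rooted tree -/

namespace WazewskiModel

variable {ℓ : ℚ → ℕ∞}

instance : TopologicalSpace (WazewskiModel ℓ) := instTopologicalSpaceSubtype

instance : SemilatticeInf (WazewskiModel ℓ) := Subtype.semilatticeInf fun _ _ => inf_mem

instance : OrderBot (WazewskiModel ℓ) where
  bot := ⟨0, zero_mem⟩
  bot_le v := fun i => nonneg v.2 i

theorem inf_val (v w : WazewskiModel ℓ) : (v ⊓ w).1 = v.1 ⊓ w.1 := rfl

theorem exists_lt_of_lt {v w : WazewskiModel ℓ} (h : v < w) : ∃ i, v.1 i < w.1 i := by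
  by_contra! hn
  exact h.not_ge hn

/-- A point between two given ones at a given position. -/
theorem exists_between_at {v w : WazewskiModel ℓ} (h : v ≤ w) {i : Node} {t : ℝ}
    (h1 : v.1 i < t) (h2 : t < w.1 i) :
    ∃ c : WazewskiModel ℓ, v < c ∧ c < w ∧ c.1 i = t ∧ ∀ s, c.1 (s :: i) = 0 := by
  have h0 := nonneg v.2 i
  have hw : w.1 i ≠ 0 := by linarith
  have ht : t ∈ Icc (0 : ℝ) 1 := ⟨by linarith, by linarith [(w.2.1 i).2]⟩
  have e := graft_self w.1 i t
  refine ⟨⟨graft w.1 i t, graft_mem w.2 ht (parent_eq w.2 hw)⟩, ?_, ?_, e, fun s =>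
    graft_of_not_suffix not_cons_suffix⟩
  · refine lt_of_le_not_ge (le_graft v.2 w.2 h hw (by linarith) h1.le) fun h' => ?_
    have := h' i
    change graft w.1 i t i ≤ _ at this
    linarith
  · refine lt_of_le_not_ge (graft_le w.2 h2.le) fun h' => ?_
    have := h' i
    change _ ≤ graft w.1 i t i at this
    linarith

theorem exists_between_model {v w : WazewskiModel ℓ} (h : v < w) : ∃ c, v < c ∧ c < w := by
  obtain ⟨i, hi⟩ := exists_lt_of_lt h
  obtain ⟨c, h1, h2, -⟩ := exists_between_at h.le (i := i) (t := (v.1 i + w.1 i) / 2)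
    (by linarith) (by linarith)
  exact ⟨c, h1, h2⟩

/-- A weighted sum of the coordinates. -/
noncomputable def height (v : WazewskiModel ℓ) : ℝ :=
  ∑' i : Node, (1 / 2 : ℝ) ^ Encodable.encode i * v.1 i

theorem norm_height_le (i : Node) (v : WazewskiModel ℓ) :
    ‖(1 / 2 : ℝ) ^ Encodable.encode i * v.1 i‖ ≤ (1 / 2 : ℝ) ^ Encodable.encode i := by
  rw [norm_mul, Real.norm_eq_abs, Real.norm_eq_abs, abs_of_pos (by positivity),
    abs_of_nonneg (nonneg v.2 i)]
  exact mul_le_of_le_one_right (by positivity) (v.2.1 i).2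

theorem continuous_height : Continuous (height (ℓ := ℓ)) :=
  continuous_tsum (fun i => continuous_const.mul ((continuous_apply i).comp continuous_subtype_val))
    summable_geometric_two_encode norm_height_le

theorem strictMono_height : StrictMono (height (ℓ := ℓ)) := by
  intro v w h
  have hs : ∀ v : WazewskiModel ℓ,
      Summable fun i : Node => (1 / 2 : ℝ) ^ Encodable.encode i * v.1 i := fun v =>
    Summable.of_norm_bounded summable_geometric_two_encode fun i => norm_height_le i v
  obtain ⟨i, hi⟩ := exists_lt_of_lt h
  exact Summable.tsum_lt_tsum (i := i) (fun k => mul_le_mul_of_nonneg_left (h.le k) (by positivity))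
    (mul_lt_mul_of_pos_left hi (by positivity)) (hs v) (hs w)

instance : CompactSpace (WazewskiModel ℓ) := isCompact_iff_compactSpace.1 isCompact_carrier

instance : TopologicalSpace.MetrizableSpace (WazewskiModel ℓ) :=
  inferInstanceAs (TopologicalSpace.MetrizableSpace (carrier ℓ))

instance : ContinuousInf (WazewskiModel ℓ) where
  continuous_inf := continuous_induced_rng.2 <| continuous_pi fun i =>
    ((continuous_apply i).comp (continuous_subtype_val.comp continuous_fst)).inf
      ((continuous_apply i).comp (continuous_subtype_val.comp continuous_snd))

instance : OrderClosedTopology (WazewskiModel ℓ) where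
  isClosed_le' := by
    have : {p : WazewskiModel ℓ × WazewskiModel ℓ | p.1 ≤ p.2} = {p | p.1 ⊓ p.2 = p.1} := by
      ext; simp
    rw [this]
    exact isClosed_eq continuous_inf continuous_fst

instance : TreeSpace (WazewskiModel ℓ) where
  le_total_of_le a b c h h' := le_or_le a.2 b.2 c.2 h h'
  isPreconnected_Icc a b hab := by
    rcases hab.eq_or_lt with rfl | hab
    · rw [Icc_self]; exact isPreconnected_singleton
    · exact (isArcBetween_Icc (X := WazewskiModel ℓ) (fun a b c h h' => le_or_le a.2 b.2 c.2 h h')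
        (fun _ _ => exists_between_model) continuous_height strictMono_height hab).isPreconnected

theorem isDendrite : IsDendrite (WazewskiModel ℓ) :=
  TreeSpace.isDendrite continuous_height strictMono_height

end WazewskiModel

/-- There are `p - 2` side branches; the two added elements stand for the direction of the root and
the continuation of the segment. -/
theorem ENat.card_option_option_subtype_add_three_le {p : ℕ∞} (hp : 3 ≤ p) :
    ENat.card (Option (Option {k : ℕ // (k : ℕ∞) + 3 ≤ p})) = p := by
  induction p using ENat.recTopCoe with
  | top =>
    have : Infinite {k : ℕ // (k : ℕ∞) + 3 ≤ ⊤} :=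
      Infinite.of_injective (fun k : ℕ => ⟨k, le_top⟩) fun a b h => by simpa using h
    exact ENat.card_eq_top_of_infinite
  | coe n =>
    have hn : 3 ≤ n := by exact_mod_cast hp
    have e : {k : ℕ // (k : ℕ∞) + 3 ≤ n} ≃ Fin (n - 2) :=
      { toFun := fun k => ⟨k.1, by
          have : k.1 + 3 ≤ n := by exact_mod_cast k.2
          omega⟩
        invFun := fun k => ⟨k.1, by
          have : k.1 + 3 ≤ n := by omega
          exact_mod_cast this⟩
        left_inv := fun _ => rfl
        right_inv := fun _ => rfl }
    rw [ENat.card_congr e.optionCongr.optionCongr, ENat.card_eq_coe_natCard]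
    simp only [Nat.card_eq_fintype_card, Fintype.card_option, Fintype.card_fin]
    congr 1
    omega

/-! ### Orders of points in the model -/

namespace WazewskiModel

variable {ℓ : ℚ → ℕ∞} {c x y z : WazewskiModel ℓ} {i : Node} {q : ℚ}

/-- The node `i` is the last one visited by `c`. -/
def IsTop (c : WazewskiModel ℓ) (i : Node) : Prop := c.1 i ≠ 0 ∧ ∀ s, c.1 (s :: i) = 0

theorem IsTop.eq_zero (h : IsTop c i) {l : Node} (hl : ¬ l <:+ i) : c.1 l = 0 := by
  rw [eq_graft c.2 h.1 h.2]; exact graft_of_not_suffix hl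

theorem IsTop.eq_of_apply_eq (h : IsTop c i) (hi : z.1 i = c.1 i)
    (hz : ∀ s, z.1 (s :: i) = 0) : z = c := by
  have hzi : z.1 i ≠ 0 := hi ▸ h.1
  refine Subtype.ext (funext fun l => ?_)
  by_cases hs : l <:+ i
  · by_cases hli : l = i
    · rw [hli, hi]
    · obtain ⟨s, hs'⟩ := exists_cons_suffix hs hli
      rw [(eq_of_suffix z.2 hzi hs').1, (eq_of_suffix c.2 h.1 hs').1]
  · rw [h.eq_zero hs, IsTop.eq_zero ⟨hzi, hz⟩ hs]

/-- Side branches that leave the segment of the last node of `c` at `c`. -/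
abbrev Branch (ℓ : ℚ → ℕ∞) (q : ℚ) : Type := {k : ℕ // (k : ℕ∞) + 3 ≤ ℓ q}

theorem IsTop.ne_or_exists (h : IsTop c i) (hq : c.1 i = q) (hne : z ≠ c) :
    z.1 i ≠ q ∨ ∃ k : Branch ℓ q, z.1 ((q, k.1) :: i) ≠ 0 := by
  by_contra! hn
  refine hne (h.eq_of_apply_eq (hn.1.trans hq.symm) fun s => ?_)
  by_contra hs
  obtain ⟨h1, h2⟩ := z.2.2.1 i s hs
  have hsq : s.1 = q := by
    rw [hn.1] at h1
    exact_mod_cast h1.symm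
  have h3 := h2.2.2
  rw [hsq] at h3
  have h4 : z.1 ((q, s.2) :: i) = 0 := hn.2 ⟨s.2, h3⟩
  rw [← hsq] at h4
  exact hs h4

theorem eq_of_branch {k : ℕ} (h : z.1 ((q, k) :: i) ≠ 0) : z.1 i = q := (z.2.2.1 i _ h).1

theorem branch_unique {k k' : ℕ} (h : z.1 ((q, k) :: i) ≠ 0) (h' : z.1 ((q, k') :: i) ≠ 0) :
    k = k' := (Prod.mk.inj (z.2.2.2 i _ _ h h')).2

theorem inf_ne_zero_iff (l : Node) : (x ⊓ y).1 l ≠ 0 ↔ x.1 l ≠ 0 ∧ y.1 l ≠ 0 := by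
  have hx := nonneg x.2 l
  have hy := nonneg y.2 l
  rw [inf_val, Pi.inf_apply]
  refine ⟨fun h => ⟨fun e => h ?_, fun e => h ?_⟩, fun ⟨h1, h2⟩ => ?_⟩
  · rw [e, inf_eq_left.2 hy]
  · rw [e, inf_eq_right.2 hx]
  · exact (lt_min (hx.lt_of_ne' h1) (hy.lt_of_ne' h2)).ne'

open Classical in
/-- The direction of `x` seen from `c`: towards the root, along the last segment of `c`, or along
one of the side branches at `c`. -/
noncomputable def direction (c : WazewskiModel ℓ) (i : Node) (q : ℚ) (x : WazewskiModel ℓ) :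
    Option (Option (Branch ℓ q)) :=
  if c ≤ x then
    if h : ∃ k : Branch ℓ q, x.1 ((q, k.1) :: i) ≠ 0 then some (some h.choose) else some none
  else none

theorem direction_of_branch (hcx : c ≤ x) {k : Branch ℓ q} (hk : x.1 ((q, k.1) :: i) ≠ 0) :
    direction c i q x = some (some k) := by
  have h : ∃ k : Branch ℓ q, x.1 ((q, k.1) :: i) ≠ 0 := ⟨k, hk⟩
  rw [direction, if_pos hcx, dif_pos h]
  congr 2
  exact Subtype.ext (branch_unique h.choose_spec hk)

theorem direction_of_not_branch (hcx : c ≤ x)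
    (h : ¬ ∃ k : Branch ℓ q, x.1 ((q, k.1) :: i) ≠ 0) : direction c i q x = some none := by
  rw [direction, if_pos hcx, dif_neg h]

theorem direction_of_not_le (hcx : ¬ c ≤ x) : direction c i q x = none := if_neg hcx

/-- A point strictly above `c` either goes further along the segment of `i` or enters a unique side
branch at `q`. The meet of two such points exceeds `c` exactly when they make the same choice. -/
theorem IsTop.direction_eq_iff_of_le (h : IsTop c i) (hq : c.1 i = q) (hcx : c ≤ x) (hcy : c ≤ y)
    (hx : x ≠ c) (hy : y ≠ c) :
    direction c i q x = direction c i q y ↔ ¬ x ⊓ y ≤ c := by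
  have hmin : (x ⊓ y).1 i = min (x.1 i) (y.1 i) := rfl
  have hxi : (q : ℝ) ≤ x.1 i := hq ▸ hcx i
  have hyi : (q : ℝ) ≤ y.1 i := hq ▸ hcy i
  have hinf : ¬ x ⊓ y ≤ c → (x ⊓ y).1 i ≠ q ∨ ∃ k : Branch ℓ q, (x ⊓ y).1 ((q, k.1) :: i) ≠ 0 :=
    fun hn => h.ne_or_exists hq fun e => hn e.le
  by_cases bx : ∃ k : Branch ℓ q, x.1 ((q, k.1) :: i) ≠ 0
  · obtain ⟨k, hk⟩ := bx
    rw [direction_of_branch hcx hk]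
    have hxq := eq_of_branch hk
    by_cases bY : ∃ k : Branch ℓ q, y.1 ((q, k.1) :: i) ≠ 0
    · obtain ⟨k', hk'⟩ := bY
      rw [direction_of_branch hcy hk', Option.some.injEq, Option.some.injEq]
      constructor
      · rintro rfl hle
        have := (inf_ne_zero_iff _).2 ⟨hk, hk'⟩
        exact this (le_antisymm ((hle _).trans_eq (h.2 _)) (nonneg (x ⊓ y).2 _))
      · intro hn
        rcases hinf hn with h1 | ⟨k'', h1⟩
        · rw [hmin, hxq, eq_of_branch hk', min_self] at h1
          exact absurd rfl h1
        · rw [inf_ne_zero_iff] at h1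
          exact Subtype.ext ((branch_unique hk h1.1).trans (branch_unique h1.2 hk'))
    · rw [direction_of_not_branch hcy bY]
      refine iff_of_false (by simp) (not_not.2 ?_)
      by_contra hn
      rcases hinf hn with h1 | ⟨k'', h1⟩
      · rw [hmin, hxq, min_eq_left hyi] at h1
        exact h1 rfl
      · exact bY ⟨k'', ((inf_ne_zero_iff _).1 h1).2⟩
  · rw [direction_of_not_branch hcx bx]
    have hxq := (h.ne_or_exists hq hx).resolve_right bx
    by_cases bY : ∃ k : Branch ℓ q, y.1 ((q, k.1) :: i) ≠ 0
    · obtain ⟨k', hk'⟩ := bY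
      rw [direction_of_branch hcy hk']
      refine iff_of_false (by simp) (not_not.2 ?_)
      by_contra hn
      rcases hinf hn with h1 | ⟨k'', h1⟩
      · rw [hmin, eq_of_branch hk', min_eq_right hxi] at h1
        exact h1 rfl
      · exact bx ⟨k'', ((inf_ne_zero_iff _).1 h1).1⟩
    · rw [direction_of_not_branch hcy bY]
      have hyq := (h.ne_or_exists hq hy).resolve_right bY
      refine iff_of_true rfl fun hle => ?_
      have := hle i
      rw [hq] at this
      exact (lt_min (hxi.lt_of_ne' hxq) (hyi.lt_of_ne' hyq)).not_ge this

theorem IsTop.direction_eq_iff (h : IsTop c i) (hq : c.1 i = q) (hx : x ≠ c) (hy : y ≠ c) :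
    direction c i q x = direction c i q y ↔ ¬ TBtw x c y := by
  have key : ∀ {x y : WazewskiModel ℓ}, c ≤ x → ¬ c ≤ y → TBtw x c y := fun {x y} hcx hcy =>
    ⟨(TreeSpace.total inf_le_left hcx).resolve_right fun h => hcy (h.trans inf_le_right),
      Or.inl hcx⟩
  have hsome : ∀ {x : WazewskiModel ℓ}, c ≤ x → direction c i q x ≠ none := fun {x} hcx => by
    by_cases bx : ∃ k : Branch ℓ q, x.1 ((q, k.1) :: i) ≠ 0
    · obtain ⟨k, hk⟩ := bx
      simp [direction_of_branch hcx hk]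
    · simp [direction_of_not_branch hcx bx]
  by_cases hcx : c ≤ x
  · by_cases hcy : c ≤ y
    · rw [h.direction_eq_iff_of_le hq hcx hcy hx hy]
      simp [TBtw, hcx]
    · rw [direction_of_not_le hcy]
      exact iff_of_false (hsome hcx) (not_not.2 (key hcx hcy))
  · by_cases hcy : c ≤ y
    · rw [direction_of_not_le hcx]
      exact iff_of_false (hsome hcy).symm (not_not.2 (key hcy hcx).symm)
    · rw [direction_of_not_le hcx, direction_of_not_le hcy]
      exact iff_of_true rfl fun hb => hb.2.elim hcx hcy

theorem IsTop.ne_bot (h : IsTop c i) : c ≠ ⊥ := by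
  rintro rfl; exact h.1 rfl

theorem IsTop.exists_direction_eq (h : IsTop c i) (hq : c.1 i = q) (h0 : 0 < q) (h1 : q < 1)
    (d : Option (Option (Branch ℓ q))) : ∃ x, x ≠ c ∧ direction c i q x = d := by
  have one : (1 : ℝ) ∈ Icc (0 : ℝ) 1 := by simp
  have hq1 : (q : ℝ) < 1 := by exact_mod_cast h1
  rcases d with _ | _ | k
  · exact ⟨⊥, h.ne_bot.symm, direction_of_not_le fun hc => h.ne_bot (le_bot_iff.1 hc)⟩
  · have hle : c.1 ≤ graft c.1 i 1 := fun l => by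
      by_cases hli : l = i
      · rw [hli, graft_self]; exact (c.2.1 i).2
      by_cases hs : l <:+ i
      · rw [graft_of_suffix hs hli]
      · rw [graft_of_not_suffix hs, h.eq_zero hs]
    refine ⟨⟨graft c.1 i 1, graft_mem c.2 one (parent_eq c.2 h.1)⟩, fun e => ?_,
      direction_of_not_branch hle ?_⟩
    · have : graft c.1 i 1 i = c.1 i := congrFun (congrArg Subtype.val e) i
      rw [graft_self, hq] at this
      exact hq1.ne' this
    · rintro ⟨k, hk⟩
      exact hk (graft_of_not_suffix not_cons_suffix)
  · have hle : c.1 ≤ graft c.1 ((q, k.1) :: i) 1 := fun l => by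
      by_cases hs : l <:+ i
      · have hne : l ≠ (q, k.1) :: i := by rintro rfl; exact not_cons_suffix hs
        rw [graft_of_suffix (hs.trans (List.suffix_cons _ _)) hne]
      · rw [h.eq_zero hs]
        exact nonneg (graft_mem c.2 one fun j s e => by
          obtain ⟨rfl, rfl⟩ := List.cons.inj e
          exact ⟨hq, h0, h1, k.2⟩) l
    have hmem : graft c.1 ((q, k.1) :: i) 1 ∈ carrier ℓ := graft_mem c.2 one fun j s e => by
      obtain ⟨rfl, rfl⟩ := List.cons.inj e
      exact ⟨hq, h0, h1, k.2⟩
    have hval := graft_self c.1 ((q, k.1) :: i) 1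
    refine ⟨⟨_, hmem⟩, fun e => ?_, direction_of_branch hle (by simp [hval])⟩
    have : graft c.1 ((q, k.1) :: i) 1 ((q, k.1) :: i) = c.1 _ :=
      congrFun (congrArg Subtype.val e) _
    rw [hval, h.2] at this
    exact one_ne_zero this

theorem IsTop.pointOrder_eq (h : IsTop c i) (hq : c.1 i = q) (h0 : 0 < q) (h1 : q < 1)
    (h3 : 3 ≤ ℓ q) : pointOrder c = ℓ q := by
  rw [pointOrder_eq_card (fun x : ({c}ᶜ : Set (WazewskiModel ℓ)) => direction c i q x.1)]
  · exact ENat.card_option_option_subtype_add_three_le h3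
  · intro d
    obtain ⟨x, hx, hd⟩ := h.exists_direction_eq hq h0 h1 d
    exact ⟨⟨x, hx⟩, hd⟩
  · exact fun x y => h.direction_eq_iff hq x.2 y.2

theorem root_ne_zero (hc : c ≠ ⊥) : c.1 [] ≠ 0 := by
  intro h
  refine hc (Subtype.ext (funext fun l => ?_))
  by_contra hl
  exact ne_zero_of_suffix c.2 hl List.nil_suffix h

/-- A point with infinite support has no last node, but a larger point `x` rules this out: at a
shortest node where the two differ, `c` has stopped, either on that segment or on its parent. -/
theorem exists_isTop_of_lt (hc : c ≠ ⊥) (hcx : c < x) : ∃ i, IsTop c i := by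
  obtain ⟨i, hi, hmin⟩ := exists_minimalFor_of_wellFoundedLT
    (fun i : Node => c.1 i < x.1 i) List.length (exists_lt_of_lt hcx)
  have hxi : x.1 i ≠ 0 := ((nonneg c.2 i).trans_lt hi).ne'
  by_cases hci : c.1 i = 0
  · cases i with
    | nil => exact absurd hci (root_ne_zero hc)
    | cons s j =>
      have hxj := x.2.2.1 j s hxi
      have hcj : c.1 j = x.1 j := le_antisymm (hcx.le j) <| not_lt.1 fun hlt => by
        have := hmin hlt (by simp)
        simp at this
      refine ⟨j, ?_, fun s' => ?_⟩
      · rw [hcj, hxj.1]; exact_mod_cast hxj.2.1.ne'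
      · by_contra hs'
        have := x.2.2.2 j s s' hxi (ne_zero_of_le c.2 hcx.le hs')
        exact hs' (this ▸ hci)
  · refine ⟨i, hci, fun s => ?_⟩
    by_contra hs
    have e1 := (c.2.2.1 i s hs).1
    have e2 := (x.2.2.1 i s (ne_zero_of_le c.2 hcx.le hs)).1
    exact hi.ne (e1.trans e2.symm)

/-- Two directions lead away from the root. They cannot both continue along the last segment of `c`,
so one is a side branch, and side branches start only at rational positions in `(0, 1)`. -/
theorem exists_isTop_of_isRamificationPoint (hc : IsRamificationPoint c) :
    ∃ (i : Node) (q : ℚ), IsTop c i ∧ c.1 i = q ∧ 0 < q ∧ q < 1 := by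
  have hb : c ≠ ⊥ := by
    rintro rfl
    obtain ⟨x, hx⟩ := hc.exists_ne
    obtain ⟨y, hy, hxy, -⟩ := hc.exists_tbtw hx hx
    have h1 := (inf_ne_zero_iff []).2 ⟨root_ne_zero hx, root_ne_zero hy⟩
    rw [tbtw_bot_iff.1 hxy] at h1
    exact h1 rfl
  obtain ⟨x, hx, hbx, -⟩ := hc.exists_tbtw hb.symm hb.symm
  obtain ⟨y, hy, hby, hxy⟩ := hc.exists_tbtw hb.symm hx
  have hcx : c < x := lt_of_le_of_ne (bot_tbtw_iff.1 hbx) hx.symm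
  have hcy : c < y := lt_of_le_of_ne (bot_tbtw_iff.1 hby) hy.symm
  obtain ⟨i, hi⟩ := exists_isTop_of_lt hb hcx
  have key : ∀ z : WazewskiModel ℓ, c < z → z.1 i = c.1 i →
      ∃ (i : Node) (q : ℚ), IsTop c i ∧ c.1 i = q ∧ 0 < q ∧ q < 1 := by
    intro z hcz hzi
    have : ∃ s, z.1 (s :: i) ≠ 0 := by
      by_contra! hn
      exact hcz.ne' (IsTop.eq_of_apply_eq hi hzi hn)
    obtain ⟨s, hs⟩ := this
    obtain ⟨e, h1, h2, -⟩ := z.2.2.1 i s hs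
    exact ⟨i, s.1, hi, hzi ▸ e, h1, h2⟩
  by_cases hxi : x.1 i = c.1 i
  · exact key x hcx hxi
  by_cases hyi : y.1 i = c.1 i
  · exact key y hcy hyi
  · exact absurd (hxy.1 i)
      (lt_min ((hcx.le i).lt_of_ne' hxi) ((hcy.le i).lt_of_ne' hyi)).not_ge

theorem isWazewskiDendrite {P : Set ℕ∞} (hP : ∀ p ∈ P, 3 ≤ p) (hℓ : ∀ q, ℓ q ∈ P)
    (hd : ∀ p ∈ P, ∀ a b : ℝ, a < b → ∃ q : ℚ, a < q ∧ q < b ∧ ℓ q = p) :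
    IsWazewskiDendrite P (WazewskiModel ℓ) where
  dendrite := isDendrite
  nontrivial := by
    have h1 : graft 0 [] 1 ∈ carrier ℓ := graft_mem zero_mem (by simp) fun j s e => by simp at e
    refine ⟨⟨_, h1⟩, ⊥, fun e => ?_⟩
    have : graft 0 [] 1 [] = (0 : Node → ℝ) [] := congrFun (congrArg Subtype.val e) []
    rw [graft_self] at this
    exact one_ne_zero this
  arcwiseDense := by
    intro p hp
    have key : ∀ {a b : WazewskiModel ℓ}, a < b →
        ∃ c, a < c ∧ c < b ∧ IsRamificationPoint c ∧ pointOrder c = p := by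
      intro a b hab
      obtain ⟨i, hi⟩ := exists_lt_of_lt hab
      obtain ⟨q, h1, h2, rfl⟩ := hd p hp _ _ hi
      obtain ⟨c, hac, hcb, hci, hcs⟩ := exists_between_at hab.le h1 h2
      have h0 : (0 : ℝ) < q := (nonneg a.2 i).trans_lt h1
      have h1 : (q : ℝ) < 1 := h2.trans_le (b.2.1 i).2
      have htop : IsTop c i := ⟨by rw [hci]; exact h0.ne', hcs⟩
      have hord := htop.pointOrder_eq hci (by exact_mod_cast h0) (by exact_mod_cast h1)
        (hP _ hp)
      exact ⟨c, hac, hcb, (hP _ hp).trans hord.ge, hord⟩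
    intro x y A hA
    rw [hA.eq_setOf_tbtw]
    by_cases hxy : x ≤ y
    · obtain ⟨c, h1, h2, h3⟩ := key (lt_of_le_of_ne hxy hA.ne)
      exact ⟨c, h3, tbtw_of_le h1.le h2.le⟩
    · obtain ⟨c, h1, h2, h3⟩ := key (inf_lt_left.2 hxy)
      exact ⟨c, h3, h1.le, Or.inl h2.le⟩
  order_mem := by
    intro c hc
    obtain ⟨i, q, hi, hq, h0, h1⟩ := exists_isTop_of_isRamificationPoint hc
    rw [hi.pointOrder_eq hq h0 h1 (hP _ (hℓ q))]
    exact hℓ q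

end WazewskiModel

theorem exists_isWazewskiDendrite {P : Set ℕ∞} (hP : ∀ p ∈ P, 3 ≤ p) (hne : P.Nonempty) :
    ∃ (X : Type) (_ : MetricSpace X), IsWazewskiDendrite P X := by
  obtain ⟨ℓ, h1, h2⟩ := exists_labelling P.to_countable hne
  exact ⟨WazewskiModel ℓ, TopologicalSpace.metrizableSpaceMetric _,
    WazewskiModel.isWazewskiDendrite hP h1 h2⟩

/-! ### Branches and homogeneity of Ważewski dendrites -/

section

variable {X Y : Type*} [TopologicalSpace X] [TopologicalSpace Y] {P : Set ℕ∞}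

/-- The component of `X ∖ {m}` that contains `b`: the points `y` such that some connected set
contains `b` and `y` but not `m`. -/
def branch (m b : X) : Set X :=
  {y | ¬ ∀ C : Set X, IsPreconnected C → b ∈ C → y ∈ C → m ∈ C}

theorem mem_branch_self {m b : X} (h : b ≠ m) : b ∈ branch m b := fun hC =>
  h (hC {b} isPreconnected_singleton rfl rfl).symm

theorem map_mem_branch_iff (g : X ≃ₜ Y) {m b y : X} :
    g y ∈ branch (g m) (g b) ↔ y ∈ branch m b := by
  refine not_congr ⟨fun h C hC hb hy => ?_, fun h C hC hb hy => ?_⟩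
  · have := h (g '' C) (hC.image g g.continuous.continuousOn) (mem_image_of_mem g hb)
      (mem_image_of_mem g hy)
    exact (g.injective.mem_set_image).1 this
  · exact h (g ⁻¹' C) ((g.isPreconnected_preimage).2 hC) hb hy

theorem mem_branch_iff_not_tbtw [SemilatticeInf X] [OrderBot X] [TreeSpace X] {m b y : X} :
    y ∈ branch m b ↔ ¬ TBtw b m y := not_congr tbtw_iff_forall_isPreconnected.symm

theorem mem_branch_iff [SemilatticeInf X] [OrderBot X] [TreeSpace X] {m b y : X} (h : m ≤ b) :
    y ∈ branch m b ↔ ¬ b ⊓ y ≤ m :=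
  mem_branch_iff_not_tbtw.trans (not_congr (and_iff_left (Or.inl h)))

namespace IsWazewskiDendrite

theorem isWazewskiTree [SemilatticeInf X] [OrderBot X] [TreeSpace X] (hX : IsWazewskiDendrite P X)
    (hP : ∀ p ∈ P, 3 ≤ p) : IsWazewskiTree P X where
  three_le := hP
  exists_between p hp a b hab := by
    -- Arcwise density may return an endpoint of the arc, so the interval is first shrunk at both
    -- ends.
    obtain ⟨b', hab', hb'⟩ := exists_between_of_lt hab
    obtain ⟨a', ha', hab''⟩ := exists_between_of_lt hab'
    obtain ⟨A, hA, -⟩ := hX.dendrite.existsUnique_arc a' b' hab''.ne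
    obtain ⟨c, ⟨-, hc⟩, hcA⟩ := hX.arcwiseDense p hp a' b' A hA
    rw [hA.eq_setOf_tbtw, setOf_tbtw_of_le hab''.le] at hcA
    exact ⟨c, ha'.trans_le hcA.1, hcA.2.trans_lt hb', hc⟩
  order_mem := hX.order_mem

/-- Rooting the dendrites at `m` and `m'` makes the two prescribed pairs a finite partial
isomorphism, with the roots as one of the pairs. -/
theorem exists_homeomorph (hX : IsWazewskiDendrite P X) (hY : IsWazewskiDendrite P Y)
    (hP : ∀ p ∈ P, 3 ≤ p) (hne : P.Nonempty) {m b : X} {m' b' : Y} (hm : IsRamificationPoint m)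
    (hb : IsRamificationPoint b) (hmb : b ≠ m) (hmb' : b' ≠ m')
    (h1 : pointOrder m = pointOrder m') (h2 : pointOrder b = pointOrder b') :
    ∃ g : X ≃ₜ Y, g m = m' ∧ g b = b' := by
  obtain ⟨_, _, _, rfl⟩ := hX.dendrite.exists_treeSpace m
  obtain ⟨_, _, _, rfl⟩ := hY.dendrite.exists_treeSpace m'
  have hS : IsFinitePartialIso ({(⊥, ⊥), (b, b')} : Set (X × Y)) :=
    { bot_mem := Or.inl rfl
      le_iff := by
        rintro p (rfl | rfl) q (rfl | rfl) <;> simp [hmb, hmb']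
      inf_mem := by
        rintro p (rfl | rfl) q (rfl | rfl) <;> simp
      finite := by simp
      isRamificationPoint := by
        rintro p (rfl | rfl)
        exacts [hm, hb]
      pointOrder_eq := by
        rintro p (rfl | rfl)
        exacts [h1, h2] }
  obtain ⟨g, hg⟩ := hS.exists_homeomorph hne (hX.isWazewskiTree hP) (hY.isWazewskiTree hP)
  exact ⟨g, hg _ (Or.inl rfl), hg _ (Or.inr rfl)⟩

end IsWazewskiDendrite

end

/-! ### Small branches in open sets -/

section

variable {X : Type*} [TopologicalSpace X] [SemilatticeInf X] [OrderBot X] [TreeSpace X]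

/-- Ramification provides a direction at `m` that leads neither to `b` nor down to the root. -/
theorem IsWazewskiTree.exists_branch_lt {P : Set ℕ∞} (hX : IsWazewskiTree P X) {p : ℕ∞}
    (hp : p ∈ P) {m b : X} (hm : IsRamificationPoint m) (hmb : m < b) :
    ∃ w, m < w ∧ w ⊓ b = m ∧ pointOrder w = p := by
  obtain ⟨v, hv, hmv, hv'⟩ : ∃ v, v ≠ m ∧ m ≤ v ∧ TBtw b m v := by
    by_cases h0 : m = ⊥
    · obtain ⟨v, h1, h2, -⟩ := hm.exists_tbtw hmb.ne' hmb.ne'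
      exact ⟨v, h1, h0 ▸ bot_le, h2⟩
    · obtain ⟨v, h1, h2, h3⟩ := hm.exists_tbtw (Ne.symm h0) hmb.ne'
      exact ⟨v, h1, bot_tbtw_iff.1 h2, h3⟩
  obtain ⟨w, h1, h2, h3⟩ := hX.exists_between p hp m v (lt_of_le_of_ne hmv hv.symm)
  exact ⟨w, h1, le_antisymm ((inf_le_inf_right b h2.le).trans (inf_comm v b ▸ hv'.1))
    (le_inf h1.le hmb.le), h3⟩

/-- In a compact set disjoint from the segment from `a` to `b`, only finitely many points of the
segment are of the form `z ⊓ b`. -/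
theorem IsCompact.finite_setOf_exists_inf_eq {K : Set X} (hK : IsCompact K) {a b : X}
    (h : Disjoint K (Icc a b)) : {m ∈ Icc a b | ∃ z ∈ K, z ⊓ b = m}.Finite := by
  refine hK.induction_on (p := fun K => {m ∈ Icc a b | ∃ z ∈ K, z ⊓ b = m}.Finite) (by simp)
    (fun s t hst ht => ht.subset ?_) (fun s t hs ht => (hs.union ht).subset ?_) fun ζ hζ => ?_
  · rintro m ⟨hm, z, hz, e⟩
    exact ⟨hm, z, hst hz, e⟩
  · rintro m ⟨hm, z, hz | hz, e⟩
    exacts [Or.inl ⟨hm, z, hz, e⟩, Or.inr ⟨hm, z, hz, e⟩]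
  · by_cases ha : a ≤ ζ
    · have hlt : ζ ⊓ b < ζ := inf_lt_left.2 fun hζb => h.notMem_of_mem_left hζ ⟨ha, hζb⟩
      -- All points near `ζ` lie above `c`, so they leave the segment where `ζ` does and share its
      -- meet with `b`.
      obtain ⟨c, h1, h2⟩ := exists_between_of_lt hlt
      refine ⟨{z | ¬ z ⊓ ζ ≤ c}, mem_nhdsWithin_of_mem_nhds (IsOpen.mem_nhds ?_ ?_),
        (finite_singleton (ζ ⊓ b)).subset ?_⟩
      · exact (isClosed_le (by fun_prop) continuous_const).isOpen_compl
      · change ¬ ζ ⊓ ζ ≤ c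
        rw [inf_idem]
        exact h2.not_ge
      · rintro _ ⟨-, z, hz, rfl⟩
        have hcz : c ≤ z := (le_inf_of_not_inf_le h2.le hz).trans inf_le_left
        refine le_antisymm (le_inf ?_ inf_le_right) (le_inf (h1.le.trans hcz) inf_le_right)
        rcases TreeSpace.total (inf_le_left : z ⊓ b ≤ z) hcz with h3 | h3
        · exact h3.trans h2.le
        · exact absurd (le_inf h2.le (h3.trans inf_le_right)) h1.not_ge
    · refine ⟨{z | ¬ a ≤ z}, mem_nhdsWithin_of_mem_nhds (IsOpen.mem_nhds ?_ ha),
        finite_empty.subset ?_⟩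
      · exact (isClosed_le continuous_const continuous_id).isOpen_compl
      · rintro _ ⟨hm, z, hz, rfl⟩
        exact hz (hm.1.trans inf_le_left)

/-- Take a segment from `a` to `x` inside `U`. Branches off this segment reach the compact
complement of `U` from only finitely many of its points, whereas points of order `p` are dense in
it. -/
theorem IsWazewskiTree.exists_branch_subset {P : Set ℕ∞} (hX : IsWazewskiTree P X) {p : ℕ∞}
    (hp : p ∈ P) {x : X} (hx : x ≠ ⊥) {U : Set X} (hU : U ∈ 𝓝 x) :
    ∃ m b, m < b ∧ pointOrder m = p ∧ pointOrder b = p ∧ branch m b ⊆ U := by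
  obtain ⟨C, hC, hconv, hCU⟩ := exists_tConvex_nhds (interior_mem_nhds.2 hU)
  obtain ⟨a, ha, hax⟩ := exists_mem_lt_of_mem_nhds hx hC
  have hIcc : Icc a x ⊆ interior U := fun z hz =>
    hCU (hconv a ha x (mem_of_mem_nhds hC) z (tbtw_of_le hz.1 hz.2))
  have hfin := isOpen_interior.isClosed_compl.isCompact.finite_setOf_exists_inf_eq
    (disjoint_compl_left_iff_subset.2 hIcc)
  by_contra! hn
  have key : ∀ m, a < m → m < x → pointOrder m = p →
      ∃ z ∈ (interior U)ᶜ, z ⊓ x = m := by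
    intro m h1 h2 h3
    obtain ⟨w, hw1, hw2, hw3⟩ := hX.exists_branch_lt hp ((hX.three_le p hp).trans_eq h3.symm) h2
    obtain ⟨z, hz, hzU⟩ := not_subset.1 (hn m w hw1 h3 hw3)
    rw [mem_branch_iff hw1.le] at hz
    refine ⟨z, fun h => hzU (interior_subset h), ?_⟩
    have hmz : m ≤ w ⊓ z := (TreeSpace.total hw1.le inf_le_left).resolve_right hz
    refine le_antisymm ?_ (le_inf (hmz.trans inf_le_right) h2.le)
    rcases TreeSpace.total (inf_le_right : w ⊓ z ≤ z) (inf_le_left : z ⊓ x ≤ z) with h4 | h4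
    · exact absurd ((le_inf inf_le_left (h4.trans inf_le_right)).trans_eq hw2) hz
    · exact (le_inf (h4.trans inf_le_left) inf_le_right).trans_eq hw2
  obtain ⟨m₀, h1, h2, h3⟩ := hX.exists_between p hp a x hax
  have hfin' : {m | a < m ∧ m < x ∧ pointOrder m = p}.Finite :=
    hfin.subset fun m hm => ⟨⟨hm.1.le, hm.2.1.le⟩, key m hm.1 hm.2.1 hm.2.2⟩
  -- A finite set of such points would have a maximal element, but density puts another one between
  -- it and `x`.
  obtain ⟨m, hm⟩ := hfin'.exists_maximal ⟨m₀, h1, h2, h3⟩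
  obtain ⟨m', h4, h5, h6⟩ := hX.exists_between p hp m x hm.prop.2.1
  exact h4.not_ge (hm.le_of_ge ⟨hm.prop.1.trans h4, h5, h6⟩ h4.le)

end

/-! ### Moving branches into open sets: minimality and expansion -/

namespace IsWazewskiDendrite

variable {X : Type*} [TopologicalSpace X] {P : Set ℕ∞}

theorem exists_branch_subset (hX : IsWazewskiDendrite P X) (hP : ∀ p ∈ P, 3 ≤ p) {p : ℕ∞}
    (hp : p ∈ P) {U : Set X} (hU : IsOpen U) (hUne : U.Nonempty) :
    ∃ m b, b ≠ m ∧ pointOrder m = p ∧ pointOrder b = p ∧ branch m b ⊆ U := by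
  obtain ⟨x, hx⟩ := hUne
  have := hX.nontrivial
  obtain ⟨e, he⟩ := exists_ne x
  obtain ⟨_, _, _, rfl⟩ := hX.dendrite.exists_treeSpace e
  obtain ⟨m, b, h1, h2, h3, h4⟩ :=
    (hX.isWazewskiTree hP).exists_branch_subset hp he.symm (hU.mem_nhds hx)
  exact ⟨m, b, h1.ne', h2, h3, h4⟩

theorem exists_mem_branch (hX : IsWazewskiDendrite P X) (hP : ∀ p ∈ P, 3 ≤ p) {p : ℕ∞}
    (hp : p ∈ P) (x : X) :
    ∃ m b, b ≠ m ∧ b ≠ x ∧ pointOrder m = p ∧ pointOrder b = p ∧ x ∈ branch m b := by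
  have := hX.nontrivial
  obtain ⟨e, he⟩ := exists_ne x
  obtain ⟨_, _, _, rfl⟩ := hX.dendrite.exists_treeSpace e
  have hT := hX.isWazewskiTree hP
  obtain ⟨m, -, h2, h3⟩ := hT.exists_between p hp ⊥ x (bot_lt_iff_ne_bot.2 he.symm)
  obtain ⟨b, h4, h5, h6⟩ := hT.exists_between p hp m x h2
  refine ⟨m, b, h4.ne', h5.ne, h3, h6, (mem_branch_iff h4.le).2 ?_⟩
  rw [inf_eq_left.2 h5.le]
  exact h4.not_ge

/-- Branches at points of order `p` can be moved into any nonempty open set. -/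
theorem exists_homeomorph_branch (hX : IsWazewskiDendrite P X) (hP : ∀ p ∈ P, 3 ≤ p) {p : ℕ∞}
    (hp : p ∈ P) {m b : X} (hmb : b ≠ m) (hm : pointOrder m = p) (hb : pointOrder b = p)
    {U : Set X} (hU : IsOpen U) (hUne : U.Nonempty) :
    ∃ g : X ≃ₜ X, ∀ x ∈ branch m b, g x ∈ U := by
  obtain ⟨m', b', h1, h2, h3, h4⟩ := hX.exists_branch_subset hP hp hU hUne
  obtain ⟨g, rfl, rfl⟩ := hX.exists_homeomorph hX hP ⟨p, hp⟩ ((hP p hp).trans_eq hm.symm)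
    ((hP p hp).trans_eq hb.symm) hmb h1 (hm.trans h2.symm) (hb.trans h3.symm)
  exact ⟨g, fun x hx => h4 ((map_mem_branch_iff g).2 hx)⟩

/-- Points of a Ważewski dendrite can be separated by homeomorphisms inside any open set. -/
theorem exists_forall_exists_mem (hX : IsWazewskiDendrite P X) (hP : ∀ p ∈ P, 3 ≤ p)
    (hne : P.Nonempty) : ∃ u v : X, u ≠ v ∧
      ∀ U : Set X, IsOpen U → U.Nonempty → ∃ g : X ≃ₜ X, ∃ x ∈ U, ∃ y ∈ U, g x = u ∧ g y = v := by
  obtain ⟨p, hp⟩ := hne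
  have := hX.nontrivial
  obtain ⟨x, -⟩ := exists_pair_ne X
  obtain ⟨m, b, h1, h2, h3, h4, h5⟩ := hX.exists_mem_branch hP hp x
  refine ⟨x, b, h2.symm, fun U hU hUne => ?_⟩
  obtain ⟨g, hg⟩ := hX.exists_homeomorph_branch hP hp h1 h3 h4 hU hUne
  exact ⟨g.symm, g x, hg x h5, g b, hg b (mem_branch_self h1), g.symm_apply_apply x,
    g.symm_apply_apply b⟩

theorem isMinimal (hX : IsWazewskiDendrite P X) (hP : ∀ p ∈ P, 3 ≤ p) (hne : P.Nonempty) :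
    MulAction.IsMinimal (X ≃ₜ X) X where
  dense_orbit x := by
    obtain ⟨p, hp⟩ := hne
    obtain ⟨m, b, h1, -, h3, h4, h5⟩ := hX.exists_mem_branch hP hp x
    refine dense_iff_inter_open.2 fun U hU hUne => ?_
    obtain ⟨g, hg⟩ := hX.exists_homeomorph_branch hP hp h1 h3 h4 hU hUne
    exact ⟨g x, hg x h5, g, rfl⟩

end IsWazewskiDendrite

theorem IsWazewskiDendrite.not_isHereditarilyNonsensitive {X : Type*} [MetricSpace X]
    {P : Set ℕ∞} (hX : IsWazewskiDendrite P X) (hP : ∀ p ∈ P, 3 ≤ p) (hne : P.Nonempty) :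
    ¬ IsHereditarilyNonsensitive (X ≃ₜ X) X := by
  intro h
  obtain ⟨u, v, huv, key⟩ := hX.exists_forall_exists_mem hP hne
  obtain ⟨O, hO, hOne, hV⟩ := h univ isClosed_univ ⟨u, trivial⟩ (fun _ _ _ => trivial) _
    (Metric.dist_mem_uniformity (dist_pos.2 huv))
  rw [inter_univ] at hOne
  obtain ⟨g, x, hx, y, hy, rfl, rfl⟩ := key O hO hOne
  have : dist (g x) (g y) < dist (g x) (g y) := hV g x ⟨hx, trivial⟩ y ⟨hy, trivial⟩
  exact this.false

theorem IsWazewskiDendrite.not_isEquicontinuousSystem {X : Type*} [MetricSpace X]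
    {P : Set ℕ∞} (hX : IsWazewskiDendrite P X) (hP : ∀ p ∈ P, 3 ≤ p) (hne : P.Nonempty) :
    ¬ IsEquicontinuousSystem (X ≃ₜ X) X := by
  intro h
  obtain ⟨u, v, huv, key⟩ := hX.exists_forall_exists_mem hP hne
  obtain ⟨δ, hδ, hV⟩ := Metric.equicontinuousAt_iff.1 (h u) _ (half_pos (dist_pos.2 huv))
  obtain ⟨g, x, hx, y, hy, h1, h2⟩ :=
    key (Metric.ball u δ) Metric.isOpen_ball ⟨u, Metric.mem_ball_self hδ⟩
  have hgx : dist (g u) (g x) < _ := hV x hx g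
  have hgy : dist (g u) (g y) < _ := hV y hy g
  have := dist_triangle_left u v (g u)
  rw [h1] at hgx
  rw [h2] at hgy
  linarith

/-! ### Small homeomorphisms -/

open Classical in
/-- A homeomorphism `g` with a fixed point `m` that maps `A` onto a disjoint set `B` gives an
involution exchanging `A` and `B` and fixing everything else. -/
theorem exists_homeomorph_swap {X : Type*} [TopologicalSpace X] {m : X} {A B : Set X}
    (hA : IsOpen A) (hB : IsOpen B) (hAB : Disjoint A B) (hmA : m ∉ A) (hmB : m ∉ B)
    (hA' : IsClosed (insert m A)) (hB' : IsClosed (insert m B)) (g : X ≃ₜ X) (hgm : g m = m)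
    (hg : ∀ x, g x ∈ B ↔ x ∈ A) :
    ∃ f : X ≃ₜ X, (∀ x ∈ A, f x = g x) ∧ ∀ x, x ∉ A → x ∉ B → f x = x := by
  have hgs : ∀ x, g.symm x ∈ A ↔ x ∈ B := fun x => by rw [← hg, g.apply_symm_apply]
  have hgm' : g.symm m = m := by rw [g.symm_apply_eq, hgm]
  let f : X → X := fun x => if x ∈ A then g x else if x ∈ B then g.symm x else x
  have fA : ∀ x ∈ A, f x = g x := fun x hx => if_pos hx
  have fB : ∀ x ∈ B, f x = g.symm x := fun x hx =>
    (if_neg fun h => hAB.notMem_of_mem_left h hx).trans (if_pos hx)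
  have fN : ∀ x, x ∉ A → x ∉ B → f x = x := fun x h1 h2 => (if_neg h1).trans (if_neg h2)
  have hinv : Function.Involutive f := by
    intro x
    by_cases h1 : x ∈ A
    · rw [fA x h1, fB _ ((hg x).2 h1), g.symm_apply_apply]
    · by_cases h2 : x ∈ B
      · rw [fB x h2, fA _ ((hgs x).2 h2), g.apply_symm_apply]
      · rw [fN x h1 h2, fN x h1 h2]
  -- The pieces are glued along the closed sets `A ∪ {m}`, `B ∪ {m}` and the complement of `A ∪ B`;
  -- the fixed point `m` makes the definitions agree.
  have hc : Continuous f := by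
    have c1 : ContinuousOn f (insert m A) := g.continuous.continuousOn.congr <| by
      rintro x (rfl | hx)
      exacts [(fN _ hmA hmB).trans hgm.symm, fA x hx]
    have c2 : ContinuousOn f (insert m B) := g.symm.continuous.continuousOn.congr <| by
      rintro x (rfl | hx)
      exacts [(fN _ hmA hmB).trans hgm'.symm, fB x hx]
    have c3 : ContinuousOn f (A ∪ B)ᶜ := continuous_id.continuousOn.congr fun x hx =>
      fN x (fun h => hx (Or.inl h)) fun h => hx (Or.inr h)
    rw [← continuousOn_univ]
    refine ((c1.union_of_isClosed c2 hA' hB').union_of_isClosed c3 (hA'.union hB')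
      (hA.union hB).isClosed_compl).mono fun x _ => ?_
    by_cases h : x ∈ A ∪ B
    exacts [Or.inl (h.imp Or.inr Or.inr), Or.inr h]
  exact ⟨⟨hinv.toPerm, hc, hc⟩, fA, fN⟩

section

variable {X : Type*} [TopologicalSpace X] [SemilatticeInf X] [OrderBot X] [TreeSpace X]

theorem isOpen_branch (m b : X) : IsOpen (branch m b) := by
  have : branch m b = {y | ¬ TBtw b m y} := Set.ext fun _ => mem_branch_iff_not_tbtw
  rw [this]
  exact isOpen_setOf_not_tbtw b m

theorem disjoint_branch {m b c : X} (h : TBtw b m c) : Disjoint (branch m b) (branch m c) := by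
  refine disjoint_left.2 fun z hb hc => ?_
  rw [mem_branch_iff_not_tbtw] at hb hc
  exact h.or.elim hb fun h' => hc h'.symm

theorem isClosed_insert_branch (m b : X) : IsClosed (insert m (branch m b)) := by
  refine isOpen_compl_iff.1 (isOpen_iff_mem_nhds.2 fun y hy => ?_)
  have hym : y ≠ m := fun e => hy (Or.inl e)
  have hby : TBtw b m y := by
    by_contra h
    exact hy (Or.inr (mem_branch_iff_not_tbtw.2 h))
  refine mem_of_superset ((isOpen_branch m y).mem_nhds (mem_branch_self hym)) ?_
  rintro z hz (rfl | hzb)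
  · exact hz fun C _ _ h => h
  · exact (disjoint_branch hby).notMem_of_mem_left hzb hz

end

namespace IsWazewskiDendrite

variable {X : Type*} [TopologicalSpace X] {P : Set ℕ∞}

/-- Choose `m` below `b` and exchange two branches at `b` that lead away from the root. Both lie in
the branch at `m` containing `b`, so nothing outside it moves. -/
theorem exists_homeomorph_eq_of_notMem_branch (hX : IsWazewskiDendrite P X)
    (hP : ∀ p ∈ P, 3 ≤ p) {p : ℕ∞} (hp : p ∈ P) :
    ∃ m b, b ≠ m ∧ pointOrder m = p ∧ pointOrder b = p ∧
      ∃ f : X ≃ₜ X, f ≠ 1 ∧ ∀ x, x ∉ branch m b → f x = x := by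
  have := hX.nontrivial
  obtain ⟨e, y, hey⟩ := exists_pair_ne X
  obtain ⟨_, _, _, rfl⟩ := hX.dendrite.exists_treeSpace e
  have hT := hX.isWazewskiTree hP
  obtain ⟨b, h0b, hby, hb⟩ := hT.exists_between p hp ⊥ y (bot_lt_iff_ne_bot.2 hey.symm)
  obtain ⟨m, -, hmb, hm⟩ := hT.exists_between p hp ⊥ b h0b
  have hbr : IsRamificationPoint b := (hP p hp).trans_eq hb.symm
  obtain ⟨u, hbu, -, hu⟩ := hT.exists_between p hp b y hby
  obtain ⟨v, hbv, huv, hv⟩ := hT.exists_branch_lt hp hbr hbu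
  have hsep : TBtw u b v := ⟨(inf_comm u v).trans_le huv.le, Or.inl hbu.le⟩
  have hne : u ≠ v := by
    rintro rfl
    exact hbu.ne' ((inf_idem u).symm.trans huv)
  obtain ⟨g, hgb, hgu⟩ := hX.exists_homeomorph hX hP ⟨p, hp⟩ hbr ((hP p hp).trans_eq hu.symm)
    hbu.ne' hbv.ne' rfl (hu.trans hv.symm)
  have hself : ∀ c, b ∉ branch b c := fun c h => h fun _ _ _ h => h
  obtain ⟨f, hfu, hf⟩ := exists_homeomorph_swap (isOpen_branch b u) (isOpen_branch b v)
    (disjoint_branch hsep) (hself u) (hself v) (isClosed_insert_branch b u)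
    (isClosed_insert_branch b v) g hgb fun x => by
      have := map_mem_branch_iff g (m := b) (b := u) (y := x)
      rwa [hgb, hgu] at this
  have hsub : ∀ c, b < c → ∀ x, x ∉ branch m b → x ∉ branch b c := by
    intro c hbc x hx hxc
    rw [mem_branch_iff hmb.le, not_not] at hx
    rw [mem_branch_iff hbc.le] at hxc
    have hbx : b ≤ x := ((TreeSpace.total hbc.le inf_le_left).resolve_right hxc).trans inf_le_right
    exact hmb.not_ge ((inf_eq_left.2 hbx).symm.trans_le hx)
  refine ⟨m, b, hmb.ne', hm, hb, f, fun h => hne ?_, fun x hx =>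
    hf x (hsub u hbu x hx) (hsub v hbv x hx)⟩
  have := hfu u (mem_branch_self hbu.ne')
  rw [hgu, h] at this
  exact this

/-- Conjugating by a homeomorphism that moves the supporting branch into `U` moves the support into
`U`. -/
theorem exists_homeomorph_ne_one (hX : IsWazewskiDendrite P X) (hP : ∀ p ∈ P, 3 ≤ p)
    (hne : P.Nonempty) {U : Set X} (hU : IsOpen U) (hUne : U.Nonempty) :
    ∃ f : X ≃ₜ X, f ≠ 1 ∧ ∀ x, x = f x ∨ x ∈ U ∧ f x ∈ U := by
  obtain ⟨p, hp⟩ := hne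
  obtain ⟨m, b, hmb, hm, hb, f, hf1, hf⟩ := hX.exists_homeomorph_eq_of_notMem_branch hP hp
  obtain ⟨g, hg⟩ := hX.exists_homeomorph_branch hP hp hmb hm hb hU hUne
  refine ⟨g * f * g⁻¹, fun h => hf1 (by simpa using h), fun x => ?_⟩
  have hfx : (g * f * g⁻¹) x = g (f (g.symm x)) := rfl
  rw [hfx]
  by_cases h : g.symm x ∈ branch m b
  · refine Or.inr ⟨g.apply_symm_apply x ▸ hg _ h, hg _ ?_⟩
    by_contra h'
    rw [f.injective (hf _ h')] at h'
    exact h' h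
  · exact Or.inl (by rw [hf _ h, g.apply_symm_apply])

end IsWazewskiDendrite

theorem IsWazewskiDendrite.exists_tendsto {X : Type*} [MetricSpace X] {P : Set ℕ∞}
    (hX : IsWazewskiDendrite P X) (hP : ∀ p ∈ P, 3 ≤ p) (hne : P.Nonempty) :
    ∃ g : ℕ → (X ≃ₜ X), (∀ i, g i ≠ 1) ∧ ∀ x : X, Tendsto (fun i => g i x) atTop (𝓝 x) := by
  have := hX.nontrivial
  obtain ⟨x₀, -⟩ := exists_pair_ne X
  choose g hg1 hg using fun n : ℕ => hX.exists_homeomorph_ne_one hP hne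
    (Metric.isOpen_ball (x := x₀) (ε := 1 / ((n : ℝ) + 1)))
    ⟨x₀, Metric.mem_ball_self Nat.one_div_pos_of_nat⟩
  refine ⟨g, hg1, fun x => ?_⟩
  have h0 : Tendsto (fun n : ℕ => 1 / ((n : ℝ) + 1) + 1 / ((n : ℝ) + 1)) atTop (𝓝 0) := by
    simpa using (tendsto_one_div_add_atTop_nhds_zero_nat (𝕜 := ℝ)).add
      tendsto_one_div_add_atTop_nhds_zero_nat
  refine tendsto_iff_dist_tendsto_zero.2 (squeeze_zero (fun _ => dist_nonneg) (fun n => ?_) h0)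
  rcases hg n x with h | ⟨h1, h2⟩
  · rw [← h, dist_self]
    positivity
  · exact (dist_triangle_right _ _ x₀).trans
      (add_le_add (Metric.mem_ball.1 h2).le (Metric.mem_ball.1 h1).le)

theorem IsWazewskiDendrite.isRigidSystem {X : Type*} [MetricSpace X] {P : Set ℕ∞}
    (hX : IsWazewskiDendrite P X) (hP : ∀ p ∈ P, 3 ≤ p) (hne : P.Nonempty) :
    IsRigidSystem (X ≃ₜ X) X := by
  obtain ⟨g, hg, hlim⟩ := hX.exists_tendsto hP hne
  exact ⟨fun i => g i, fun i => ⟨subset_closure ⟨g i, rfl⟩, fun h =>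
    hg i (Homeomorph.ext fun x => congrFun h x)⟩, tendsto_pi_nhds.2 hlim⟩

/-! ### Tameness -/

/-- The natural action of `Homeo(X)` on a compact Hausdorff space is a dynamical system. -/
theorem isDynamicalSystem_homeomorph (X : Type*) [TopologicalSpace X] [CompactSpace X]
    [T2Space X] : IsDynamicalSystem (X ≃ₜ X) X := by
  have hind : IsInducing (fun f : X ≃ₜ X =>
    ((⟨f, f.continuous⟩ : C(X, X)), (⟨f.symm, f.symm.continuous⟩ : C(X, X)))) := ⟨rfl⟩
  have h1 : Continuous fun f : X ≃ₜ X => (⟨f, f.continuous⟩ : C(X, X)) :=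
    continuous_fst.comp hind.continuous
  have h2 : Continuous fun f : X ≃ₜ X => (⟨f.symm, f.symm.continuous⟩ : C(X, X)) :=
    continuous_snd.comp hind.continuous
  refine ⟨{ continuous_mul := ?_, continuous_inv := ?_ }, inferInstance, ⟨?_⟩⟩
  · refine hind.continuous_iff.2 (Continuous.prodMk ?_ ?_)
    · exact (h1.comp continuous_fst).compCM (h1.comp continuous_snd)
    · exact (h2.comp continuous_snd).compCM (h2.comp continuous_fst)
  · exact hind.continuous_iff.2 (h2.prodMk h1)
  · exact (h1.comp continuous_fst).eval continuous_snd

theorem IsHalfSpace.preimage {X : Type*} [SemilatticeInf X] {k : X → X} (hk : ∀ x y z, TBtw x z y → TBtw (k x) (k z) (k y))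
    {H : Set X} (hH : IsHalfSpace H) : IsHalfSpace (k ⁻¹' H) :=
  ⟨fun x hx y hy z h => hH.1 _ hx _ hy _ (hk x y z h),
    fun x hx y hy z h => hH.2 _ hx _ hy _ (hk x y z h)⟩

section

variable {X : Type*} [TopologicalSpace X] [SemilatticeInf X] [OrderBot X] [TreeSpace X]

theorem tbtw_of_mem_ellisSemigroup {k : X → X} (hk : k ∈ ellisSemigroup (X ≃ₜ X) X) {x y z : X}
    (h : TBtw x z y) : TBtw (k x) (k z) (k y) := by
  have hc : IsClosed {k : X → X | TBtw (k x) (k z) (k y)} :=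
    isClosed_tbtw.preimage (f := fun k : X → X => (k x, k z, k y)) (by fun_prop)
  refine closure_minimal ?_ hc hk
  rintro _ ⟨g, rfl⟩
  exact (tbtw_map_homeomorph g).2 h

/-- Betweenness preserving self-maps of a dendrite are of Baire class one. -/
theorem isBaireClassOne_of_tbtw {k : X → X}
    (hk : ∀ x y z, TBtw x z y → TBtw (k x) (k z) (k y)) : IsBaireClassOne k := by
  intro U hU
  let _ : MetricSpace X := TopologicalSpace.metrizableSpaceMetric X
  choose! F hFfin hF hFx hFU using fun x (hx : x ∈ U) => exists_halfSpaces_nhds (hU.mem_nhds hx)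
  -- By second countability `U` is a countable union of finite intersections of half-spaces. The
  -- preimages of their complements are half-spaces, hence open or closed, hence Gδ by
  -- metrizability.
  obtain ⟨t, htU, ht, hcov⟩ := TopologicalSpace.countable_cover_nhdsWithin
    (f := fun x => ⋂₀ F x) fun x hx => mem_nhdsWithin_of_mem_nhds (hFx x hx)
  have : (k ⁻¹' U)ᶜ = ⋂ x ∈ t, ⋃ H ∈ F x, k ⁻¹' Hᶜ := by
    have hUeq : U = ⋃ x ∈ t, ⋂₀ F x :=
      hcov.antisymm (iUnion₂_subset fun x hx => hFU x (htU hx))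
    conv_lhs => rw [hUeq]
    ext y
    simp
  rw [this]
  refine IsGδ.biInter ht fun x hx => IsGδ.biUnion (hFfin x (htU hx)) fun H hH => ?_
  rcases ((hF x (htU hx) H hH).compl.preimage hk).isOpen_or_isClosed with h | h
  exacts [h.isGδ, h.isGδ]

end

/-- Self-maps of `X` become real functions on `X × ℕ` through the coordinates of an embedding into
`ℓ^∞`. Replacing `X` by its image there gives a Polish space in the lowest universe, as the
definition demands. -/
theorem isRosenthalCompactum_of_isBaireClassOne {X : Type*} [MetricSpace X] [CompactSpace X]
    {E : Set (X → X)} (hE : IsClosed E) (h : ∀ k ∈ E, IsBaireClassOne k) :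
    IsRosenthalCompactum E := by
  have hEc : CompactSpace E := isCompact_iff_compactSpace.1 hE.isCompact
  obtain ⟨ψ, hψ⟩ := TopologicalSpace.exists_embedding_l_infty X
  have hψn : ∀ n, Continuous fun x => ψ x n := fun n =>
    (continuous_eval_const (F := BoundedContinuousFunction ℕ ℝ) n).comp hψ.continuous
  let e := hψ.toHomeomorph
  have : CompactSpace (range ψ) := e.compactSpace
  refine ⟨hEc, range ψ × ℕ, inferInstance, inferInstance,
    fun k y => ψ (k.1 (e.symm y.1)) y.2, ?_, ?_⟩
  · refine (Continuous.isClosedEmbedding ?_ ?_).isEmbedding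
    · exact continuous_pi fun y => (hψn y.2).comp
        ((continuous_apply (e.symm y.1)).comp continuous_subtype_val)
    · intro k k' hkk
      refine Subtype.ext (funext fun x => hψ.injective ?_)
      ext n
      simpa using congrFun hkk (e x, n)
  · intro k U hU
    have : ((fun y : range ψ × ℕ => ψ (k.1 (e.symm y.1)) y.2) ⁻¹' U)ᶜ =
        ⋂ n : ℕ, (Prod.snd ⁻¹' {n}ᶜ ∪
          (fun y : range ψ × ℕ => e.symm y.1) ⁻¹' (k.1 ⁻¹' ((fun x => ψ x n) ⁻¹' U))ᶜ) := by
      ext y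
      simp only [mem_compl_iff, mem_preimage, mem_iInter, mem_union, mem_singleton_iff]
      exact ⟨fun hy n => or_iff_not_imp_left.2 fun hn => not_not.1 hn ▸ hy,
        fun hy => (hy y.2).resolve_left (not_not.2 rfl)⟩
    rw [this]
    refine IsGδ.iInter fun n => IsGδ.union ?_ ?_
    · exact ((isOpen_discrete _).preimage continuous_snd).isGδ
    · exact (h k.1 k.2 _ (hU.preimage (hψn n))).preimage (by fun_prop)

theorem IsDendrite.isTameSystem {X : Type*} [MetricSpace X] [Nonempty X] (hX : IsDendrite X) :
    IsTameSystem (X ≃ₜ X) X := by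
  have := hX.compact
  refine isRosenthalCompactum_of_isBaireClassOne isClosed_closure fun k hk => ?_
  obtain ⟨e⟩ := ‹Nonempty X›
  obtain ⟨_, _, _, -⟩ := hX.exists_treeSpace e
  exact isBaireClassOne_of_tbtw fun x y z => tbtw_of_mem_ellisSemigroup hk

theorem mainTheorem5 (P : Set ℕ∞) (hP : ∀ p ∈ P, 3 ≤ p) (hne : P.Nonempty) :
    (∃ (X : Type) (_ : MetricSpace X), IsWazewskiDendrite P X) ∧
    ∀ (X : Type u) [MetricSpace X], IsWazewskiDendrite P X →
      IsDynamicalSystem (X ≃ₜ X) X ∧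
      (∃ g : ℕ → (X ≃ₜ X), (∀ i, g i ≠ 1) ∧ ∀ x : X, Tendsto (fun i => g i x) atTop (𝓝 x)) ∧
      IsRigidSystem (X ≃ₜ X) X ∧
      IsTameSystem (X ≃ₜ X) X ∧
      MulAction.IsMinimal (X ≃ₜ X) X ∧
      ¬ IsHereditarilyNonsensitive (X ≃ₜ X) X ∧
      ¬ IsEquicontinuousSystem (X ≃ₜ X) X := by
  refine ⟨exists_isWazewskiDendrite hP hne, fun X _ hX => ?_⟩
  have := hX.dendrite.compact
  have := hX.nontrivial
  exact ⟨isDynamicalSystem_homeomorph X, hX.exists_tendsto hP hne, hX.isRigidSystem hP hne,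
    hX.dendrite.isTameSystem, hX.isMinimal hP hne, hX.not_isHereditarilyNonsensitive hP hne,
    hX.not_isEquicontinuousSystem hP hne⟩
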